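/- **Notation.** Let $\mathbb T^2$ be the two-dimensional torus with its Haar measure of total mass one and, for $n\in\mathbb Z^2$, $e_n(x)=e^{in\cdot x}$ (harmless factors $2\pi$ are dropped, i.e. $\mathbb T^2=(\mathbb R/2\pi\mathbb Z)^2$ with normalised measure, so that $\Delta e_n=-|n|^2e_n$). All functions are real-valued; $\widehat f_n=\int_{\mathbb T^2} f\,\overline{e_n}$, $\langle n\rangle=(1+|n|^2)^{1/2}$, $J=\sqrt{1-\Delta}$ is the Fourier multiplier $\langle n\rangle$, and $\pi_Nf=\sum_{|n|\le N}\widehat f_n e_n$ for $N\in\mathbb N$. The truncated nonlinear Klein–Gordon system is $$\partial_t u=v,\qquad \partial_t v=\Delta u-u-\pi_N\big((\pi_Nu)^3\big). \tag{1}$$ Its truncated energy is $$E_N(u,v)=\tfrac12\int_{\mathbb T^2}\big(u^2+|\nabla u|^2+v^2\big)\,dx+\tfrac14\int_{\mathbb T^2}(\pi_Nu)^4\,dx,\qquad (u,v)\in H^1(\mathbb T^2)\times L^2(\mathbb T^2).$$ For an integer $s\ge2$, $\mu_s$ is the law of the pair of random series $$u^\omega=\sum_{n\in\mathbb Z^2}\frac{g_n(\omega)}{\langle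 n\rangle^{s+1}}e_n,\qquad v^\omega=\sum_{n\in\mathbb Z^2}\frac{h_n(\omega)}{\langle n\rangle^{s}}e_n,$$ where $g_{-n}=\overline{g_n}$, $h_{-n}=\overline{h_n}$ and, for $n$ in $\Lambda=(\mathbb Z\times\mathbb Z_{>0})\cup(\mathbb Z_{>0}\times\{0\})\cup\{(0,0)\}$, the $g_n,h_n$ are independent standard Gaussians (real-valued for $n=0$, complex-valued with $\mathbb E|g_n|^2=\mathbb E|h_n|^2=1$ for $n\ne0$). It is a probability measure carried by $H^1(\mathbb T^2)\times L^2(\mathbb T^2)$. With $$\sigma_N=\mathbb E_{\mu_s}\Big[\int_{\mathbb T^2}(J^s\pi_Nu)^2\,dx\Big],$$ the renormalized energy is $$E_{s,N}(u,v)=\tfrac12\int_{\mathbb T^2}(J^sv)^2+\tfrac12\int_{\mathbb T^2}(J^{s+1}u)^2+\tfrac32\int_{\mathbb T^2}(J^s\pi_Nu)^2(\pi_Nu)^2-\tfrac32\,\sigma_N\int_{\mathbb T^2}(\pi_Nu)^2 .$$ **Theorem 1.3 (renormalized energy estimate).** Let $s\ge2$ be an even integer. For every $N\in\mathbb N$ the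 system (1) has, for each initial datum in $H^1(\mathbb T^2)\times L^2(\mathbb T^2)$, exactly one global solution in $C(\mathbb R;H^1(\mathbb T^2)\times L^2(\mathbb T^2))$; let $\Phi_N(t)$ be the resulting flow. For every $(u,v)\in H^1(\mathbb T^2)\times L^2(\mathbb T^2)$ the function $t\mapsto E_{s,N}(\pi_N\Phi_N(t)(u,v))$ is differentiable at $t=0$. Moreover, given $r>0$, there is a constant $C$ (depending only on $s$ and $r$) such that $$\Bigg\{\int_{\{E_N(u,v)\le r\}}\Big|\partial_tE_{s,N}(\pi_N\Phi_N(t)(u,v))\big|_{t=0}\Big|^p\,d\mu_s(u,v)\Bigg\}^{1/p}\le Cp$$ for every real $p\ge2$ and every $N\in\mathbb N$, the integrand being integrable. -/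

import Mathlib

open MeasureTheory ProbabilityTheory Filter Topology
open scoped ENNReal

noncomputable section

namespace NLKG

/-! ### The torus, its Fourier series, Sobolev norms

The torus is `T² = (ℝ/ℤ)²`, with its Haar measure of total mass one. The exponential of frequency
`n ∈ ℤ²`, written `e^{i n·x}` (harmless factors `2π` being dropped), is `UnitAddTorus.mFourier n`.
Accordingly derivatives are normalised so that `Δ e_n = -|n|² e_n`; equivalently one works on
`(ℝ/2πℤ)²` with normalised measure. -/

/-- The two-dimensional torus. -/
abbrev T2 : Type := UnitAddTorus (Fin 2)

/-- The lattice of frequencies `ℤ²`. -/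
abbrev Freq : Type := Fin 2 → ℤ

/-- The Haar probability measure on the torus. -/
abbrev haar : Measure T2 := Measure.pi fun _ : Fin 2 => AddCircle.haarAddCircle

/-- Real-valued square integrable functions on the torus. -/
abbrev L2 : Type := Lp ℝ 2 haar

instance : MeasurableSpace L2 := borel L2

instance : BorelSpace L2 := ⟨rfl⟩

/-- `|n|²`. -/
def absSq (n : Freq) : ℝ := (n 0 : ℝ) ^ 2 + (n 1 : ℝ) ^ 2

/-- The Japanese bracket `⟨n⟩ = (1 + |n|²)^{1/2}`. -/
def bracket (n : Freq) : ℝ := √(1 + absSq n)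

/-- The frequencies with `|n| ≤ N` (each coordinate of such an `n` lies in `[-N, N]`). -/
def ball (N : ℕ) : Finset Freq :=
  open scoped Classical in
  (Fintype.piFinset fun _ : Fin 2 => Finset.Icc (-(N : ℤ)) N).filter
    fun n => absSq n ≤ (N : ℝ) ^ 2

/-- The Fourier coefficient `∫ f(x) e^{-i n·x} dx` of a real-valued function. -/
def coeff (f : T2 → ℝ) (n : Freq) : ℂ :=
  UnitAddTorus.mFourierCoeff (fun x => (f x : ℂ)) n

/-- The Dirichlet projector `π_N f = ∑_{|n| ≤ N} f̂_n e^{i n·x}`; the sum is real-valued because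
the coefficients of a real-valued `f` satisfy `f̂_{-n} = conj f̂_n`. -/
def proj (N : ℕ) (f : T2 → ℝ) : T2 → ℝ := fun x =>
  (∑ n ∈ ball N, coeff f n * UnitAddTorus.mFourier n x).re

/-- The Bessel potential `J^a f`, `J = √(1 - Δ)`: the function with Fourier coefficients
`⟨n⟩^a f̂_n`, defined by its Fourier series in `L²`. The series converges exactly when `f` belongs
to `H^a`, and is then real-valued. -/
def J (a : ℕ) (f : T2 → ℝ) : T2 → ℝ := fun x =>
  ((∑' n : Freq, ((bracket n : ℂ) ^ a * coeff f n) • UnitAddTorus.mFourierLp 2 n :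
    Lp ℂ 2 haar) x).re

/-- `f ∈ H¹(T²)`, for `f ∈ L²(T²)`. -/
def MemH1 (f : T2 → ℝ) : Prop := Summable fun n : Freq => bracket n ^ 2 * ‖coeff f n‖ ^ 2

/-- `‖f‖²_{H¹} = ∑ ⟨n⟩² |f̂_n|² = ∫ (f² + |∇f|²)`, for `f ∈ H¹(T²)`. -/
def h1NormSq (f : T2 → ℝ) : ℝ := ∑' n : Freq, bracket n ^ 2 * ‖coeff f n‖ ^ 2

/-! ### The truncated equation -/

/-- `W = (u, v)` is a global solution in `C(ℝ; H¹ × L²)` of the truncated equation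
`∂ₜ u = v`, `∂ₜ v = Δu - u - π_N ((π_N u)³)`. The equation is tested against every exponential
`e^{i n·x}`, i.e. it holds in the sense of distributions on the torus. -/
structure IsSolution (N : ℕ) (W : ℝ → L2 × L2) : Prop where
  memH1 : ∀ t, MemH1 (W t).1
  continuous_fst : ∀ t₀, Tendsto (fun t => h1NormSq ((W t).1 - (W t₀).1 : L2)) (𝓝 t₀) (𝓝 0)
  continuous_snd : Continuous fun t => (W t).2
  eq_fst : ∀ (n : Freq) (t : ℝ),
    HasDerivAt (fun τ => coeff (W τ).1 n) (coeff (W t).2 n) t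
  eq_snd : ∀ (n : Freq) (t : ℝ),
    HasDerivAt (fun τ => coeff (W τ).2 n)
      (-(absSq n : ℂ) * coeff (W t).1 n - coeff (W t).1 n
        - if n ∈ ball N then coeff (fun x => proj N (W t).1 x ^ 3) n else 0) t

/-- The flow `Φ_N(t)` of the truncated equation on `H¹ × L²`: the value at time `t` of the solution
with initial datum `w`. -/
def flow (N : ℕ) (t : ℝ) (w : L2 × L2) : L2 × L2 :=
  open scoped Classical in
  if h : ∃ W, IsSolution N W ∧ W 0 = w then h.choose t else w

/-- The truncated energy
`E_N(u,v) = ½ ∫ (u² + |∇u|² + v²) + ¼ ∫ (π_N u)⁴`, for `(u, v) ∈ H¹ × L²`. -/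
def truncEnergy (N : ℕ) (w : L2 × L2) : ℝ :=
  1 / 2 * (h1NormSq w.1 + ∫ x, w.2 x ^ 2 ∂haar) + 1 / 4 * ∫ x, proj N w.1 x ^ 4 ∂haar

/-- The set `{E_N(u,v) ≤ r}` in `H¹ × L²`. -/
def energySublevel (N : ℕ) (r : ℝ) : Set (L2 × L2) :=
  {w | MemH1 w.1 ∧ truncEnergy N w ≤ r}

/-! ### The Gaussian measure `μ_s` -/

/-- The sample space: real numbers indexed by `Fin 2` (for the two families `g` and `h`), the
frequencies, and `Fin 2` (for real and imaginary parts). -/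
abbrev Sample : Type := Fin 2 × Freq × Fin 2 → ℝ

/-- All coordinates of the sample are independent standard real Gaussians. -/
def sampleMeasure : Measure Sample := Measure.infinitePi fun _ => gaussianReal 0 1

/-- The nonzero elements of the index set
`Λ = (ℤ × ℤ_{>0}) ∪ (ℤ_{>0} × {0}) ∪ {(0, 0)}`. -/
def IsPos (n : Freq) : Prop := 0 < n 1 ∨ (n 1 = 0 ∧ 0 < n 0)

/-- The standard complex Gaussian `(X + iY)/√2`, with `E|·|² = 1`, attached to a frequency. -/
def stdGaussian (k : Fin 2) (n : Freq) (ω : Sample) : ℂ :=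
  ((ω (k, n, 0) : ℂ) + Complex.I * (ω (k, n, 1) : ℂ)) / (√2 : ℝ)

/-- The families `g = gauss 0` and `h = gauss 1`: real standard Gaussian at `n = 0`, independent
standard complex Gaussians for nonzero `n ∈ Λ`, extended by `g_{-n} = conj g_n`. -/
def gauss (k : Fin 2) (n : Freq) (ω : Sample) : ℂ :=
  open scoped Classical in
  if n = 0 then (ω (k, 0, 0) : ℂ)
  else if IsPos n then stdGaussian k n ω
  else (starRingEnd ℂ) (stdGaussian k (-n) ω)

/-- The random Fourier series `∑ g_n ⟨n⟩^{-a} e^{i n·x}`, a series in `L²(T²; ℂ)` whose sum is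
real-valued. It converges almost surely for `a ≥ 2`. -/
def randomSeries (k : Fin 2) (a : ℕ) (ω : Sample) : L2 :=
  Complex.reCLM.compLp
    (∑' n : Freq, (gauss k n ω / (bracket n : ℂ) ^ a) • UnitAddTorus.mFourierLp 2 n :
      Lp ℂ 2 haar)

/-- The Gaussian measure `μ_s`: the law of `(∑ g_n ⟨n⟩^{-s-1} e_n, ∑ h_n ⟨n⟩^{-s} e_n)`. For
`s ≥ 2` it is carried by `H^σ × H^{σ-1}` for every `σ < s`, in particular by `H¹ × L²`. -/
def mu (s : ℕ) : Measure (L2 × L2) :=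
  sampleMeasure.map fun ω => (randomSeries 0 (s + 1) ω, randomSeries 1 s ω)

/-! The random series are measurable, so that `μ_s` is a genuine probability measure. -/

lemma measurable_gauss (k : Fin 2) (n : Freq) : Measurable (gauss k n) := by
  have h : ∀ m : Freq, Measurable (stdGaussian k m) := by
    intro m; unfold stdGaussian; fun_prop
  unfold gauss
  split_ifs
  · fun_prop
  · exact h n
  · exact Complex.continuous_conj.measurable.comp (h (-n))

lemma summable_series_iff (c : Freq → ℂ) :
    Summable (fun n => (c n • UnitAddTorus.mFourierLp 2 n : Lp ℂ 2 haar)) ↔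
      Summable fun n => ‖c n‖ ^ 2 := by
  have := (UnitAddTorus.orthonormal_mFourier (d := Fin 2)).orthogonalFamily.summable_iff_norm_sq_summable
    (fun n => c n)
  simpa using this

lemma measurable_randomSeries (k : Fin 2) (a : ℕ) : Measurable (randomSeries k a) := by
  let _ : MeasurableSpace (Lp ℂ 2 haar) := borel _
  have _ : SecondCountableTopology (Lp ℂ 2 haar) := by
    have _ : Fact ((2 : ℝ≥0∞) ≠ ⊤) := ⟨by simp⟩
    have _ : SigmaFinite haar := IsFiniteMeasure.toSigmaFinite haar
    infer_instance
  have _ : BorelSpace (Lp ℂ 2 haar) := ⟨rfl⟩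
  set c : Freq → Sample → ℂ := fun n ω => gauss k n ω / (bracket n : ℂ) ^ a with hc
  have hcm : ∀ n, Measurable (c n) := fun n => (measurable_gauss k n).div_const _
  set S : Set Sample := {ω | Summable fun n => ‖c n ω‖ ^ 2} with hS
  have hSm : MeasurableSet S := by
    have : S = {ω | ∑' n, ENNReal.ofReal (‖c n ω‖ ^ 2) ≠ ⊤} := by
      ext ω
      constructor
      · exact fun h => Summable.tsum_ofReal_ne_top h
      · intro h
        have := ENNReal.summable_toReal h
        refine this.congr fun n => ?_
        exact ENNReal.toReal_ofReal (by positivity)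
    rw [this]
    refine (measurableSet_singleton _).compl.preimage
      (f := fun ω => ∑' n, ENNReal.ofReal (‖c n ω‖ ^ 2)) ?_
    exact Measurable.tsum fun n => ((hcm n).norm.pow_const 2).ennreal_ofReal
  have hlim : Measurable fun ω =>
      (∑' n : Freq, c n ω • UnitAddTorus.mFourierLp 2 n : Lp ℂ 2 haar) := by
    refine measurable_of_tendsto_metrizable' (atTop : Filter (Finset Freq))
      (f := fun F => S.indicator fun ω => (∑ n ∈ F, c n ω • UnitAddTorus.mFourierLp 2 n : Lp ℂ 2 haar))
      (fun F => ?_) ?_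
    · refine Measurable.indicator ?_ hSm
      refine Finset.measurable_sum _ fun n _ => ?_
      exact (hcm n).smul_const (UnitAddTorus.mFourierLp 2 n : Lp ℂ 2 haar)
    · rw [tendsto_pi_nhds]
      intro ω
      by_cases h : ω ∈ S
      · simp only [Set.indicator_of_mem h]
        exact ((summable_series_iff fun n => c n ω).2 h).hasSum
      · simp only [Set.indicator_of_notMem h]
        rw [tsum_eq_zero_of_not_summable fun h' => h ((summable_series_iff fun n => c n ω).1 h')]
        exact tendsto_const_nhds
  exact (Complex.reCLM.compLpL 2 haar).continuous.measurable.comp hlim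

instance instIsProbabilityMeasureMu (s : ℕ) : IsProbabilityMeasure (mu s) := by
  have _ : IsProbabilityMeasure sampleMeasure := by unfold sampleMeasure; infer_instance
  exact Measure.isProbabilityMeasure_map
    ((measurable_randomSeries 0 (s + 1)).prodMk (measurable_randomSeries 1 s)).aemeasurable
/-! ### The renormalized energy -/

/-- `σ_N = E_{μ_s} [∫ (J^s π_N u)²]`. -/
def sigma (s N : ℕ) : ℝ := ∫ w, (∫ x, J s (proj N w.1) x ^ 2 ∂haar) ∂(mu s)

/-- The renormalized energy
`E_{s,N}(u,v) = ½ ∫ (J^s v)² + ½ ∫ (J^{s+1} u)² + (3/2) ∫ (J^s π_N u)² (π_N u)²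
  - (3/2) σ_N ∫ (π_N u)²`, for `(u, v) ∈ H^{s+1} × H^s`. -/
def renormEnergy (s N : ℕ) (u v : T2 → ℝ) : ℝ :=
  1 / 2 * ∫ x, J s v x ^ 2 ∂haar + 1 / 2 * ∫ x, J (s + 1) u x ^ 2 ∂haar
    + 3 / 2 * ∫ x, J s (proj N u) x ^ 2 * proj N u x ^ 2 ∂haar
    - 3 / 2 * sigma s N * ∫ x, proj N u x ^ 2 ∂haar

/-- `t ↦ E_{s,N}(π_N Φ_N(t)(u,v))`. -/
def energyAlongFlow (s N : ℕ) (w : L2 × L2) (t : ℝ) : ℝ :=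
  renormEnergy s N (proj N (flow N t w).1) (proj N (flow N t w).2)

end NLKG

end

open MeasureTheory ProbabilityTheory Filter Topology
open scoped ENNReal

noncomputable section

namespace NLKG

/-! ### Transport-entropy inequality for Gaussian product measures -/

/-! The estimate combines a deterministic bound with a Gaussian transport inequality. On the random
side only second moments are needed, and no hypercontractivity.

Along the flow the quadratic terms of the renormalized energy cancel. What remains is `energyRate`:
three times the Wick-ordered integral of `(J^s u)² u v`, minus a quartic sum with symbol `⟨n₄⟩^s
(⟨n₄⟩^s - 3⟨n₁⟩^s)`. Symmetrising over the three frequencies of `u` turns this symbol into the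
commutator `⟨d⟩^s (⟨d⟩^s - ⟨a⟩^s - ⟨b⟩^s - ⟨c⟩^s)` (`quad_comm_eq`). Since `a + b + c + d = 0`, it
gains a derivative: one power of the largest of `⟨a⟩, ⟨b⟩, ⟨c⟩` is replaced by one of the other two
(`abs_commSymbol_le`).

A sample `y` is typical if its two components are bounded by `M` in the regularities `s - 1/8` and
`s - 9/8`, and if the Wick square and the commutator, seen as random bilinear forms, have weighted
Hilbert–Schmidt norms at most `M`. The squares of these norms have means bounded independently of
`N`, so for a suitable `M` typical samples have probability at least 1/2
(`half_le_measure_typical`).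

Let `x` have bounded energy and let `y` be typical. The difference of the corresponding data is
bounded in `H^{s+1} × H^s` by `2|x - y|`, a Cameron–Martin direction. Put `τ² = 1 + 4|x - y|²`.
Expanding around `y` gives `|energyRate(x)| ≤ K τ²` (`norm_energyRate_le`). In the purely random
terms, Hilbert–Schmidt bounds meet two factors of size `τ`. In a mixed term one factor is a
difference of size `τ`, and interpolating the bounded energy norm with a rough norm of size `τ`
leaves `√τ` for each of two others. With two differences, the other two factors are controlled by
the energy alone.

The transport inequality says that `F(x) G(y) ≤ exp(|x - y|²/4)` implies `∫F ∫G ≤ 1`. On the line it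
is Prékopa–Leindler at midpoints, and it tensorises (`lintegral_mul_lintegral_infinitePi_le_one`).
Take for `G` the indicator of the typical samples and for `F` the function `exp(|energyRate|/(16K) -
1/16)` on the set of bounded energy: the integral of `F` is at most 2 for every `N`, and exponential
integrability yields moments of order `p` bounded by `(Cp)^p`.

For well-posedness, frequencies outside the ball evolve as free oscillators, and those inside obey a
finite-dimensional Hamiltonian equation whose conserved energy is coercive. -/

/-- The sum of the lengths of two sets of reals whose midpoints lie in an order-connected set. -/
lemma volume_add_volume_le {U V I : Set ℝ} (hU : U.Nonempty) (hV : V.Nonempty)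
    (hI : I.OrdConnected) (h : ∀ x ∈ U, ∀ y ∈ V, (x + y) / 2 ∈ I) :
    volume U + volume V ≤ 2 * volume I := by
  by_cases hfin : volume I = ⊤
  · simp [hfin]
  -- Volume is at most diameter, so sums of distances suffice. For `x ≤ x'` and `y ≤ y'` the
  -- interval between the two midpoints lies in `I` and has half the total length.
  have key : ∀ x ∈ U, ∀ x' ∈ U, ∀ y ∈ V, ∀ y' ∈ V, edist x x' + edist y y' ≤ 2 * volume I := by
    have aux : ∀ x ∈ U, ∀ x' ∈ U, ∀ y ∈ V, ∀ y' ∈ V, x ≤ x' → y ≤ y' →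
        edist x x' + edist y y' ≤ 2 * volume I := by
      intro x hx x' hx' y hy y' hy' hxx hyy
      have h1 : Set.Icc ((x + y) / 2) ((x' + y') / 2) ⊆ I := hI.out (h x hx y hy) (h x' hx' y' hy')
      have h2 := measure_mono (μ := volume) h1
      rw [Real.volume_Icc] at h2
      rw [edist_dist, edist_dist, Real.dist_eq, Real.dist_eq, abs_sub_comm x, abs_sub_comm y,
        abs_of_nonneg (sub_nonneg.2 hxx), abs_of_nonneg (sub_nonneg.2 hyy),
        ← ENNReal.ofReal_add (sub_nonneg.2 hxx) (sub_nonneg.2 hyy)]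
      calc ENNReal.ofReal (x' - x + (y' - y))
          = 2 * ENNReal.ofReal ((x' + y') / 2 - (x + y) / 2) := by
            rw [show (2 : ℝ≥0∞) = ENNReal.ofReal 2 by simp, ← ENNReal.ofReal_mul (by norm_num)]
            congr 1; ring
        _ ≤ _ := by gcongr
    intro x hx x' hx' y hy y' hy'
    rcases le_total x x' with hxx | hxx <;> rcases le_total y y' with hyy | hyy
    · exact aux x hx x' hx' y hy y' hy' hxx hyy
    · rw [edist_comm y]; exact aux x hx x' hx' y' hy' y hy hxx hyy
    · rw [edist_comm x]; exact aux x' hx' x hx y hy y' hy' hxx hyy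
    · rw [edist_comm x, edist_comm y]; exact aux x' hx' x hx y' hy' y hy hxx hyy
  have hV' : Metric.ediam V ≤ 2 * volume I := by
    obtain ⟨x, hx⟩ := hU
    refine Metric.ediam_le fun y hy y' hy' => ?_
    exact le_trans (by simp) (key x hx x hx y hy y' hy')
  have hU' : Metric.ediam U ≤ 2 * volume I - Metric.ediam V := by
    refine Metric.ediam_le fun x hx x' hx' => ?_
    have h2I : 2 * volume I ≠ ⊤ := ENNReal.mul_ne_top (by simp) hfin
    have h1 : Metric.ediam V ≤ 2 * volume I - edist x x' :=
      Metric.ediam_le fun y hy y' hy' =>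
        ENNReal.le_sub_of_add_le_left (edist_ne_top _ _) (key x hx x' hx' y hy y' hy')
    refine ENNReal.le_sub_of_add_le_right (ne_top_of_le_ne_top h2I hV') ?_
    have h3 : edist x x' ≤ 2 * volume I := by
      obtain ⟨y, hy⟩ := hV
      exact le_trans (by simp) (key x hx x' hx' y hy y hy)
    calc edist x x' + Metric.ediam V ≤ edist x x' + (2 * volume I - edist x x') := by gcongr
      _ = 2 * volume I := add_tsub_cancel_of_le h3
  calc volume U + volume V ≤ Metric.ediam U + Metric.ediam V :=
        add_le_add (Real.volume_le_diam U) (Real.volume_le_diam V)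
    _ ≤ (2 * volume I - Metric.ediam V) + Metric.ediam V := by gcongr
    _ = 2 * volume I := tsub_add_cancel_of_le hV'

/-- A normalised one-dimensional Prékopa–Leindler inequality. -/
lemma lintegral_add_lintegral_le_of_midpoint {f g φ : ℝ → ℝ} (hf : Measurable f)
    (hg : Measurable g) (hφ : Measurable φ) (hf0 : ∀ x, 0 ≤ f x) (hg0 : ∀ x, 0 ≤ g x)
    (hφ0 : ∀ x, 0 ≤ φ x) (hf1 : ∀ x, f x ≤ 1) (hg1 : ∀ x, g x ≤ 1)
    (hfs : ∀ t < 1, ∃ x, t < f x) (hgs : ∀ t < 1, ∃ x, t < g x)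
    (hconn : ∀ t, {z | t < φ z}.OrdConnected)
    (h : ∀ x y, f x * g y ≤ φ ((x + y) / 2) ^ 2) :
    (∫⁻ x, ENNReal.ofReal (f x)) + ∫⁻ x, ENNReal.ofReal (g x) ≤
      2 * ∫⁻ x, ENNReal.ofReal (φ x) := by
  rw [lintegral_eq_lintegral_meas_lt volume (ae_of_all _ hf0) hf.aemeasurable,
    lintegral_eq_lintegral_meas_lt volume (ae_of_all _ hg0) hg.aemeasurable,
    lintegral_eq_lintegral_meas_lt volume (ae_of_all _ hφ0) hφ.aemeasurable]
  have hm : ∀ ψ : ℝ → ℝ, Measurable fun t : ℝ => volume {a | t < ψ a} := fun ψ =>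
    Antitone.measurable fun s t hst => measure_mono fun x hx => lt_of_le_of_lt hst hx
  rw [← lintegral_add_left (hm f), ← lintegral_const_mul _ (hm φ)]
  refine setLIntegral_mono' measurableSet_Ioi fun t ht => ?_
  -- Below level 1 both superlevel sets are nonempty, and their midpoints lie in that of `φ` because
  -- `t ^ 2 < f x * g y`. From level 1 on, the left side vanishes.
  rcases lt_or_ge t 1 with ht1 | ht1
  · refine volume_add_volume_le (hfs t ht1) (hgs t ht1) (hconn t) fun x hx y hy => ?_
    have ht0 : (0 : ℝ) < t := ht
    have h1 : t ^ 2 < φ ((x + y) / 2) ^ 2 := by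
      refine lt_of_lt_of_le ?_ (h x y)
      rw [sq]
      exact mul_lt_mul'' hx hy ht0.le ht0.le
    exact lt_of_pow_lt_pow_left₀ 2 (hφ0 _) h1
  · have e1 : {a | t < f a} = ∅ := by
      ext a; simpa using (hf1 a).trans ht1
    have e2 : {a | t < g a} = ∅ := by
      ext a; simpa using (hg1 a).trans ht1
    simp [e1, e2]

lemma ordConnected_gaussianPDFReal (t : ℝ) : {z | t < gaussianPDFReal 0 1 z}.OrdConnected := by
  constructor
  intro x hx y hy z hz
  have hz2 : z ^ 2 ≤ max (x ^ 2) (y ^ 2) := by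
    rcases le_total 0 z with h | h
    · exact le_max_of_le_right (by nlinarith [hz.1, hz.2])
    · exact le_max_of_le_left (by nlinarith [hz.1, hz.2])
  have hmono : ∀ w : ℝ, z ^ 2 ≤ w ^ 2 → gaussianPDFReal 0 1 w ≤ gaussianPDFReal 0 1 z := by
    intro w hw
    simp only [gaussianPDFReal]
    gcongr ?_ * Real.exp ?_
    simp only [sub_zero]
    gcongr
  rcases le_max_iff.1 hz2 with h | h
  · exact lt_of_lt_of_le hx (hmono x h)
  · exact lt_of_lt_of_le hy (hmono y h)

/-- The parallelogram identity `x²/2 + y²/2 - (x-y)²/4 = ((x+y)/2)²` in the exponent. It dictates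
the constant 1/4 of the transport cost. -/
lemma gaussianPDFReal_mul_exp (x y : ℝ) :
    gaussianPDFReal 0 1 x * gaussianPDFReal 0 1 y * Real.exp ((x - y) ^ 2 / 4) =
      gaussianPDFReal 0 1 ((x + y) / 2) ^ 2 := by
  simp only [gaussianPDFReal]
  have : ∀ c a b d : ℝ, c * Real.exp a * (c * Real.exp b) * Real.exp d
      = c ^ 2 * Real.exp (a + b + d) := by
    intros; rw [Real.exp_add, Real.exp_add]; ring
  rw [this, mul_pow, ← Real.exp_nat_mul]
  congr 2
  push_cast
  ring

lemma lintegral_gaussianReal_zero_one {F : ℝ → ℝ≥0∞} (hF : Measurable F) :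
    ∫⁻ x, F x ∂gaussianReal 0 1 = ∫⁻ x, F x * gaussianPDF 0 1 x := by
  rw [gaussianReal_of_var_ne_zero 0 one_ne_zero,
    lintegral_withDensity_eq_lintegral_mul _ (measurable_gaussianPDF 0 1) hF]
  simp [mul_comm]

/-- The exponential transport inequality for the standard Gaussian measure on the line. -/
lemma lintegral_mul_lintegral_gaussianReal_le_one {F G : ℝ → ℝ≥0∞} (hF : Measurable F)
    (hG : Measurable G)
    (h : ∀ x y, F x * G y ≤ ENNReal.ofReal (Real.exp ((x - y) ^ 2 / 4))) :
    (∫⁻ x, F x ∂gaussianReal 0 1) * ∫⁻ x, G x ∂gaussianReal 0 1 ≤ 1 := by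
  rw [lintegral_gaussianReal_zero_one hF, lintegral_gaussianReal_zero_one hG]
  set u : ℝ → ℝ≥0∞ := fun x => F x * gaussianPDF 0 1 x with hu
  set v : ℝ → ℝ≥0∞ := fun x => G x * gaussianPDF 0 1 x with hv
  have hum : Measurable u := hF.mul (measurable_gaussianPDF 0 1)
  have hvm : Measurable v := hG.mul (measurable_gaussianPDF 0 1)
  have huv : ∀ x y, u x * v y ≤ ENNReal.ofReal (gaussianPDFReal 0 1 ((x + y) / 2) ^ 2) := by
    intro x y
    rw [← gaussianPDFReal_mul_exp, ENNReal.ofReal_mul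
      (mul_nonneg (gaussianPDFReal_nonneg _ _ _) (gaussianPDFReal_nonneg _ _ _)),
      ENNReal.ofReal_mul (gaussianPDFReal_nonneg _ _ _)]
    calc u x * v y = gaussianPDF 0 1 x * gaussianPDF 0 1 y * (F x * G y) := by
          simp only [hu, hv]; ring
      _ ≤ _ := by
          unfold gaussianPDF
          gcongr
          exact h x y
  by_cases hu0 : ∀ x, u x = 0
  · simp [funext hu0]
  by_cases hv0 : ∀ x, v x = 0
  · simp [funext hv0]
  push Not at hu0 hv0
  have hbdd : ∀ {p q : ℝ → ℝ≥0∞}, (∃ x, p x ≠ 0) →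
      (∀ x y, p x * q y ≤ ENNReal.ofReal (gaussianPDFReal 0 1 ((x + y) / 2) ^ 2)) →
      ⨆ y, q y ≠ ⊤ := by
    rintro p q ⟨x0, hx0⟩ hpq
    have hb : ∀ z, gaussianPDFReal 0 1 z ≤ gaussianPDFReal 0 1 0 := by
      intro z
      simp only [gaussianPDFReal]
      gcongr ?_ * Real.exp ?_
      rw [sub_zero, sub_zero, neg_div, neg_div, zero_pow two_ne_zero, zero_div, neg_zero]
      exact neg_nonpos.2 (by positivity)
    have : ∀ y, q y ≤ ENNReal.ofReal (gaussianPDFReal 0 1 0 ^ 2) / p x0 := by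
      intro y
      rw [ENNReal.le_div_iff_mul_le (Or.inl hx0) (Or.inr (by simp)), mul_comm]
      refine (hpq x0 y).trans (ENNReal.ofReal_le_ofReal ?_)
      gcongr
      · exact gaussianPDFReal_nonneg _ _ _
      · exact hb _
    exact ne_top_of_le_ne_top (ENNReal.div_ne_top (by simp) hx0) (iSup_le this)
  have hbtop := hbdd hu0 huv
  have hatop := hbdd hv0 fun x y => by
    rw [mul_comm, add_comm x y]; exact huv y x
  -- Dividing by the suprema makes the superlevel sets of both functions nonempty at every level
  -- below 1. The scale `c = √(ab)` of the Gaussian density compensates.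
  set a := ⨆ x, u x with ha
  set b := ⨆ x, v x with hb
  have ha0 : a ≠ 0 := by
    obtain ⟨x, hx⟩ := hu0
    exact fun h0 => hx (le_antisymm (h0 ▸ le_iSup u x) bot_le)
  have hb0 : b ≠ 0 := by
    obtain ⟨x, hx⟩ := hv0
    exact fun h0 => hx (le_antisymm (h0 ▸ le_iSup v x) bot_le)
  set f : ℝ → ℝ := fun x => (u x / a).toReal with hf
  set g : ℝ → ℝ := fun x => (v x / b).toReal with hg
  set c : ℝ := √(a.toReal * b.toReal) with hc
  have har : 0 < a.toReal := ENNReal.toReal_pos ha0 hatop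
  have hbr : 0 < b.toReal := ENNReal.toReal_pos hb0 hbtop
  have hc0 : 0 < c := Real.sqrt_pos.2 (mul_pos har hbr)
  have hc2 : c ^ 2 = a.toReal * b.toReal := Real.sq_sqrt (mul_pos har hbr).le
  have hule : ∀ x, u x / a ≤ 1 := fun x =>
    ENNReal.div_le_of_le_mul (by rw [one_mul]; exact le_iSup u x)
  have hvle : ∀ x, v x / b ≤ 1 := fun x =>
    ENNReal.div_le_of_le_mul (by rw [one_mul]; exact le_iSup v x)
  have hsup : ∀ {p : ℝ → ℝ≥0∞}, (⨆ x, p x) ≠ ⊤ → (⨆ x, p x) ≠ 0 → ∀ t < (1 : ℝ),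
      ∃ x, t < (p x / ⨆ x, p x).toReal := by
    intro p hpt hp0 t ht
    rcases lt_or_ge t 0 with ht0 | ht0
    · exact ⟨0, lt_of_lt_of_le ht0 ENNReal.toReal_nonneg⟩
    have h1 : ENNReal.ofReal t * (⨆ x, p x) < ⨆ x, p x := by
      conv_rhs => rw [← one_mul (⨆ x, p x)]
      refine ENNReal.mul_lt_mul_left hp0 hpt ?_
      rw [← ENNReal.ofReal_one]
      exact (ENNReal.ofReal_lt_ofReal_iff one_pos).2 ht
    obtain ⟨x, hx⟩ := lt_iSup_iff.1 h1
    refine ⟨x, ?_⟩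
    have h2 : ENNReal.ofReal t < p x / ⨆ x, p x := by
      rw [ENNReal.lt_div_iff_mul_lt (Or.inl hp0) (Or.inl hpt)]
      exact hx
    refine (ENNReal.ofReal_lt_iff_lt_toReal ht0 ?_).1 h2
    exact ENNReal.div_ne_top (ne_top_of_le_ne_top hpt (le_iSup p x)) hp0
  have main := lintegral_add_lintegral_le_of_midpoint (f := f) (g := g)
    (φ := fun z => gaussianPDFReal 0 1 z / c) (hum.div_const a).ennreal_toReal
    (hvm.div_const b).ennreal_toReal ((measurable_gaussianPDFReal 0 1).div_const c)
    (fun x => ENNReal.toReal_nonneg) (fun x => ENNReal.toReal_nonneg)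
    (fun x => div_nonneg (gaussianPDFReal_nonneg _ _ _) hc0.le)
    (fun x => ENNReal.toReal_le_of_le_ofReal zero_le_one (by simpa using hule x))
    (fun x => ENNReal.toReal_le_of_le_ofReal zero_le_one (by simpa using hvle x))
    (hsup hatop ha0) (hsup hbtop hb0)
    (fun t => by simpa only [lt_div_iff₀ hc0] using ordConnected_gaussianPDFReal (t * c))
    (fun x y => by
      have h1 := ENNReal.toReal_mono (by simp) (huv x y)
      rw [ENNReal.toReal_mul, ENNReal.toReal_ofReal (sq_nonneg _)] at h1
      simp only [hf, hg, ENNReal.toReal_div]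
      rw [div_pow, hc2, div_mul_div_comm]
      gcongr)
  have hfu : ∀ x, ENNReal.ofReal (f x) = u x / a := fun x =>
    ENNReal.ofReal_toReal (ne_top_of_le_ne_top ENNReal.one_ne_top (hule x))
  have hgv : ∀ x, ENNReal.ofReal (g x) = v x / b := fun x =>
    ENNReal.ofReal_toReal (ne_top_of_le_ne_top ENNReal.one_ne_top (hvle x))
  have hφ1 : ∫⁻ x, ENNReal.ofReal (gaussianPDFReal 0 1 x / c) = ENNReal.ofReal c⁻¹ := by
    simp_rw [div_eq_mul_inv, ENNReal.ofReal_mul (gaussianPDFReal_nonneg _ _ _)]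
    rw [lintegral_mul_const _ (measurable_gaussianPDFReal 0 1).ennreal_ofReal,
      lintegral_gaussianPDFReal_eq_one 0 one_ne_zero, one_mul]
  simp_rw [hfu, hgv, hφ1, div_eq_mul_inv] at main
  rw [lintegral_mul_const _ hum, lintegral_mul_const _ hvm] at main
  set A := (∫⁻ x, u x) * a⁻¹ with hA
  set B := (∫⁻ x, v x) * b⁻¹ with hB
  have hABtop : A + B ≠ ⊤ :=
    ne_top_of_le_ne_top (ENNReal.mul_ne_top (by simp) ENNReal.ofReal_ne_top) main
  have hAt : A ≠ ⊤ := fun h => hABtop (by simp [h])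
  have hBt : B ≠ ⊤ := fun h => hABtop (by simp [h])
  have hreal : A.toReal + B.toReal ≤ 2 * c⁻¹ := by
    have := ENNReal.toReal_mono (ENNReal.mul_ne_top (by simp) ENNReal.ofReal_ne_top) main
    rwa [ENNReal.toReal_add hAt hBt, ENNReal.toReal_mul (a := 2),
      ENNReal.toReal_ofReal (by positivity), ENNReal.toReal_ofNat] at this
  have e1 : ∫⁻ x, u x = A * a := by
    rw [hA, mul_assoc, ENNReal.inv_mul_cancel ha0 hatop, mul_one]
  have e2 : ∫⁻ x, v x = B * b := by
    rw [hB, mul_assoc, ENNReal.inv_mul_cancel hb0 hbtop, mul_one]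
  rw [e1, e2, ← ENNReal.toReal_le_toReal
    (ENNReal.mul_ne_top (ENNReal.mul_ne_top hAt hatop) (ENNReal.mul_ne_top hBt hbtop)) (by simp)]
  simp only [ENNReal.toReal_mul, ENNReal.toReal_one]
  have hA0 : 0 ≤ A.toReal := ENNReal.toReal_nonneg
  have hB0 : 0 ≤ B.toReal := ENNReal.toReal_nonneg
  have h4 : (A.toReal + B.toReal) * c ≤ 2 := by
    calc _ ≤ 2 * c⁻¹ * c := by gcongr
      _ = 2 := by field_simp
  -- The arithmetic–geometric mean inequality passes from the sum to the product.
  have h5 : A.toReal * B.toReal * c ^ 2 ≤ 1 := by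
    have h6 : 0 ≤ (A.toReal + B.toReal) * c := by positivity
    nlinarith [sq_nonneg ((A.toReal - B.toReal) * c)]
  rw [hc2] at h5
  linarith

/-- The exponential transport inequality, tensorised over finitely many coordinates. -/
lemma lmarginal_mul_lmarginal_le {ι : Type*} [DecidableEq ι] (I s : Finset ι) (hs : s ⊆ I)
    {F G : (ι → ℝ) → ℝ≥0∞} (hF : Measurable F) (hG : Measurable G)
    (h : ∀ x y, F x * G y ≤ ENNReal.ofReal (Real.exp ((∑ i ∈ I, (x i - y i) ^ 2) / 4))) :
    ∀ x y, (∫⋯∫⁻_s, F ∂fun _ => gaussianReal 0 1) x * (∫⋯∫⁻_s, G ∂fun _ => gaussianReal 0 1) y ≤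
      ENNReal.ofReal (Real.exp ((∑ i ∈ I \ s, (x i - y i) ^ 2) / 4)) := by
  induction s using Finset.induction_on with
  | empty => simpa using h
  | insert i s hi ih =>
    intro x y
    have ih' := ih ((Finset.subset_insert i s).trans hs)
    rw [lmarginal_insert F hF hi, lmarginal_insert G hG hi]
    -- The cost `c` of the coordinates not yet integrated stays frozen. The inequality on the line
    -- is applied in coordinate `i` to the marginals, after a division by `exp c`.
    set c : ℝ := (∑ j ∈ I \ insert i s, (x j - y j) ^ 2) / 4 with hc
    have hsplit : I \ s = insert i (I \ insert i s) := by
      ext j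
      have := hs (Finset.mem_insert_self i s)
      by_cases hj : j = i
      · subst hj; simp [hi, this]
      · simp [hj]
    have hsum : ∀ p q : ℝ, (∑ j ∈ I \ s, (Function.update x i p j - Function.update y i q j) ^ 2) / 4
        = (p - q) ^ 2 / 4 + c := by
      intro p q
      rw [hsplit, Finset.sum_insert (by simp), hc, add_div]
      congr 2
      · simp
      · refine Finset.sum_congr rfl fun j hj => ?_
        have : j ≠ i := by rintro rfl; simp at hj
        simp [Function.update_of_ne this]
    have hmF : Measurable fun p => (∫⋯∫⁻_s, F ∂fun _ => gaussianReal 0 1) (Function.update x i p) :=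
      (hF.lmarginal _).comp (measurable_update x)
    have hmG : Measurable fun q => (∫⋯∫⁻_s, G ∂fun _ => gaussianReal 0 1) (Function.update y i q) :=
      (hG.lmarginal _).comp (measurable_update y)
    have h1 := lintegral_mul_lintegral_gaussianReal_le_one
      (hmF.const_mul (ENNReal.ofReal (Real.exp (-c)))) hmG fun p q => by
        calc _ = ENNReal.ofReal (Real.exp (-c)) * ((∫⋯∫⁻_s, F ∂fun _ => gaussianReal 0 1)
              (Function.update x i p) * (∫⋯∫⁻_s, G ∂fun _ => gaussianReal 0 1)
              (Function.update y i q)) := by ring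
          _ ≤ ENNReal.ofReal (Real.exp (-c)) *
              ENNReal.ofReal (Real.exp ((p - q) ^ 2 / 4 + c)) := by
              gcongr
              exact (ih' _ _).trans_eq (by rw [hsum])
          _ = _ := by
              rw [← ENNReal.ofReal_mul (Real.exp_pos _).le, ← Real.exp_add]
              congr 2; ring
    rw [lintegral_const_mul _ hmF] at h1
    calc _ = ENNReal.ofReal (Real.exp c) * (ENNReal.ofReal (Real.exp (-c)) *
          (∫⁻ p, (∫⋯∫⁻_s, F ∂fun _ => gaussianReal 0 1) (Function.update x i p) ∂gaussianReal 0 1) *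
          ∫⁻ q, (∫⋯∫⁻_s, G ∂fun _ => gaussianReal 0 1) (Function.update y i q)
            ∂gaussianReal 0 1) := by
          rw [← mul_assoc, ← mul_assoc, ← ENNReal.ofReal_mul (Real.exp_pos _).le, ← Real.exp_add]
          simp
      _ ≤ ENNReal.ofReal (Real.exp c) * 1 := by gcongr
      _ = _ := by rw [mul_one]

/-- The exponential transport inequality for functions of finitely many independent standard
Gaussians. -/
lemma lintegral_mul_lintegral_infinitePi_le_one {ι : Type*} (I : Finset ι)
    {F G : (ι → ℝ) → ℝ≥0∞} (hF : Measurable F) (hG : Measurable G)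
    (hFd : DependsOn F I) (hGd : DependsOn G I)
    (h : ∀ x y, F x * G y ≤ ENNReal.ofReal (Real.exp ((∑ i ∈ I, (x i - y i) ^ 2) / 4))) :
    (∫⁻ x, F x ∂Measure.infinitePi fun _ => gaussianReal 0 1) *
      ∫⁻ x, G x ∂Measure.infinitePi (fun _ : ι => gaussianReal 0 1) ≤ 1 := by
  classical
  have hlm : ∀ H : (ι → ℝ) → ℝ≥0∞, Measurable H → DependsOn H I →
      ∫⁻ x, H x ∂Measure.infinitePi (fun _ : ι => gaussianReal 0 1) =
        (∫⋯∫⁻_I, H ∂fun _ => gaussianReal 0 1) 0 := by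
    intro H hH hd
    have e : ∀ x, H x = H (Function.updateFinset 0 I (I.restrict x)) := fun x =>
      hd fun i hi => by simp [Function.updateFinset, Finset.mem_coe.1 hi]
    have h1 := lintegral_restrict_infinitePi (μ := fun _ : ι => gaussianReal 0 1) (s := I)
      (f := fun y : I → ℝ => H (Function.updateFinset 0 I y)) (hH.comp measurable_updateFinset)
    rw [lintegral_congr e, h1]
    rfl
  rw [hlm F hF hFd, hlm G hG hGd]
  simpa using lmarginal_mul_lmarginal_le I I subset_rfl hF hG h 0 0

/-! ### Brackets and lattice sums -/

/-- `⟨n⟩^{1/8}`. -/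
def lam (n : Freq) : ℝ := (1 + absSq n) ^ (1 / 16 : ℝ)

lemma absSq_nonneg (n : Freq) : 0 ≤ absSq n := by unfold absSq; positivity

lemma absSq_neg (n : Freq) : absSq (-n) = absSq n := by simp [absSq]

lemma bracket_neg (n : Freq) : bracket (-n) = bracket n := by simp [bracket, absSq_neg]

lemma bracket_sq (n : Freq) : bracket n ^ 2 = 1 + absSq n :=
  Real.sq_sqrt (by linarith [absSq_nonneg n])

lemma one_le_bracket (n : Freq) : 1 ≤ bracket n :=
  Real.one_le_sqrt.2 (by linarith [absSq_nonneg n])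

lemma bracket_pos (n : Freq) : 0 < bracket n := one_pos.trans_le (one_le_bracket n)

lemma one_le_lam (n : Freq) : 1 ≤ lam n :=
  Real.one_le_rpow (by linarith [absSq_nonneg n]) (by norm_num)

lemma lam_pos (n : Freq) : 0 < lam n := one_pos.trans_le (one_le_lam n)

lemma lam_neg (n : Freq) : lam (-n) = lam n := by simp [lam, absSq_neg]

/-- All Sobolev exponents below are multiples of 1/8, so weights become natural powers of `lam` and
their comparison is arithmetic of exponents. -/
lemma lam_pow_eight (n : Freq) : lam n ^ 8 = bracket n := by
  have h := absSq_nonneg n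
  rw [lam, bracket, ← Real.rpow_natCast, ← Real.rpow_mul (by linarith), Real.sqrt_eq_rpow]
  norm_num

lemma absSq_add_le (m n : Freq) : 1 + absSq (m + n) ≤ 2 * ((1 + absSq m) * (1 + absSq n)) := by
  simp only [absSq, Pi.add_apply, Int.cast_add]
  nlinarith [sq_nonneg ((m 0 : ℝ) - n 0), sq_nonneg ((m 1 : ℝ) - n 1), sq_nonneg ((m 0 : ℝ) * n 0),
    sq_nonneg ((m 0 : ℝ) * n 1), sq_nonneg ((m 1 : ℝ) * n 0), sq_nonneg ((m 1 : ℝ) * n 1)]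

lemma lam_add_le (m n : Freq) : lam (m + n) ≤ 2 * (lam m * lam n) := by
  have hm := absSq_nonneg m
  have hn := absSq_nonneg n
  have hmn := absSq_nonneg (m + n)
  unfold lam
  rw [← Real.mul_rpow (by linarith) (by linarith)]
  calc (1 + absSq (m + n)) ^ (1 / 16 : ℝ)
      ≤ (2 * ((1 + absSq m) * (1 + absSq n))) ^ (1 / 16 : ℝ) :=
        Real.rpow_le_rpow (by linarith) (absSq_add_le m n) (by norm_num)
    _ = 2 ^ (1 / 16 : ℝ) * ((1 + absSq m) * (1 + absSq n)) ^ (1 / 16 : ℝ) :=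
        Real.mul_rpow (by norm_num) (by positivity)
    _ ≤ 2 * ((1 + absSq m) * (1 + absSq n)) ^ (1 / 16 : ℝ) := by
        gcongr
        calc (2 : ℝ) ^ (1 / 16 : ℝ) ≤ 2 ^ (1 : ℝ) :=
              Real.rpow_le_rpow_of_exponent_le (by norm_num) (by norm_num)
          _ = 2 := by simp

/-- The constant 1 matters: it gives `|⟨d⟩ - ⟨a⟩| ≤ ⟨b⟩ + ⟨c⟩` when the frequencies sum to zero,
which is the source of the commutator gain. -/
lemma bracket_add_le (m n : Freq) : bracket (m + n) ≤ bracket m + bracket n := by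
  unfold bracket
  rw [Real.sqrt_le_left (by positivity)]
  have hm := absSq_nonneg m
  have hn := absSq_nonneg n
  rw [add_sq, Real.sq_sqrt (by linarith), Real.sq_sqrt (by linarith)]
  have h1 : (m 0 : ℝ) * n 0 + m 1 * n 1 ≤ √(1 + absSq m) * √(1 + absSq n) := by
    rw [← Real.sqrt_mul (by linarith)]
    refine Real.le_sqrt_of_sq_le ?_
    simp only [absSq]
    nlinarith [sq_nonneg ((m 0 : ℝ) * n 1 - m 1 * n 0), sq_nonneg (m 0 : ℝ), sq_nonneg (n 0 : ℝ),
      sq_nonneg (m 1 : ℝ), sq_nonneg (n 1 : ℝ)]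
  simp only [absSq, Pi.add_apply, Int.cast_add] at h1 ⊢
  nlinarith

/-- The exponent 17/8 exceeds the dimension. Splitting it evenly between the two coordinates leaves
decay of order 17/16 > 1 in each. -/
lemma summable_lam_pow : Summable fun n : Freq => (lam n ^ 17)⁻¹ := by
  have h1 : Summable fun k : ℤ => (1 + (k : ℝ) ^ 2) ^ (-(17 / 32) : ℝ) := by
    have h2 : Summable fun k : ℤ => |(k : ℝ)| ^ (-(17 / 16) : ℝ) :=
      Real.summable_abs_int_rpow (by norm_num)
    refine Summable.of_norm_bounded_eventually h2 ?_
    filter_upwards [(Set.finite_singleton (0 : ℤ)).compl_mem_cofinite] with k hk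
    have hk0 : 0 < |(k : ℝ)| := abs_pos.2 (by exact_mod_cast hk)
    rw [Real.norm_of_nonneg (by positivity)]
    calc (1 + (k : ℝ) ^ 2) ^ (-(17 / 32) : ℝ) ≤ (|(k : ℝ)| ^ 2) ^ (-(17 / 32) : ℝ) :=
          Real.rpow_le_rpow_of_nonpos (by positivity) (by rw [sq_abs]; linarith) (by norm_num)
      _ = |(k : ℝ)| ^ (-(17 / 16) : ℝ) := by
          rw [← Real.rpow_natCast, ← Real.rpow_mul hk0.le]
          norm_num
  have h3 := (h1.mul_of_nonneg h1 (fun _ => by positivity) (fun _ => by positivity))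
  rw [← (finTwoArrowEquiv ℤ).summable_iff] at h3
  refine Summable.of_nonneg_of_le (fun n => by have := lam_pos n; positivity) (fun n => ?_) h3
  have hn := absSq_nonneg n
  have e : (lam n ^ 17)⁻¹ =
      (1 + absSq n) ^ (-(17 / 32) : ℝ) * (1 + absSq n) ^ (-(17 / 32) : ℝ) := by
    rw [lam, ← Real.rpow_natCast, ← Real.rpow_mul (by linarith), ← Real.rpow_neg (by linarith),
      ← Real.rpow_add (by linarith)]
    norm_num
  rw [e]
  simp only [Function.comp, finTwoArrowEquiv_apply]
  gcongr ?_ * ?_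
  · exact Real.rpow_le_rpow_of_nonpos (by positivity)
      (by
        have : 0 ≤ (n 1 : ℝ) ^ 2 := sq_nonneg _
        change 1 + (n 0 : ℝ) ^ 2 ≤ 1 + ((n 0 : ℝ) ^ 2 + (n 1 : ℝ) ^ 2)
        linarith) (by norm_num)
  · exact Real.rpow_le_rpow_of_nonpos (by positivity)
      (by
        have : 0 ≤ (n 0 : ℝ) ^ 2 := sq_nonneg _
        change 1 + (n 1 : ℝ) ^ 2 ≤ 1 + ((n 0 : ℝ) ^ 2 + (n 1 : ℝ) ^ 2)
        linarith) (by norm_num)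

/-- `∑_n ⟨n⟩^{-17/8}`. -/
def latticeSum : ℝ := ∑' n : Freq, (lam n ^ 17)⁻¹

lemma latticeSum_nonneg : 0 ≤ latticeSum :=
  tsum_nonneg fun n => by have := lam_pos n; positivity

lemma sum_lam_le (B : Finset Freq) {e : ℕ} (he : 17 ≤ e) :
    ∑ n ∈ B, ((lam n)⁻¹) ^ e ≤ latticeSum := by
  calc ∑ n ∈ B, ((lam n)⁻¹) ^ e ≤ ∑ n ∈ B, (lam n ^ 17)⁻¹ := by
        refine Finset.sum_le_sum fun n _ => ?_
        rw [← inv_pow]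
        exact pow_le_pow_of_le_one (by have := lam_pos n; positivity)
          (inv_le_one_of_one_le₀ (one_le_lam n)) he
    _ ≤ latticeSum := summable_lam_pow.sum_le_tsum _ fun n _ => by
        have := lam_pos n; positivity

/-! ### Quadrilinear sums over frequencies with vanishing sum -/

/-- The sum of `f n₁ n₂ n₃ n₄` over frequencies in `B` with `n₁ + n₂ + n₃ + n₄ = 0`. -/
def quad {R : Type*} [AddCommMonoid R] (B : Finset Freq) (f : Freq → Freq → Freq → Freq → R) : R :=
  ∑ a ∈ B, ∑ b ∈ B, ∑ c ∈ B, ∑ d ∈ B, if a + b + c + d = 0 then f a b c d else 0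

section quad

variable {R : Type*} {B : Finset Freq}

lemma quad_congr [AddCommMonoid R] {f g : Freq → Freq → Freq → Freq → R}
    (h : ∀ a ∈ B, ∀ b ∈ B, ∀ c ∈ B, ∀ d ∈ B, a + b + c + d = 0 → f a b c d = g a b c d) :
    quad B f = quad B g := by
  unfold quad
  refine Finset.sum_congr rfl fun a ha => Finset.sum_congr rfl fun b hb =>
    Finset.sum_congr rfl fun c hc => Finset.sum_congr rfl fun d hd => ?_
  split_ifs with h0
  · exact h a ha b hb c hc d hd h0
  · rfl

lemma quad_add [AddCommMonoid R] (f g : Freq → Freq → Freq → Freq → R) :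
    quad B (fun a b c d => f a b c d + g a b c d) = quad B f + quad B g := by
  unfold quad
  simp only [← Finset.sum_add_distrib]
  refine Finset.sum_congr rfl fun a _ => Finset.sum_congr rfl fun b _ =>
    Finset.sum_congr rfl fun c _ => Finset.sum_congr rfl fun d _ => ?_
  split_ifs <;> simp

lemma quad_const_mul [Semiring R] (k : R) (f : Freq → Freq → Freq → Freq → R) :
    quad B (fun a b c d => k * f a b c d) = k * quad B f := by
  unfold quad
  simp only [Finset.mul_sum, mul_ite, mul_zero]

/-- The constraint is symmetric in the four frequencies, so the sum is invariant under permuting the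
slots. The permutations used below are composed from adjacent transpositions. -/
lemma quad_swap12 [AddCommMonoid R] (f : Freq → Freq → Freq → Freq → R) :
    quad B (fun a b c d => f b a c d) = quad B f := by
  unfold quad
  rw [Finset.sum_comm]
  simp only [add_comm]

lemma quad_swap23 [AddCommMonoid R] (f : Freq → Freq → Freq → Freq → R) :
    quad B (fun a b c d => f a c b d) = quad B f := by
  unfold quad
  refine Finset.sum_congr rfl fun a _ => ?_
  rw [Finset.sum_comm]
  refine Finset.sum_congr rfl fun b _ => Finset.sum_congr rfl fun c _ =>
    Finset.sum_congr rfl fun d _ => ?_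
  rw [add_right_comm a c b]

lemma quad_swap34 [AddCommMonoid R] (f : Freq → Freq → Freq → Freq → R) :
    quad B (fun a b c d => f a b d c) = quad B f := by
  unfold quad
  refine Finset.sum_congr rfl fun a _ => Finset.sum_congr rfl fun b _ => ?_
  rw [Finset.sum_comm]
  refine Finset.sum_congr rfl fun c _ => Finset.sum_congr rfl fun d _ => ?_
  rw [add_right_comm (a + b) d c]

lemma quad_swap24 [AddCommMonoid R] (f : Freq → Freq → Freq → Freq → R) :
    quad B (fun a b c d => f a d c b) = quad B f :=
  (quad_swap34 fun a b c d => f a c d b).trans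
    ((quad_swap23 fun a b c d => f a b d c).trans (quad_swap34 f))

lemma quad_perm_bcad [AddCommMonoid R] (f : Freq → Freq → Freq → Freq → R) :
    quad B (fun a b c d => f b c a d) = quad B f :=
  (quad_swap12 fun a b c d => f a c b d).trans (quad_swap23 f)

lemma quad_perm_bdac [AddCommMonoid R] (f : Freq → Freq → Freq → Freq → R) :
    quad B (fun a b c d => f b d a c) = quad B f :=
  (quad_swap34 fun a b c d => f b c a d).trans (quad_perm_bcad f)

lemma quad_perm_cdab [AddCommMonoid R] (f : Freq → Freq → Freq → Freq → R) :
    quad B (fun a b c d => f c d a b) = quad B f :=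
  (quad_swap23 fun a b c d => f b d a c).trans (quad_perm_bdac f)

lemma quad_le {f g : Freq → Freq → Freq → Freq → ℝ}
    (h : ∀ a ∈ B, ∀ b ∈ B, ∀ c ∈ B, ∀ d ∈ B, a + b + c + d = 0 → f a b c d ≤ g a b c d) :
    quad B f ≤ quad B g := by
  unfold quad
  refine Finset.sum_le_sum fun a ha => Finset.sum_le_sum fun b hb =>
    Finset.sum_le_sum fun c hc => Finset.sum_le_sum fun d hd => ?_
  split_ifs with h0
  · exact h a ha b hb c hc d hd h0
  · rfl

lemma norm_quad_le (f : Freq → Freq → Freq → Freq → ℂ) :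
    ‖quad B f‖ ≤ quad B fun a b c d => ‖f a b c d‖ := by
  unfold quad
  refine norm_sum_le_of_le _ fun a _ => norm_sum_le_of_le _ fun b _ =>
    norm_sum_le_of_le _ fun c _ => norm_sum_le_of_le _ fun d _ => ?_
  split_ifs <;> simp

end quad

/-! ### Bounds for quadrilinear sums in ℓ². -/

/-- The `ℓ²` norm of a function over the frequencies of `B`. -/
def l2n (B : Finset Freq) (f : Freq → ℝ) : ℝ := √(∑ n ∈ B, f n ^ 2)

lemma l2n_nonneg (B : Finset Freq) (f : Freq → ℝ) : 0 ≤ l2n B f := Real.sqrt_nonneg _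

lemma l2n_sq (B : Finset Freq) (f : Freq → ℝ) : l2n B f ^ 2 = ∑ n ∈ B, f n ^ 2 :=
  Real.sq_sqrt (Finset.sum_nonneg fun _ _ => sq_nonneg _)

lemma sum_mul_le_l2n (B : Finset Freq) (f g : Freq → ℝ) :
    ∑ n ∈ B, f n * g n ≤ l2n B f * l2n B g :=
  Real.sum_mul_le_sqrt_mul_sqrt B f g

/-- A convolution of two `ℓ²` sequences. -/
lemma sum_conv_le (B : Finset Freq) (q : Freq) (f g : Freq → ℝ) :
    ∑ c ∈ B, ∑ d ∈ B, (if q + c + d = 0 then f c * g d else 0) ≤ l2n B f * l2n B g := by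
  rw [← Finset.sum_product', ← Finset.sum_filter]
  -- Cauchy–Schwarz on the graph `q + c + d = 0`, where each of `c`, `d` determines the other.
  refine (Real.sum_mul_le_sqrt_mul_sqrt _ (fun p : Freq × Freq => f p.1)
    (fun p => g p.2)).trans ?_
  refine mul_le_mul ?_ ?_ (Real.sqrt_nonneg _) (l2n_nonneg B f)
  · refine Real.sqrt_le_sqrt ?_
    rw [Finset.sum_filter, Finset.sum_product' (f := fun c d => if q + c + d = 0 then f c ^ 2 else 0)]
    refine Finset.sum_le_sum fun c _ => ?_
    have : ∀ d, q + c + d = 0 ↔ d = -(q + c) := fun d => by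
      rw [add_comm, ← eq_neg_iff_add_eq_zero]
    simp only [this, Finset.sum_ite_eq']
    split_ifs
    · rfl
    · positivity
  · refine Real.sqrt_le_sqrt ?_
    rw [Finset.sum_filter, Finset.sum_product_right' (f := fun c d => if q + c + d = 0 then g d ^ 2 else 0)]
    refine Finset.sum_le_sum fun d _ => ?_
    have : ∀ c, q + c + d = 0 ↔ c = -(q + d) := fun c => by
      rw [add_right_comm, add_comm, ← eq_neg_iff_add_eq_zero]
    simp only [this, Finset.sum_ite_eq']
    split_ifs
    · rfl
    · positivity

/-- Two frequencies are summed freely in ℓ¹. For each choice of them the other two form a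
convolution of ℓ² sequences. -/
lemma quad_mul_le (B : Finset Freq) {f₁ f₂ : Freq → ℝ} (f₃ f₄ : Freq → ℝ)
    (h₁ : ∀ n, 0 ≤ f₁ n) (h₂ : ∀ n, 0 ≤ f₂ n) :
    quad B (fun a b c d => f₁ a * f₂ b * f₃ c * f₄ d) ≤
      (∑ n ∈ B, f₁ n) * (∑ n ∈ B, f₂ n) * (l2n B f₃ * l2n B f₄) := by
  unfold quad
  rw [Finset.sum_mul_sum, Finset.sum_mul]
  refine Finset.sum_le_sum fun a _ => ?_
  rw [Finset.sum_mul]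
  refine Finset.sum_le_sum fun b _ => ?_
  calc _ = f₁ a * f₂ b * ∑ c ∈ B, ∑ d ∈ B, (if a + b + c + d = 0 then f₃ c * f₄ d else 0) := by
        simp only [Finset.mul_sum, mul_ite, mul_zero, mul_assoc]
    _ ≤ _ := by
        have := h₁ a; have := h₂ b
        gcongr
        exact sum_conv_le B (a + b) f₃ f₄

lemma quad_mul_le_l1 (B : Finset Freq) {f₁ f₂ f₃ : Freq → ℝ} (h₁ : ∀ n, 0 ≤ f₁ n)
    (h₂ : ∀ n, 0 ≤ f₂ n) (h₃ : ∀ n, 0 ≤ f₃ n) :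
    quad B (fun a b c _ => f₁ a * f₂ b * f₃ c) ≤
      (∑ n ∈ B, f₁ n) * (∑ n ∈ B, f₂ n) * ∑ n ∈ B, f₃ n := by
  unfold quad
  rw [Finset.sum_mul_sum, Finset.sum_mul]
  refine Finset.sum_le_sum fun a _ => ?_
  rw [Finset.sum_mul]
  refine Finset.sum_le_sum fun b _ => ?_
  rw [Finset.mul_sum]
  refine Finset.sum_le_sum fun c _ => ?_
  have : ∀ d, a + b + c + d = 0 ↔ d = -(a + b + c) := fun d => by
    rw [add_comm, ← eq_neg_iff_add_eq_zero]
  simp only [this, Finset.sum_ite_eq']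
  have := h₁ a; have := h₂ b; have := h₃ c
  split_ifs
  · rfl
  · positivity

lemma quad_mul_le' (B : Finset Freq) {f₁ f₃ : Freq → ℝ} (f₂ f₄ : Freq → ℝ)
    (h₁ : ∀ n, 0 ≤ f₁ n) (h₃ : ∀ n, 0 ≤ f₃ n) :
    quad B (fun a b c d => f₁ a * f₂ b * f₃ c * f₄ d) ≤
      (∑ n ∈ B, f₁ n) * (∑ n ∈ B, f₃ n) * (l2n B f₂ * l2n B f₄) := by
  rw [← quad_swap23]
  refine (le_of_eq (quad_congr fun a _ b _ c _ d _ _ => ?_)).trans (quad_mul_le B f₂ f₄ h₁ h₃)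
  ring

/-- The weight `∑_{i<j} (⟨n_i⟩⟨n_j⟩)^{-9/8}`. -/
def pairWeight (a b c d : Freq) : ℝ :=
  ((lam a)⁻¹ * (lam b)⁻¹) ^ 9 + ((lam a)⁻¹ * (lam c)⁻¹) ^ 9 + ((lam a)⁻¹ * (lam d)⁻¹) ^ 9 +
    ((lam b)⁻¹ * (lam c)⁻¹) ^ 9 + ((lam b)⁻¹ * (lam d)⁻¹) ^ 9 + ((lam c)⁻¹ * (lam d)⁻¹) ^ 9

/-- The weight `⟨n⟩^{-9/8}` is square summable because 18 ≥ 17, hence it takes ℓ² to ℓ¹. This is why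
the exponent 9 appears in `pairWeight`. -/
lemma sum_lam_mul_le (B : Finset Freq) (f : Freq → ℝ) :
    ∑ n ∈ B, (lam n)⁻¹ ^ 9 * f n ≤ √latticeSum * l2n B f := by
  refine (sum_mul_le_l2n B _ f).trans ?_
  gcongr
  · exact l2n_nonneg B f
  · refine Real.sqrt_le_sqrt ?_
    simp only [← pow_mul]
    exact sum_lam_le B (by norm_num)

/-- A quadrilinear sum with a weight dominated by `pairWeight` is bounded on `ℓ²`. -/
lemma quad_weight_le (B : Finset Freq) {f₁ f₂ f₃ f₄ : Freq → ℝ} (h₁ : ∀ n, 0 ≤ f₁ n)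
    (h₂ : ∀ n, 0 ≤ f₂ n) (h₃ : ∀ n, 0 ≤ f₃ n) (h₄ : ∀ n, 0 ≤ f₄ n) {C : ℝ} (hC : 0 ≤ C)
    {w : Freq → Freq → Freq → Freq → ℝ}
    (hw : ∀ a b c d, a + b + c + d = 0 → w a b c d ≤ C * pairWeight a b c d) :
    quad B (fun a b c d => w a b c d * (f₁ a * f₂ b * f₃ c * f₄ d)) ≤
      C * (6 * latticeSum) * (l2n B f₁ * l2n B f₂ * l2n B f₃ * l2n B f₄) := by
  have key : ∀ {g₁ g₂ g₃ g₄ : Freq → ℝ}, (∀ n, 0 ≤ g₁ n) → (∀ n, 0 ≤ g₂ n) → (∀ n, 0 ≤ g₃ n) →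
      (∀ n, 0 ≤ g₄ n) →
      quad B (fun a b c d => ((lam a)⁻¹ * (lam b)⁻¹) ^ 9 * (g₁ a * g₂ b * g₃ c * g₄ d)) ≤
        latticeSum * (l2n B g₁ * l2n B g₂ * l2n B g₃ * l2n B g₄) := by
    intro g₁ g₂ g₃ g₄ k₁ k₂ _ _
    have hl : ∀ n, 0 ≤ (lam n)⁻¹ ^ 9 := fun n => by have := lam_pos n; positivity
    calc _ = quad B (fun a b c d => ((lam a)⁻¹ ^ 9 * g₁ a) * ((lam b)⁻¹ ^ 9 * g₂ b) * g₃ c * g₄ d) :=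
          quad_congr fun a _ b _ c _ d _ _ => by ring
      _ ≤ _ := quad_mul_le B g₃ g₄ (fun n => mul_nonneg (hl n) (k₁ n))
          (fun n => mul_nonneg (hl n) (k₂ n))
      _ ≤ (√latticeSum * l2n B g₁) * (√latticeSum * l2n B g₂) * (l2n B g₃ * l2n B g₄) := by
          have := l2n_nonneg B g₃
          have := l2n_nonneg B g₄
          have := l2n_nonneg B g₁
          have h0 : 0 ≤ ∑ n ∈ B, (lam n)⁻¹ ^ 9 * g₂ n :=
            Finset.sum_nonneg fun n _ => mul_nonneg (hl n) (k₂ n)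
          gcongr
          · exact sum_lam_mul_le B g₁
          · exact sum_lam_mul_le B g₂
      _ = (√latticeSum) ^ 2 * (l2n B g₁ * l2n B g₂ * l2n B g₃ * l2n B g₄) := by ring
      _ = _ := by rw [Real.sq_sqrt latticeSum_nonneg]
  -- One estimate for each of the six pairs; a permutation of the slots brings the pair to the
  -- front.
  have s12 := key h₁ h₂ h₃ h₄
  have s13 := key h₁ h₃ h₂ h₄
  have s14 := key h₁ h₄ h₃ h₂
  have s23 := key h₂ h₃ h₁ h₄
  have s24 := key h₂ h₄ h₁ h₃
  have s34 := key h₃ h₄ h₁ h₂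
  rw [← quad_swap23] at s13
  rw [← quad_swap24] at s14
  rw [← quad_perm_bcad] at s23
  rw [← quad_perm_bdac] at s24
  rw [← quad_perm_cdab] at s34
  calc _ ≤ quad B (fun a b c d => C * (pairWeight a b c d * (f₁ a * f₂ b * f₃ c * f₄ d))) := by
        refine quad_le fun a _ b _ c _ d _ h0 => ?_
        rw [← mul_assoc C]
        exact mul_le_mul_of_nonneg_right (hw a b c d h0)
          (mul_nonneg (mul_nonneg (mul_nonneg (h₁ a) (h₂ b)) (h₃ c)) (h₄ d))
    _ = C * (quad B (fun a b c d => ((lam a)⁻¹ * (lam b)⁻¹) ^ 9 * (f₁ a * f₂ b * f₃ c * f₄ d)) +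
          quad B (fun a b c d => ((lam a)⁻¹ * (lam c)⁻¹) ^ 9 * (f₁ a * f₃ c * f₂ b * f₄ d)) +
          quad B (fun a b c d => ((lam a)⁻¹ * (lam d)⁻¹) ^ 9 * (f₁ a * f₄ d * f₃ c * f₂ b)) +
          quad B (fun a b c d => ((lam b)⁻¹ * (lam c)⁻¹) ^ 9 * (f₂ b * f₃ c * f₁ a * f₄ d)) +
          quad B (fun a b c d => ((lam b)⁻¹ * (lam d)⁻¹) ^ 9 * (f₂ b * f₄ d * f₁ a * f₃ c)) +
          quad B (fun a b c d => ((lam c)⁻¹ * (lam d)⁻¹) ^ 9 * (f₃ c * f₄ d * f₁ a * f₂ b))) := by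
        rw [quad_const_mul]
        congr 1
        simp only [← quad_add]
        refine quad_congr fun a _ b _ c _ d _ _ => ?_
        unfold pairWeight
        generalize (lam a)⁻¹ * (lam b)⁻¹ = p1
        generalize (lam a)⁻¹ * (lam c)⁻¹ = p2
        generalize (lam a)⁻¹ * (lam d)⁻¹ = p3
        generalize (lam b)⁻¹ * (lam c)⁻¹ = p4
        generalize (lam b)⁻¹ * (lam d)⁻¹ = p5
        generalize (lam c)⁻¹ * (lam d)⁻¹ = p6
        ring
    _ ≤ C * (6 * (latticeSum * (l2n B f₁ * l2n B f₂ * l2n B f₃ * l2n B f₄))) := by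
        gcongr
        linarith [s12, s13, s14, s23, s24, s34]
    _ = _ := by ring

/-- Weights in three variables are dominated by pair weights. -/
lemma pow_mul_pow_mul_pow_le {x y z : ℝ} (hx : 0 ≤ x) (hy : 0 ≤ y) (hz : 0 ≤ z)
    (hx1 : x ≤ 1) (hy1 : y ≤ 1) (hz1 : z ≤ 1) {c e₁ e₂ e₃ : ℕ} (h₁ : e₁ ≤ c) (h₂ : e₂ ≤ c)
    (h₃ : e₃ ≤ c) (h : 2 * c ≤ e₁ + e₂ + e₃) :
    x ^ e₁ * y ^ e₂ * z ^ e₃ ≤ (x * y) ^ c + (x * z) ^ c + (y * z) ^ c := by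
  -- The smallest number gives its power away: it supplies the exponents `c - i` and `c - j` missing
  -- from the two others, which are at least as large.
  have key : ∀ {p q r : ℝ} {i j k : ℕ}, 0 ≤ p → 0 ≤ q → 0 ≤ r → r ≤ 1 → i ≤ c → j ≤ c →
      2 * c ≤ i + j + k → r ≤ p → r ≤ q → p ^ i * q ^ j * r ^ k ≤ (p * q) ^ c := by
    intro p q r i j k hp hq hr hr1 hi hj hk hrp hrq
    calc p ^ i * q ^ j * r ^ k ≤ p ^ i * q ^ j * (r ^ (c - i) * r ^ (c - j)) := by
          rw [← pow_add]
          gcongr 1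
          exact pow_le_pow_of_le_one hr hr1 (by omega)
      _ ≤ p ^ i * q ^ j * (p ^ (c - i) * q ^ (c - j)) := by gcongr
      _ = (p ^ i * p ^ (c - i)) * (q ^ j * q ^ (c - j)) := by ring
      _ = (p * q) ^ c := by
          rw [← pow_add, ← pow_add, Nat.add_sub_cancel' hi, Nat.add_sub_cancel' hj, mul_pow]
  have n1 : 0 ≤ (x * y) ^ c := by positivity
  have n2 : 0 ≤ (x * z) ^ c := by positivity
  have n3 : 0 ≤ (y * z) ^ c := by positivity
  rcases le_total x y with hxy | hxy
  · rcases le_total x z with hxz | hxz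
    · have := key hy hz hx hx1 h₂ h₃ (by omega) hxy hxz (k := e₁)
      nlinarith
    · have := key hx hy hz hz1 h₁ h₂ (by omega) hxz (hxz.trans hxy) (k := e₃)
      nlinarith
  · rcases le_total y z with hyz | hyz
    · have := key hx hz hy hy1 h₁ h₃ (by omega) hxy hyz (k := e₂)
      nlinarith
    · have := key hx hy hz hz1 h₁ h₂ (by omega) (hyz.trans hxy) hyz (k := e₃)
      nlinarith

/-! ### The time derivative of the renormalized energy: deterministic estimates -/

/-- The share of `x` among the maximisers of `x, y, z`. -/
def maxShare (x y z : ℝ) : ℝ :=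
  if y ≤ x ∧ z ≤ x then (1 + (if y = x then 1 else 0) + (if z = x then 1 else 0))⁻¹ else 0

lemma maxShare_nonneg (x y z : ℝ) : 0 ≤ maxShare x y z := by
  unfold maxShare; split_ifs <;> norm_num

lemma maxShare_le_one (x y z : ℝ) : maxShare x y z ≤ 1 := by
  unfold maxShare; split_ifs <;> norm_num

/-- Ties are shared equally, so the shares form a partition of unity compatible with permutations. A
symmetric sum may then be restricted to the region where one chosen frequency is maximal. -/
lemma maxShare_add (x y z : ℝ) :
    maxShare x y z + maxShare y x z + maxShare z x y = 1 := by
  unfold maxShare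
  rcases lt_trichotomy x y with h1 | h1 | h1 <;> rcases lt_trichotomy y z with h2 | h2 | h2 <;>
    rcases lt_trichotomy x z with h3 | h3 | h3 <;>
    first
    | (exfalso; linarith)
    | (subst_vars; simp_all [le_of_lt, not_le_of_gt, ne_of_lt]; try norm_num)

/-- The symbol of the commutator term, localised to the region where the first frequency is the
largest of the first three. -/
def commSymbol (s : ℕ) (a b c d : Freq) : ℝ :=
  bracket d ^ s * (bracket d ^ s - bracket a ^ s - bracket b ^ s - bracket c ^ s) *
    maxShare (bracket a) (bracket b) (bracket c)

lemma bracket_le_of_sum_eq_zero {a b c d : Freq} (h : a + b + c + d = 0) :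
    bracket d ≤ bracket a + bracket b + bracket c := by
  have e : d = -(a + b + c) := by rw [eq_neg_iff_add_eq_zero, add_comm, h]
  rw [e, bracket_neg]
  exact (bracket_add_le _ _).trans (by gcongr; exact bracket_add_le _ _)

lemma lam_le_of_sum_eq_zero {a b c d : Freq} (h : a + b + c + d = 0) :
    lam a ≤ 4 * (lam b * lam c * lam d) := by
  have e : a = -(b + c + d) := by
    rw [eq_neg_iff_add_eq_zero, ← h]; abel
  rw [e, lam_neg]
  refine (lam_add_le _ _).trans ?_
  have := lam_add_le b c
  have := lam_pos d
  nlinarith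

lemma lam_le_lam_iff {a b : Freq} : lam a ≤ lam b ↔ bracket a ≤ bracket b := by
  rw [← lam_pow_eight, ← lam_pow_eight]
  exact (pow_le_pow_iff_left₀ (lam_pos a).le (lam_pos b).le (by norm_num)).symm

lemma commSymbol_eq_zero {s : ℕ} {a b c d : Freq} (h : ¬ (lam b ≤ lam a ∧ lam c ≤ lam a)) :
    commSymbol s a b c d = 0 := by
  rw [lam_le_lam_iff, lam_le_lam_iff] at h
  simp [commSymbol, maxShare, h]

/-- On the support, `⟨a⟩` dominates `⟨b⟩` and `⟨c⟩`, so `⟨d⟩ ≤ 3⟨a⟩`. A mean value bound gives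
`|⟨d⟩^s - ⟨a⟩^s| ≤ C⟨a⟩^{s-1}(⟨b⟩ + ⟨c⟩)`, and `⟨b⟩^s`, `⟨c⟩^s` obey the same bound because one
factor may be kept and the others replaced by `⟨a⟩`. -/
lemma abs_commSymbol_le {s : ℕ} (hs : 1 ≤ s) {a b c d : Freq} (h : a + b + c + d = 0) :
    |commSymbol s a b c d| ≤
      (s * 3 ^ s + 1) * (lam d ^ (8 * s) * lam a ^ (8 * s - 8) * (lam b ^ 8 + lam c ^ 8)) := by
  by_cases hm : lam b ≤ lam a ∧ lam c ≤ lam a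
  swap
  · rw [commSymbol_eq_zero hm, abs_zero]
    have := lam_pos a; have := lam_pos b; have := lam_pos c; have := lam_pos d
    positivity
  rw [lam_le_lam_iff, lam_le_lam_iff] at hm
  have e1 : lam d ^ (8 * s) = bracket d ^ s := by rw [pow_mul, lam_pow_eight]
  have e2 : lam a ^ (8 * s - 8) = bracket a ^ (s - 1) := by
    rw [show 8 * s - 8 = 8 * (s - 1) by omega, pow_mul, lam_pow_eight]
  rw [e1, e2, lam_pow_eight, lam_pow_eight]
  have h1 := bracket_le_of_sum_eq_zero h
  have h2 : bracket a ≤ bracket d + bracket b + bracket c :=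
    bracket_le_of_sum_eq_zero (by rw [← h]; abel)
  have pa := bracket_pos a; have pb := bracket_pos b; have pc := bracket_pos c
  have pd := bracket_pos d
  set x := bracket a
  set y := bracket b
  set z := bracket c
  set u := bracket d
  have hux : |u ^ s - x ^ s| ≤ (s * 3 ^ s) * (x ^ (s - 1) * (y + z)) := by
    have hm3 : max |u| |x| ≤ 3 * x := by
      rw [abs_of_pos pd, abs_of_pos pa]
      exact max_le (by linarith [hm.1, hm.2]) (by linarith)
    calc |u ^ s - x ^ s| ≤ |u - x| * s * max |u| |x| ^ (s - 1) := abs_pow_sub_pow_le _ _ _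
      _ ≤ (y + z) * s * (3 * x) ^ (s - 1) := by
          gcongr
          rw [abs_le]; constructor <;> linarith
      _ = (s * 3 ^ (s - 1)) * (x ^ (s - 1) * (y + z)) := by rw [mul_pow]; ring
      _ ≤ _ := by
          gcongr
          · norm_num
          · omega
  have hy : y ^ s ≤ x ^ (s - 1) * y := by
    obtain ⟨k, rfl⟩ : ∃ k, s = k + 1 := ⟨s - 1, by omega⟩
    rw [pow_succ, Nat.add_sub_cancel]
    gcongr
    exact hm.1
  have hz : z ^ s ≤ x ^ (s - 1) * z := by
    obtain ⟨k, rfl⟩ : ∃ k, s = k + 1 := ⟨s - 1, by omega⟩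
    rw [pow_succ, Nat.add_sub_cancel]
    gcongr
    exact hm.2
  have hK : |u ^ s - x ^ s - y ^ s - z ^ s| ≤ (s * 3 ^ s + 1) * (x ^ (s - 1) * (y + z)) := by
    have hy0 : 0 ≤ y ^ s := by positivity
    have hz0 : 0 ≤ z ^ s := by positivity
    have := abs_le.1 hux
    rw [abs_le]
    constructor <;> nlinarith
  unfold commSymbol
  rw [abs_mul, abs_mul, abs_of_nonneg (maxShare_nonneg _ _ _), abs_of_nonneg (by positivity)]
  calc _ ≤ u ^ s * ((s * 3 ^ s + 1) * (x ^ (s - 1) * (y + z))) * 1 := by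
        gcongr
        · exact maxShare_nonneg _ _ _
        · exact maxShare_le_one _ _ _
    _ = _ := by ring

/-! ### Random tensors and the algebra of the energy rate. -/

/-- The renormalized square of `J^s p`, as a tensor in two dual frequencies. -/
def wickTensor (s : ℕ) (σ : ℝ) (B : Finset Freq) (p : Freq → ℂ) (m l : Freq) : ℂ :=
  (∑ a ∈ B, ∑ b ∈ B, if a + b + m + l = 0 then
    ((bracket a ^ s * bracket b ^ s : ℝ) : ℂ) * (p a * p b) else 0) -
    if m + l = 0 then (σ : ℂ) else 0

/-- The random tensor of the commutator term. -/
def commTensor (s : ℕ) (B : Finset Freq) (p q : Freq → ℂ) (m l : Freq) : ℂ :=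
  ∑ a ∈ B, ∑ d ∈ B, if a + m + l + d = 0 then
    (commSymbol s a m l d : ℂ) * (p a * q d) else 0

/-- The time derivative of the renormalized energy as a function of the Fourier coefficients `a` of
`u` and `b` of `v`. -/
def energyRate (s : ℕ) (σ : ℝ) (B : Finset Freq) (a b : Freq → ℂ) : ℂ :=
  3 * (quad B (fun n₁ n₂ m l => ((bracket n₁ ^ s * bracket n₂ ^ s : ℝ) : ℂ) *
      (a n₁ * a n₂ * a m * b l)) - σ * ∑ m ∈ B, ∑ l ∈ B, if m + l = 0 then a m * b l else 0) -
    quad B (fun n₁ n₂ n₃ n₄ => ((bracket n₄ ^ s * (bracket n₄ ^ s - 3 * bracket n₁ ^ s) : ℝ) : ℂ) *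
      (a n₁ * a n₂ * a n₃ * b n₄))

/-- The product of coefficients is symmetric in `n₁, n₂, n₃`, so `3⟨n₁⟩^s` may be replaced by
`⟨n₁⟩^s + ⟨n₂⟩^s + ⟨n₃⟩^s`. Inserting the partition of unity `maxShare` then yields three equal
sums, one for each maximiser. -/
lemma quad_comm_eq (s : ℕ) (B : Finset Freq) (a b : Freq → ℂ) :
    quad B (fun n₁ n₂ n₃ n₄ => ((bracket n₄ ^ s * (bracket n₄ ^ s - 3 * bracket n₁ ^ s) : ℝ) : ℂ) *
      (a n₁ * a n₂ * a n₃ * b n₄)) =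
    3 * quad B (fun n₁ n₂ n₃ n₄ => (commSymbol s n₁ n₂ n₃ n₄ : ℂ) *
      (a n₁ * a n₂ * a n₃ * b n₄)) := by
  set P : Freq → Freq → Freq → Freq → ℂ := fun n₁ n₂ n₃ n₄ => a n₁ * a n₂ * a n₃ * b n₄ with hP
  set f : Freq → Freq → Freq → Freq → ℂ := fun n₁ n₂ n₃ n₄ =>
    ((bracket n₄ ^ s * bracket n₁ ^ s : ℝ) : ℂ) * P n₁ n₂ n₃ n₄ with hf
  set f0 : Freq → Freq → Freq → Freq → ℂ := fun n₁ n₂ n₃ n₄ =>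
    ((bracket n₄ ^ s * bracket n₄ ^ s : ℝ) : ℂ) * P n₁ n₂ n₃ n₄ with hf0
  set g : Freq → Freq → Freq → Freq → ℂ := fun n₁ n₂ n₃ n₄ =>
    (commSymbol s n₁ n₂ n₃ n₄ : ℂ) * P n₁ n₂ n₃ n₄ with hg
  have h2 := quad_swap12 (B := B) f
  have h3 := (quad_swap23 (B := B) fun a b c d => f b a c d).trans h2
  have g2 := quad_swap12 (B := B) g
  have g3 := (quad_swap23 (B := B) fun a b c d => g b a c d).trans g2
  have hL : quad B (fun n₁ n₂ n₃ n₄ =>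
      ((bracket n₄ ^ s * (bracket n₄ ^ s - 3 * bracket n₁ ^ s) : ℝ) : ℂ) * P n₁ n₂ n₃ n₄) +
      3 * quad B f = quad B f0 := by
    rw [← quad_const_mul, ← quad_add]
    refine quad_congr fun n₁ _ n₂ _ n₃ _ n₄ _ _ => ?_
    simp only [hf, hf0]
    push_cast
    ring
  have hR : quad B g + quad B (fun a b c d => g b a c d) + quad B (fun a b c d => g c a b d) +
      (quad B f + quad B (fun a b c d => f b a c d) + quad B (fun a b c d => f c a b d)) =
      quad B f0 := by
    simp only [← quad_add]
    refine quad_congr fun n₁ _ n₂ _ n₃ _ n₄ _ _ => ?_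
    have hP2 : P n₂ n₁ n₃ n₄ = P n₁ n₂ n₃ n₄ := by simp only [hP]; ring
    have hP3 : P n₃ n₁ n₂ n₄ = P n₁ n₂ n₃ n₄ := by simp only [hP]; ring
    have hχ := congrArg (fun x : ℝ => (x : ℂ))
      (maxShare_add (bracket n₁) (bracket n₂) (bracket n₃))
    simp only [hf, hf0, hg, hP2, hP3, commSymbol]
    push_cast at hχ ⊢
    linear_combination ((bracket n₄ : ℂ) ^ s * ((bracket n₄ : ℂ) ^ s - (bracket n₁ : ℂ) ^ s -
      (bracket n₂ : ℂ) ^ s - (bracket n₃ : ℂ) ^ s)) * P n₁ n₂ n₃ n₄ * hχ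
  rw [g2, g3, h2, h3] at hR
  linear_combination hL - hR

/-- This separates the random factor `p`, collected in a tensor whose norm is typical, from the two
functions `c`, `d` against which it is tested. -/
lemma sum_wickTensor_mul (s : ℕ) (σ : ℝ) (B : Finset Freq) (p c d : Freq → ℂ) :
    ∑ m ∈ B, ∑ l ∈ B, wickTensor s σ B p m l * (c m * d l) =
      quad B (fun n₁ n₂ m l => ((bracket n₁ ^ s * bracket n₂ ^ s : ℝ) : ℂ) *
        (p n₁ * p n₂ * c m * d l)) - σ * ∑ m ∈ B, ∑ l ∈ B, if m + l = 0 then c m * d l else 0 := by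
  have h : quad B (fun n₁ n₂ m l => ((bracket n₁ ^ s * bracket n₂ ^ s : ℝ) : ℂ) *
        (p n₁ * p n₂ * c m * d l)) = ∑ m ∈ B, ∑ l ∈ B, (∑ a ∈ B, ∑ b ∈ B, if a + b + m + l = 0 then
          ((bracket a ^ s * bracket b ^ s : ℝ) : ℂ) * (p a * p b) else 0) * (c m * d l) := by
    rw [← quad_perm_cdab]
    unfold quad
    refine Finset.sum_congr rfl fun m _ => Finset.sum_congr rfl fun l _ => ?_
    rw [Finset.sum_mul]
    refine Finset.sum_congr rfl fun a _ => ?_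
    rw [Finset.sum_mul]
    refine Finset.sum_congr rfl fun b _ => ?_
    rw [show m + l + a + b = a + b + m + l by abel]
    split_ifs <;> ring
  rw [h, Finset.mul_sum, ← Finset.sum_sub_distrib]
  refine Finset.sum_congr rfl fun m _ => ?_
  rw [Finset.mul_sum, ← Finset.sum_sub_distrib]
  refine Finset.sum_congr rfl fun l _ => ?_
  unfold wickTensor
  split_ifs <;> ring

lemma sum_commTensor_mul (s : ℕ) (B : Finset Freq) (p q c d : Freq → ℂ) :
    ∑ m ∈ B, ∑ l ∈ B, commTensor s B p q m l * (c m * d l) =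
      quad B (fun n₁ m l n₄ => (commSymbol s n₁ m l n₄ : ℂ) * (p n₁ * c m * d l * q n₄)) := by
  have e := quad_perm_bcad (B := B)
    (fun n₁ m l n₄ => (commSymbol s n₁ m l n₄ : ℂ) * (p n₁ * c m * d l * q n₄))
  have e2 := quad_perm_bcad (B := B)
    (fun a b c' d' => (commSymbol s b c' a d' : ℂ) * (p b * c c' * d a * q d'))
  rw [← e, ← e2]
  unfold quad
  refine Finset.sum_congr rfl fun m _ => Finset.sum_congr rfl fun l _ => ?_
  unfold commTensor
  rw [Finset.sum_mul]
  refine Finset.sum_congr rfl fun a _ => ?_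
  rw [Finset.sum_mul]
  refine Finset.sum_congr rfl fun b _ => ?_
  rw [show m + l + a + b = a + m + l + b by abel]
  split_ifs <;> ring

/-! ### Cauchy–Schwarz bounds for multilinear forms. -/

lemma l2n_add_le (B : Finset Freq) {f g h : Freq → ℝ} (hh : ∀ n ∈ B, |h n| ≤ f n + g n)
    (hf : ∀ n, 0 ≤ f n) (hg : ∀ n, 0 ≤ g n) : l2n B h ≤ l2n B f + l2n B g := by
  refine Real.sqrt_le_iff.2 ⟨add_nonneg (l2n_nonneg _ _) (l2n_nonneg _ _), ?_⟩
  rw [add_sq, l2n_sq, l2n_sq]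
  calc ∑ n ∈ B, h n ^ 2 ≤ ∑ n ∈ B, (f n + g n) ^ 2 := by
        refine Finset.sum_le_sum fun n hn => ?_
        rw [sq_le_sq, abs_of_nonneg (add_nonneg (hf n) (hg n))]
        exact hh n hn
    _ = ∑ n ∈ B, f n ^ 2 + 2 * ∑ n ∈ B, f n * g n + ∑ n ∈ B, g n ^ 2 := by
        rw [Finset.mul_sum, ← Finset.sum_add_distrib, ← Finset.sum_add_distrib]
        exact Finset.sum_congr rfl fun n _ => by ring
    _ ≤ _ := by
        have := sum_mul_le_l2n B f g
        linarith

/-- The Hilbert–Schmidt norm of a tensor controls the associated bilinear form. -/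
lemma norm_sum_tensor_mul_le (B : Finset Freq) (W : Freq → Freq → ℂ) (c d : Freq → ℂ)
    (ρ τ : Freq → ℝ) (hρ : ∀ n, 0 < ρ n) (hτ : ∀ n, 0 < τ n) {M : ℝ} (hM : 0 ≤ M)
    (hW : ∑ m ∈ B, ∑ l ∈ B, (‖W m l‖ * ((ρ m)⁻¹ * (τ l)⁻¹)) ^ 2 ≤ M ^ 2) :
    ‖∑ m ∈ B, ∑ l ∈ B, W m l * (c m * d l)‖ ≤
      M * (l2n B (fun n => ρ n * ‖c n‖) * l2n B fun n => τ n * ‖d n‖) := by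
  have h1 : ‖∑ m ∈ B, ∑ l ∈ B, W m l * (c m * d l)‖ ≤ ∑ p ∈ B ×ˢ B,
      (‖W p.1 p.2‖ * ((ρ p.1)⁻¹ * (τ p.2)⁻¹)) * ((ρ p.1 * ‖c p.1‖) * (τ p.2 * ‖d p.2‖)) := by
    rw [Finset.sum_product]
    refine norm_sum_le_of_le _ fun m _ => norm_sum_le_of_le _ fun l _ => ?_
    rw [norm_mul, norm_mul]
    have := hρ m
    have := hτ l
    refine le_of_eq ?_
    field_simp
  refine h1.trans ((Real.sum_mul_le_sqrt_mul_sqrt _ _ _).trans ?_)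
  refine mul_le_mul ?_ ?_ (Real.sqrt_nonneg _) hM
  · rw [Finset.sum_product]
    exact Real.sqrt_le_iff.2 ⟨hM, hW⟩
  · simp only [mul_pow (_ * ‖c _‖), Finset.sum_product]
    rw [← Finset.sum_mul_sum, Real.sqrt_mul (Finset.sum_nonneg fun _ _ => sq_nonneg _)]
    rfl

/-- Quadrilinear forms are bounded by weighted `ℓ²` norms as soon as their symbols are dominated by
`pairWeight` after removal of the weights. -/
lemma norm_quad_symbol_le (B : Finset Freq) (κ : Freq → Freq → Freq → Freq → ℝ)
    (p q c d : Freq → ℂ) (i j k l : ℕ) {C M₁ M₂ M₃ M₄ : ℝ} (hC : 0 ≤ C)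
    (hκ : ∀ n₁ n₂ n₃ n₄, n₁ + n₂ + n₃ + n₄ = 0 → |κ n₁ n₂ n₃ n₄| ≤
      lam n₁ ^ i * lam n₂ ^ j * lam n₃ ^ k * lam n₄ ^ l * (C * pairWeight n₁ n₂ n₃ n₄))
    (h₁ : l2n B (fun n => lam n ^ i * ‖p n‖) ≤ M₁) (h₂ : l2n B (fun n => lam n ^ j * ‖q n‖) ≤ M₂)
    (h₃ : l2n B (fun n => lam n ^ k * ‖c n‖) ≤ M₃) (h₄ : l2n B (fun n => lam n ^ l * ‖d n‖) ≤ M₄) :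
    ‖quad B (fun n₁ n₂ n₃ n₄ => (κ n₁ n₂ n₃ n₄ : ℂ) * (p n₁ * q n₂ * c n₃ * d n₄))‖ ≤
      C * (6 * latticeSum) * (M₁ * M₂ * M₃ * M₄) := by
  have hl : ∀ n, 0 < lam n := lam_pos
  refine (norm_quad_le _).trans ?_
  have hnn : ∀ (e : ℕ) (f : Freq → ℂ) (n : Freq), 0 ≤ lam n ^ e * ‖f n‖ := fun e f n => by
    have := hl n; positivity
  have h := quad_weight_le B (hnn i p) (hnn j q) (hnn k c) (hnn l d) hC
    (w := fun n₁ n₂ n₃ n₄ => |κ n₁ n₂ n₃ n₄| * ((lam n₁ ^ i)⁻¹ * (lam n₂ ^ j)⁻¹ *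
      (lam n₃ ^ k)⁻¹ * (lam n₄ ^ l)⁻¹)) (fun n₁ n₂ n₃ n₄ h0 => by
        have p1 := hl n₁; have p2 := hl n₂; have p3 := hl n₃; have p4 := hl n₄
        calc _ ≤ lam n₁ ^ i * lam n₂ ^ j * lam n₃ ^ k * lam n₄ ^ l * (C * pairWeight n₁ n₂ n₃ n₄) *
              ((lam n₁ ^ i)⁻¹ * (lam n₂ ^ j)⁻¹ * (lam n₃ ^ k)⁻¹ * (lam n₄ ^ l)⁻¹) := by
              gcongr
              exact hκ n₁ n₂ n₃ n₄ h0
          _ = _ := by field_simp)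
  refine (le_of_eq (quad_congr fun n₁ _ n₂ _ n₃ _ n₄ _ _ => ?_)).trans (h.trans ?_)
  · have p1 := hl n₁; have p2 := hl n₂; have p3 := hl n₃; have p4 := hl n₄
    simp only [norm_mul, Complex.norm_real, Real.norm_eq_abs]
    field_simp
  · have z := latticeSum_nonneg
    have n1 := l2n_nonneg B (fun n => lam n ^ i * ‖p n‖)
    have n2 := l2n_nonneg B (fun n => lam n ^ j * ‖q n‖)
    have n3 := l2n_nonneg B (fun n => lam n ^ k * ‖c n‖)
    have n4 := l2n_nonneg B (fun n => lam n ^ l * ‖d n‖)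
    have : 0 ≤ M₁ := n1.trans h₁
    have : 0 ≤ M₂ := n2.trans h₂
    have : 0 ≤ M₃ := n3.trans h₃
    gcongr

lemma pairWeight_nonneg (a b c d : Freq) : 0 ≤ pairWeight a b c d := by
  have := lam_pos a; have := lam_pos b; have := lam_pos c; have := lam_pos d
  unfold pairWeight
  positivity

/-- Monomials in three of the inverse brackets are dominated by `pairWeight`. -/
lemma pow_le_pairWeight_abc (a b c d : Freq) {i j k : ℕ} (hi : i ≤ 9) (hj : j ≤ 9) (hk : k ≤ 9)
    (h : 18 ≤ i + j + k) :
    (lam a)⁻¹ ^ i * (lam b)⁻¹ ^ j * (lam c)⁻¹ ^ k ≤ pairWeight a b c d := by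
  have pa := lam_pos a; have pb := lam_pos b; have pc := lam_pos c; have pd := lam_pos d
  have h1 := pow_mul_pow_mul_pow_le (inv_nonneg.2 pa.le) (inv_nonneg.2 pb.le) (inv_nonneg.2 pc.le)
    (inv_le_one_of_one_le₀ (one_le_lam a)) (inv_le_one_of_one_le₀ (one_le_lam b))
    (inv_le_one_of_one_le₀ (one_le_lam c)) hi hj hk (by omega)
  have : 0 ≤ ((lam a)⁻¹ * (lam d)⁻¹) ^ 9 := by positivity
  have : 0 ≤ ((lam b)⁻¹ * (lam d)⁻¹) ^ 9 := by positivity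
  have : 0 ≤ ((lam c)⁻¹ * (lam d)⁻¹) ^ 9 := by positivity
  unfold pairWeight
  linarith

lemma pow_le_pairWeight_bcd (a b c d : Freq) {i j k : ℕ} (hi : i ≤ 9) (hj : j ≤ 9) (hk : k ≤ 9)
    (h : 18 ≤ i + j + k) :
    (lam b)⁻¹ ^ i * (lam c)⁻¹ ^ j * (lam d)⁻¹ ^ k ≤ pairWeight a b c d := by
  refine (pow_le_pairWeight_abc b c d a hi hj hk h).trans_eq ?_
  unfold pairWeight
  ring

lemma inv_lam_pow_anti (a : Freq) {i j : ℕ} (h : i ≤ j) : (lam a)⁻¹ ^ j ≤ (lam a)⁻¹ ^ i :=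
  pow_le_pow_of_le_one (inv_nonneg.2 (lam_pos a).le) (inv_le_one_of_one_le₀ (one_le_lam a)) h

/-! #### Symbol bounds -/

/-- The rough frequency `a` carries weight `8 * s - 1`, one power short of the symbol. That power is
distributed over `b, c, d`. The surplus weights 8, 11, 3 then leave inverse powers 7, 10, 2;
trimming 10 to 9 keeps a total of 18. -/
lemma symbol_wick_cross {s : ℕ} (hs : 2 ≤ s) {a b c d : Freq} (h : a + b + c + d = 0) :
    |bracket a ^ s * bracket b ^ s| ≤ lam a ^ (8 * s - 1) * lam b ^ (8 * s + 8) * lam c ^ 11 *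
      lam d ^ 3 * (4 * pairWeight a b c d) := by
  have pa := lam_pos a; have pb := lam_pos b; have pc := lam_pos c; have pd := lam_pos d
  have h1 := lam_le_of_sum_eq_zero h
  have h2 := pow_le_pairWeight_bcd a b c d (i := 7) (j := 9) (k := 2) (by norm_num) (by norm_num)
    (by norm_num) (by norm_num)
  have h3 : (lam c)⁻¹ ^ 10 ≤ (lam c)⁻¹ ^ 9 := inv_lam_pow_anti c (by norm_num)
  rw [abs_of_nonneg (by have := bracket_pos a; have := bracket_pos b; positivity),
    ← lam_pow_eight, ← lam_pow_eight, ← pow_mul, ← pow_mul]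
  obtain ⟨k, hk⟩ : ∃ k, 8 * s = k + 1 := ⟨8 * s - 1, by omega⟩
  rw [hk, Nat.add_sub_cancel]
  calc lam a ^ (k + 1) * lam b ^ (k + 1) = lam a ^ k * lam b ^ (k + 1) * lam a := by ring
    _ ≤ lam a ^ k * lam b ^ (k + 1) * (4 * (lam b * lam c * lam d)) := by gcongr
    _ = lam a ^ k * lam b ^ (k + 1 + 8) * lam c ^ 11 * lam d ^ 3 *
        (4 * ((lam b)⁻¹ ^ 7 * (lam c)⁻¹ ^ 10 * (lam d)⁻¹ ^ 2)) := by
        field_simp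
        ring
    _ ≤ lam a ^ k * lam b ^ (k + 1 + 8) * lam c ^ 11 * lam d ^ 3 *
        (4 * ((lam b)⁻¹ ^ 7 * (lam c)⁻¹ ^ 9 * (lam d)⁻¹ ^ 2)) := by gcongr
    _ ≤ _ := by gcongr

lemma symbol_wick_smooth (s : ℕ) (a b c d : Freq) :
    |bracket a ^ s * bracket b ^ s| ≤ lam a ^ (8 * s + 8) * lam b ^ (8 * s + 8) * lam c ^ 8 *
      lam d ^ 0 * (1 * pairWeight a b c d) := by
  have pa := lam_pos a; have pb := lam_pos b; have pc := lam_pos c; have pd := lam_pos d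
  have h2 := pow_le_pairWeight_abc a b c d (i := 8) (j := 8) (k := 8) (by norm_num) (by norm_num)
    (by norm_num) (by norm_num)
  rw [abs_of_nonneg (by have := bracket_pos a; have := bracket_pos b; positivity),
    ← lam_pow_eight, ← lam_pow_eight, ← pow_mul, ← pow_mul]
  calc lam a ^ (8 * s) * lam b ^ (8 * s) = lam a ^ (8 * s + 8) * lam b ^ (8 * s + 8) * lam c ^ 8 *
        lam d ^ 0 * (1 * ((lam a)⁻¹ ^ 8 * (lam b)⁻¹ ^ 8 * (lam c)⁻¹ ^ 8)) := by
        field_simp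
        ring
    _ ≤ _ := by gcongr

/-- The constant in the bound on the symbol of the commutator term. -/
def commConst (s : ℕ) : ℝ := s * 3 ^ s + 1

lemma commConst_pos (s : ℕ) : 0 < commConst s := by unfold commConst; positivity

/-- This is the monomial left in both mixed commutator estimates: 7 powers of slack at `a`, and
weight 11 at `b` and `c`, of which the commutator bound uses 8 at one of them. -/
lemma pairWeight_sum_rough (a b c d : Freq) :
    (lam a)⁻¹ ^ 7 * ((lam b)⁻¹ ^ 3 * (lam c)⁻¹ ^ 11 + (lam b)⁻¹ ^ 11 * (lam c)⁻¹ ^ 3) ≤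
      2 * pairWeight a b c d := by
  have pa := lam_pos a; have pb := lam_pos b; have pc := lam_pos c; have pd := lam_pos d
  have h2 := pow_le_pairWeight_abc a b c d (i := 7) (j := 3) (k := 9) (by norm_num) (by norm_num)
    (by norm_num) (by norm_num)
  have h3 := pow_le_pairWeight_abc a b c d (i := 7) (j := 9) (k := 3) (by norm_num) (by norm_num)
    (by norm_num) (by norm_num)
  have h4 : (lam c)⁻¹ ^ 11 ≤ (lam c)⁻¹ ^ 9 := inv_lam_pow_anti c (by norm_num)
  have h5 : (lam b)⁻¹ ^ 11 ≤ (lam b)⁻¹ ^ 9 := inv_lam_pow_anti b (by norm_num)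
  calc _ ≤ (lam a)⁻¹ ^ 7 * ((lam b)⁻¹ ^ 3 * (lam c)⁻¹ ^ 9 + (lam b)⁻¹ ^ 9 * (lam c)⁻¹ ^ 3) := by
        gcongr
    _ ≤ _ := by linarith

lemma symbol_comm_rough_smooth {s : ℕ} (hs : 2 ≤ s) {a b c d : Freq} (h : a + b + c + d = 0) :
    |commSymbol s a b c d| ≤ lam a ^ (8 * s - 1) * lam b ^ 11 * lam c ^ 11 *
      lam d ^ (8 * s) * ((2 * commConst s) * pairWeight a b c d) := by
  have pa := lam_pos a; have pb := lam_pos b; have pc := lam_pos c; have pd := lam_pos d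
  have h2 := pairWeight_sum_rough a b c d
  refine (abs_commSymbol_le (by omega) h).trans ?_
  rw [← commConst]
  have hC := commConst_pos s
  obtain ⟨k, hk⟩ : ∃ k, 8 * s = k + 8 := ⟨8 * s - 8, by omega⟩
  rw [hk, Nat.add_sub_cancel, show k + 8 - 1 = k + 7 by omega]
  calc _ = lam a ^ (k + 7) * lam b ^ 11 * lam c ^ 11 * lam d ^ (k + 8) * (commConst s *
        ((lam a)⁻¹ ^ 7 * ((lam b)⁻¹ ^ 3 * (lam c)⁻¹ ^ 11 + (lam b)⁻¹ ^ 11 * (lam c)⁻¹ ^ 3))) := by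
        field_simp
        ring
    _ ≤ lam a ^ (k + 7) * lam b ^ 11 * lam c ^ 11 * lam d ^ (k + 8) * (commConst s *
        (2 * pairWeight a b c d)) := by gcongr
    _ = _ := by ring

/-- The weight at `d` is nine powers short. Where the symbol is nonzero `⟨d⟩ ≤ 3⟨a⟩`, so the smooth
frequency `a` pays for them; of its surplus of 16 powers over the commutator bound 7 remain. -/
lemma symbol_comm_smooth_rough {s : ℕ} (hs : 2 ≤ s) {a b c d : Freq} (h : a + b + c + d = 0) :
    |commSymbol s a b c d| ≤ lam a ^ (8 * s + 8) * lam b ^ 11 * lam c ^ 11 *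
      lam d ^ (8 * s - 9) * ((2 * 3 ^ 9 * commConst s) * pairWeight a b c d) := by
  have pa := lam_pos a; have pb := lam_pos b; have pc := lam_pos c; have pd := lam_pos d
  by_cases hm : lam b ≤ lam a ∧ lam c ≤ lam a
  swap
  · rw [commSymbol_eq_zero hm, abs_zero]
    have := pairWeight_nonneg a b c d
    have := commConst_pos s
    positivity
  have h2 := pairWeight_sum_rough a b c d
  refine (abs_commSymbol_le (by omega) h).trans ?_
  rw [← commConst]
  have hC := commConst_pos s
  have hd : lam d ^ 9 ≤ 3 ^ 9 * lam a ^ 9 := by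
    rw [← mul_pow]
    refine pow_le_pow_left₀ pd.le ?_ 9
    refine le_of_pow_le_pow_left₀ (n := 8) (by norm_num) (by positivity) ?_
    rw [mul_pow, lam_pow_eight, lam_pow_eight]
    have := bracket_le_of_sum_eq_zero h
    rw [lam_le_lam_iff, lam_le_lam_iff] at hm
    nlinarith [bracket_pos a]
  obtain ⟨k, hk⟩ : ∃ k, 8 * s = k + 9 := ⟨8 * s - 9, by omega⟩
  rw [hk, Nat.add_sub_cancel, show k + 9 - 8 = k + 1 by omega]
  calc _ = lam d ^ 9 * (commConst s * (lam d ^ k * lam a ^ (k + 1) * (lam b ^ 8 + lam c ^ 8))) := by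
        ring
    _ ≤ 3 ^ 9 * lam a ^ 9 *
        (commConst s * (lam d ^ k * lam a ^ (k + 1) * (lam b ^ 8 + lam c ^ 8))) := by gcongr
    _ = lam a ^ (k + 9 + 8) * lam b ^ 11 * lam c ^ 11 * lam d ^ k * (3 ^ 9 * commConst s *
        ((lam a)⁻¹ ^ 7 * ((lam b)⁻¹ ^ 3 * (lam c)⁻¹ ^ 11 + (lam b)⁻¹ ^ 11 * (lam c)⁻¹ ^ 3))) := by
        field_simp
        ring
    _ ≤ lam a ^ (k + 9 + 8) * lam b ^ 11 * lam c ^ 11 * lam d ^ k * (3 ^ 9 * commConst s *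
        (2 * pairWeight a b c d)) := by gcongr
    _ = _ := by ring

/-- Only the energy weight 8 is available at `b` and `c`. Since `a` dominates both, one inverse
power of `lam a` is converted into the ninth power needed at `b` or `c`. -/
lemma symbol_comm_smooth_smooth {s : ℕ} (hs : 2 ≤ s) {a b c d : Freq} (h : a + b + c + d = 0) :
    |commSymbol s a b c d| ≤ lam a ^ (8 * s + 8) * lam b ^ 8 * lam c ^ 8 *
      lam d ^ (8 * s) * ((2 * commConst s) * pairWeight a b c d) := by
  have pa := lam_pos a; have pb := lam_pos b; have pc := lam_pos c; have pd := lam_pos d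
  by_cases hm : lam b ≤ lam a ∧ lam c ≤ lam a
  swap
  · rw [commSymbol_eq_zero hm, abs_zero]
    have := pairWeight_nonneg a b c d
    have := commConst_pos s
    positivity
  refine (abs_commSymbol_le (by omega) h).trans ?_
  rw [← commConst]
  have hC := commConst_pos s
  have ib := inv_anti₀ pb hm.1
  have ic := inv_anti₀ pc hm.2
  have h2 : (lam a)⁻¹ ^ 16 * ((lam b)⁻¹ ^ 8 + (lam c)⁻¹ ^ 8) ≤ 2 * pairWeight a b c d := by
    have t1 : (lam a)⁻¹ ^ 16 * (lam b)⁻¹ ^ 8 ≤ ((lam a)⁻¹ * (lam b)⁻¹) ^ 9 := by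
      calc _ = (lam a)⁻¹ ^ 15 * (lam b)⁻¹ ^ 8 * (lam a)⁻¹ := by ring
        _ ≤ (lam a)⁻¹ ^ 9 * (lam b)⁻¹ ^ 8 * (lam b)⁻¹ := by
          gcongr ?_ * _ * ?_
          exact inv_lam_pow_anti a (by norm_num)
        _ = _ := by ring
    have t2 : (lam a)⁻¹ ^ 16 * (lam c)⁻¹ ^ 8 ≤ ((lam a)⁻¹ * (lam c)⁻¹) ^ 9 := by
      calc _ = (lam a)⁻¹ ^ 15 * (lam c)⁻¹ ^ 8 * (lam a)⁻¹ := by ring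
        _ ≤ (lam a)⁻¹ ^ 9 * (lam c)⁻¹ ^ 8 * (lam c)⁻¹ := by
          gcongr ?_ * _ * ?_
          exact inv_lam_pow_anti a (by norm_num)
        _ = _ := by ring
    have n1 : 0 ≤ ((lam a)⁻¹ * (lam b)⁻¹) ^ 9 := by positivity
    have n2 : 0 ≤ ((lam a)⁻¹ * (lam c)⁻¹) ^ 9 := by positivity
    have n3 : 0 ≤ ((lam a)⁻¹ * (lam d)⁻¹) ^ 9 := by positivity
    have n4 : 0 ≤ ((lam b)⁻¹ * (lam c)⁻¹) ^ 9 := by positivity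
    have n5 : 0 ≤ ((lam b)⁻¹ * (lam d)⁻¹) ^ 9 := by positivity
    have n6 : 0 ≤ ((lam c)⁻¹ * (lam d)⁻¹) ^ 9 := by positivity
    unfold pairWeight
    linarith
  obtain ⟨k, hk⟩ : ∃ k, 8 * s = k + 8 := ⟨8 * s - 8, by omega⟩
  rw [hk, Nat.add_sub_cancel]
  calc _ = lam a ^ (k + 8 + 8) * lam b ^ 8 * lam c ^ 8 * lam d ^ (k + 8) * (commConst s *
        ((lam a)⁻¹ ^ 16 * ((lam b)⁻¹ ^ 8 + (lam c)⁻¹ ^ 8))) := by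
        field_simp
        ring
    _ ≤ lam a ^ (k + 8 + 8) * lam b ^ 8 * lam c ^ 8 * lam d ^ (k + 8) * (commConst s *
        (2 * pairWeight a b c d)) := by gcongr
    _ = _ := by ring

/-! #### The estimate -/

/-- The norms of a pair of Fourier series which are bounded with large probability. -/
structure IsTypical (s : ℕ) (σ : ℝ) (B : Finset Freq) (M : ℝ) (p q : Freq → ℂ) : Prop where
  fst : l2n B (fun n => lam n ^ (8 * s - 1) * ‖p n‖) ≤ M
  snd : l2n B (fun n => lam n ^ (8 * s - 9) * ‖q n‖) ≤ M
  wick : ∑ m ∈ B, ∑ l ∈ B, (‖wickTensor s σ B p m l‖ * ((lam m ^ 15)⁻¹ * (lam l ^ 7)⁻¹)) ^ 2 ≤ M ^ 2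
  comm : ∑ m ∈ B, ∑ l ∈ B, (‖commTensor s B p q m l‖ * ((lam m ^ 15)⁻¹ * (lam l ^ 15)⁻¹)) ^ 2 ≤ M ^ 2

/-- The rate of change of the renormalized energy grows at most quadratically with the
Cameron–Martin distance to a typical point, in sets of bounded energy. -/
lemma norm_energyRate_le {s : ℕ} (hs : 2 ≤ s) (σ : ℝ) (B : Finset Freq) {M τ : ℝ} (hM : 1 ≤ M)
    (hτ : 1 ≤ τ) {a b p q : Freq → ℂ} (ht : IsTypical s σ B M p q)
    (ha : l2n B (fun n => lam n ^ 8 * ‖a n‖) ≤ M) (hb : l2n B (fun n => lam n ^ 0 * ‖b n‖) ≤ M)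
    (hap : l2n B (fun n => lam n ^ (8 * s + 8) * ‖a n - p n‖) ≤ τ)
    (hbq : l2n B (fun n => lam n ^ (8 * s) * ‖b n - q n‖) ≤ τ) :
    ‖energyRate s σ B a b‖ ≤ 10 ^ 9 * (M ^ 4 * (1 + commConst s) * (1 + latticeSum)) * τ ^ 2 := by
  have hl : ∀ n, 0 < lam n := lam_pos
  have hl1 : ∀ n, 1 ≤ lam n := one_le_lam
  have hM0 : 0 < M := by linarith
  have hτ0 : 0 < τ := by linarith
  have hMτ : M + τ ≤ 2 * M * τ := by nlinarith
  -- In the rough norms `H^{15/8}` and `H^{7/8}` the data grow linearly in `τ`. The comparisons `15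
  -- ≤ 8s - 1` and `7 ≤ 8s - 9` rely on `s ≥ 2`.
  have d1 : l2n B (fun n => lam n ^ 15 * ‖a n‖) ≤ 2 * M * τ := by
    refine (l2n_add_le B (f := fun n => lam n ^ (8 * s - 1) * ‖p n‖)
      (g := fun n => lam n ^ (8 * s + 8) * ‖a n - p n‖) (fun n _ => ?_)
      (fun n => by have := hl n; positivity) (fun n => by have := hl n; positivity)).trans
      (le_trans (by linarith [ht.fst]) hMτ)
    have := hl n
    rw [abs_of_nonneg (by positivity)]
    calc lam n ^ 15 * ‖a n‖ ≤ lam n ^ 15 * (‖p n‖ + ‖a n - p n‖) := by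
          gcongr
          calc ‖a n‖ = ‖p n + (a n - p n)‖ := by congr 1; ring
            _ ≤ _ := norm_add_le _ _
      _ = lam n ^ 15 * ‖p n‖ + lam n ^ 15 * ‖a n - p n‖ := by ring
      _ ≤ _ := by
          gcongr ?_ * _ + ?_ * _
          · exact pow_le_pow_right₀ (hl1 n) (by omega)
          · exact pow_le_pow_right₀ (hl1 n) (by omega)
  have d2 : l2n B (fun n => lam n ^ 7 * ‖b n‖) ≤ 2 * M * τ := by
    refine (l2n_add_le B (f := fun n => lam n ^ (8 * s - 9) * ‖q n‖)
      (g := fun n => lam n ^ (8 * s) * ‖b n - q n‖) (fun n _ => ?_)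
      (fun n => by have := hl n; positivity) (fun n => by have := hl n; positivity)).trans
      (le_trans (by linarith [ht.snd]) hMτ)
    have := hl n
    rw [abs_of_nonneg (by positivity)]
    calc lam n ^ 7 * ‖b n‖ ≤ lam n ^ 7 * (‖q n‖ + ‖b n - q n‖) := by
          gcongr
          calc ‖b n‖ = ‖q n + (b n - q n)‖ := by congr 1; ring
            _ ≤ _ := norm_add_le _ _
      _ = lam n ^ 7 * ‖q n‖ + lam n ^ 7 * ‖b n - q n‖ := by ring
      _ ≤ _ := by
          gcongr ?_ * _ + ?_ * _
          · exact pow_le_pow_right₀ (hl1 n) (by omega)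
          · exact pow_le_pow_right₀ (hl1 n) (by omega)
  set ρ : ℝ := √τ with hρ
  have hρ2 : ρ ^ 2 = τ := Real.sq_sqrt hτ0.le
  have hρ0 : 0 ≤ ρ := Real.sqrt_nonneg _
  -- Interpolation between the energy norm, bounded by `M`, and the rough norm, of size `τ`: the
  -- exponents satisfy `2·11 ≤ 8 + 15`, and for `b` below `2·3 ≤ 0 + 7`. The result has size `√τ`.
  have d3 : l2n B (fun n => lam n ^ 11 * ‖a n‖) ≤ 2 * M * ρ := by
    refine Real.sqrt_le_iff.2 ⟨by positivity, ?_⟩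
    calc _ ≤ ∑ n ∈ B, (lam n ^ 8 * ‖a n‖) * (lam n ^ 15 * ‖a n‖) := by
          refine Finset.sum_le_sum fun n _ => ?_
          calc (lam n ^ 11 * ‖a n‖) ^ 2 = lam n ^ 22 * ‖a n‖ ^ 2 := by ring
            _ ≤ lam n ^ 23 * ‖a n‖ ^ 2 := by
                gcongr ?_ * _
                exact pow_le_pow_right₀ (hl1 n) (by omega)
            _ = _ := by ring
      _ ≤ M * (2 * M * τ) := (sum_mul_le_l2n B _ _).trans
          (mul_le_mul ha d1 (l2n_nonneg _ _) hM0.le)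
      _ ≤ (2 * M * ρ) ^ 2 := by rw [mul_pow, hρ2]; nlinarith [mul_pos hM0 hM0]
  have d4 : l2n B (fun n => lam n ^ 3 * ‖b n‖) ≤ 2 * M * ρ := by
    refine Real.sqrt_le_iff.2 ⟨by positivity, ?_⟩
    calc _ ≤ ∑ n ∈ B, (lam n ^ 0 * ‖b n‖) * (lam n ^ 7 * ‖b n‖) := by
          refine Finset.sum_le_sum fun n _ => ?_
          calc (lam n ^ 3 * ‖b n‖) ^ 2 = lam n ^ 6 * ‖b n‖ ^ 2 := by ring
            _ ≤ lam n ^ 7 * ‖b n‖ ^ 2 := by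
                gcongr ?_ * _
                exact pow_le_pow_right₀ (hl1 n) (by omega)
            _ = _ := by ring
      _ ≤ M * (2 * M * τ) := (sum_mul_le_l2n B _ _).trans
          (mul_le_mul hb d2 (l2n_nonneg _ _) hM0.le)
      _ ≤ (2 * M * ρ) ^ 2 := by rw [mul_pow, hρ2]; nlinarith [mul_pos hM0 hM0]
  -- `T0` and `S0` contain two factors of the typical point: a Hilbert–Schmidt norm against two
  -- factors of size `τ`.
  have T0 := norm_sum_tensor_mul_le B (wickTensor s σ B p) a b (fun n => lam n ^ 15)
    (fun n => lam n ^ 7) (fun n => pow_pos (hl n) _) (fun n => pow_pos (hl n) _) hM0.le ht.wick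
  rw [sum_wickTensor_mul] at T0
  have S0 := norm_sum_tensor_mul_le B (commTensor s B p q) a a (fun n => lam n ^ 15)
    (fun n => lam n ^ 15) (fun n => pow_pos (hl n) _) (fun n => pow_pos (hl n) _) hM0.le ht.comm
  rw [sum_commTensor_mul] at S0
  replace T0 := T0.trans (mul_le_mul_of_nonneg_left
    (mul_le_mul d1 d2 (l2n_nonneg _ _) (by positivity)) hM0.le)
  replace S0 := S0.trans (mul_le_mul_of_nonneg_left
    (mul_le_mul d1 d1 (l2n_nonneg _ _) (by positivity)) hM0.le)
  -- Each remaining term contains a difference of size `τ`. The second power of `τ` comes from two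
  -- interpolated factors in `T1`, `S1`, `S2`, and from a second difference in `T2`, `S3`.
  have T1 := norm_quad_symbol_le B (fun n₁ n₂ _ _ => bracket n₁ ^ s * bracket n₂ ^ s)
    p (fun n => a n - p n) a b (8 * s - 1) (8 * s + 8) 11 3 (by norm_num)
    (fun _ _ _ _ h => symbol_wick_cross hs h) ht.fst hap d3 d4
  have T2 := norm_quad_symbol_le B (fun n₁ n₂ _ _ => bracket n₁ ^ s * bracket n₂ ^ s)
    (fun n => a n - p n) (fun n => a n - p n) a b (8 * s + 8) (8 * s + 8) 8 0 (by norm_num)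
    (fun _ _ _ _ _ => symbol_wick_smooth s _ _ _ _) hap hap ha hb
  have hC := commConst_pos s
  have S1 := norm_quad_symbol_le B (commSymbol s) p a a (fun n => b n - q n)
    (8 * s - 1) 11 11 (8 * s) (by positivity) (fun _ _ _ _ h => symbol_comm_rough_smooth hs h)
    ht.fst d3 d3 hbq
  have S2 := norm_quad_symbol_le B (commSymbol s) (fun n => a n - p n) a a q
    (8 * s + 8) 11 11 (8 * s - 9) (by positivity) (fun _ _ _ _ h => symbol_comm_smooth_rough hs h)
    hap d3 d3 ht.snd
  have S3 := norm_quad_symbol_le B (commSymbol s) (fun n => a n - p n) a a (fun n => b n - q n)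
    (8 * s + 8) 8 8 (8 * s) (by positivity) (fun _ _ _ _ h => symbol_comm_smooth_smooth hs h)
    hap ha ha hbq
  have eT : quad B (fun n₁ n₂ m l => ((bracket n₁ ^ s * bracket n₂ ^ s : ℝ) : ℂ) *
      (a n₁ * a n₂ * a m * b l)) =
      quad B (fun n₁ n₂ m l => ((bracket n₁ ^ s * bracket n₂ ^ s : ℝ) : ℂ) *
        (p n₁ * p n₂ * a m * b l)) +
      2 * quad B (fun n₁ n₂ m l => ((bracket n₁ ^ s * bracket n₂ ^ s : ℝ) : ℂ) *
        (p n₁ * (a n₂ - p n₂) * a m * b l)) +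
      quad B (fun n₁ n₂ m l => ((bracket n₁ ^ s * bracket n₂ ^ s : ℝ) : ℂ) *
        ((a n₁ - p n₁) * (a n₂ - p n₂) * a m * b l)) := by
    have h12 := quad_swap12 (B := B) fun n₁ n₂ m l =>
      ((bracket n₁ ^ s * bracket n₂ ^ s : ℝ) : ℂ) * (p n₁ * (a n₂ - p n₂) * a m * b l)
    rw [two_mul]
    nth_rewrite 1 [← h12]
    simp only [← quad_add]
    refine quad_congr fun n₁ _ n₂ _ m _ l _ _ => ?_
    push_cast
    ring
  have eS : quad B (fun n₁ n₂ n₃ n₄ => (commSymbol s n₁ n₂ n₃ n₄ : ℂ) *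
      (a n₁ * a n₂ * a n₃ * b n₄)) =
      quad B (fun n₁ n₂ n₃ n₄ => (commSymbol s n₁ n₂ n₃ n₄ : ℂ) *
        (p n₁ * a n₂ * a n₃ * q n₄)) +
      quad B (fun n₁ n₂ n₃ n₄ => (commSymbol s n₁ n₂ n₃ n₄ : ℂ) *
        (p n₁ * a n₂ * a n₃ * (b n₄ - q n₄))) +
      quad B (fun n₁ n₂ n₃ n₄ => (commSymbol s n₁ n₂ n₃ n₄ : ℂ) *
        ((a n₁ - p n₁) * a n₂ * a n₃ * q n₄)) +
      quad B (fun n₁ n₂ n₃ n₄ => (commSymbol s n₁ n₂ n₃ n₄ : ℂ) *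
        ((a n₁ - p n₁) * a n₂ * a n₃ * (b n₄ - q n₄))) := by
    simp only [← quad_add]
    refine quad_congr fun n₁ _ n₂ _ m _ l _ _ => ?_
    ring
  have eF : energyRate s σ B a b = 3 * ((quad B (fun n₁ n₂ m l =>
        ((bracket n₁ ^ s * bracket n₂ ^ s : ℝ) : ℂ) * (p n₁ * p n₂ * a m * b l)) -
        σ * ∑ m ∈ B, ∑ l ∈ B, if m + l = 0 then a m * b l else 0) +
      2 * quad B (fun n₁ n₂ m l => ((bracket n₁ ^ s * bracket n₂ ^ s : ℝ) : ℂ) *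
        (p n₁ * (a n₂ - p n₂) * a m * b l)) +
      quad B (fun n₁ n₂ m l => ((bracket n₁ ^ s * bracket n₂ ^ s : ℝ) : ℂ) *
        ((a n₁ - p n₁) * (a n₂ - p n₂) * a m * b l)) -
      (quad B (fun n₁ n₂ n₃ n₄ => (commSymbol s n₁ n₂ n₃ n₄ : ℂ) *
        (p n₁ * a n₂ * a n₃ * q n₄)) +
      quad B (fun n₁ n₂ n₃ n₄ => (commSymbol s n₁ n₂ n₃ n₄ : ℂ) *
        (p n₁ * a n₂ * a n₃ * (b n₄ - q n₄))) +
      quad B (fun n₁ n₂ n₃ n₄ => (commSymbol s n₁ n₂ n₃ n₄ : ℂ) *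
        ((a n₁ - p n₁) * a n₂ * a n₃ * q n₄)) +
      quad B (fun n₁ n₂ n₃ n₄ => (commSymbol s n₁ n₂ n₃ n₄ : ℂ) *
        ((a n₁ - p n₁) * a n₂ * a n₃ * (b n₄ - q n₄))))) := by
    unfold energyRate
    rw [quad_comm_eq, eT, eS]
    ring
  have hn : ∀ z₀ z₁ z₂ y₀ y₁ y₂ y₃ : ℂ, ‖3 * (z₀ + 2 * z₁ + z₂ - (y₀ + y₁ + y₂ + y₃))‖ ≤
      3 * (‖z₀‖ + 2 * ‖z₁‖ + ‖z₂‖ + (‖y₀‖ + ‖y₁‖ + ‖y₂‖ + ‖y₃‖)) := by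
    intro z₀ z₁ z₂ y₀ y₁ y₂ y₃
    rw [norm_mul, show ‖(3 : ℂ)‖ = 3 by simp]
    gcongr
    refine (norm_sub_le _ _).trans (add_le_add ((norm_add_le _ _).trans (add_le_add_left
      ((norm_add_le _ _).trans_eq ?_) _)) ((norm_add_le _ _).trans (add_le_add_left
      ((norm_add_le _ _).trans (add_le_add_left (norm_add_le _ _) _)) _)))
    rw [norm_mul, show ‖(2 : ℂ)‖ = 2 by simp]
  rw [eF]
  refine (hn _ _ _ _ _ _ _).trans ?_
  have hZ := latticeSum_nonneg
  set Z := latticeSum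
  set K := commConst s
  have t0 : M * (2 * M * τ * (2 * M * τ)) = 4 * M ^ 3 * τ ^ 2 := by ring
  have t1 : 4 * (6 * Z) * (M * τ * (2 * M * ρ) * (2 * M * ρ)) = 96 * Z * M ^ 3 * τ ^ 2 := by
    rw [show M * τ * (2 * M * ρ) * (2 * M * ρ) = 4 * M ^ 3 * τ * ρ ^ 2 by ring, hρ2]; ring
  have t2 : 1 * (6 * Z) * (τ * τ * M * M) = 6 * Z * M ^ 2 * τ ^ 2 := by ring
  have t3 : 2 * K * (6 * Z) * (M * (2 * M * ρ) * (2 * M * ρ) * τ) = 48 * K * Z * M ^ 3 * τ ^ 2 := by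
    rw [show M * (2 * M * ρ) * (2 * M * ρ) * τ = 4 * M ^ 3 * τ * ρ ^ 2 by ring, hρ2]; ring
  have t4 : 2 * 3 ^ 9 * K * (6 * Z) * (τ * (2 * M * ρ) * (2 * M * ρ) * M) =
      944784 * K * Z * M ^ 3 * τ ^ 2 := by
    rw [show τ * (2 * M * ρ) * (2 * M * ρ) * M = 4 * M ^ 3 * τ * ρ ^ 2 by ring, hρ2]; ring
  have t5 : 2 * K * (6 * Z) * (τ * M * M * τ) = 12 * K * Z * M ^ 2 * τ ^ 2 := by ring
  rw [t0] at T0 S0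
  rw [t1] at T1
  rw [t2] at T2
  rw [t3] at S1
  rw [t4] at S2
  rw [t5] at S3
  have m2 : M ^ 2 * τ ^ 2 ≤ M ^ 4 * τ ^ 2 := by
    gcongr 1
    exact pow_le_pow_right₀ hM (by norm_num)
  have m3 : M ^ 3 * τ ^ 2 ≤ M ^ 4 * τ ^ 2 := by
    gcongr 1
    exact pow_le_pow_right₀ hM (by norm_num)
  have hKZ : 0 ≤ K * Z := by positivity
  set X := M ^ 4 * τ ^ 2 with hX
  have hX0 : 0 ≤ X := by positivity
  have u2 : Z * (M ^ 2 * τ ^ 2) ≤ Z * X := by gcongr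
  have u3 : Z * (M ^ 3 * τ ^ 2) ≤ Z * X := by gcongr
  have v2 : K * Z * (M ^ 2 * τ ^ 2) ≤ K * Z * X := by gcongr
  have v3 : K * Z * (M ^ 3 * τ ^ 2) ≤ K * Z * X := by gcongr
  have w1 : 0 ≤ K * X := by positivity
  have w2 : 0 ≤ Z * X := by positivity
  have w3 : 0 ≤ K * Z * X := by positivity
  rw [show 10 ^ 9 * (M ^ 4 * (1 + K) * (1 + Z)) * τ ^ 2 =
    10 ^ 9 * (X + K * X + Z * X + K * Z * X) by rw [hX]; ring]
  linarith [T0, S0, T1, T2, S1, S2, S3]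

section

/-! ### Second moments of quadratic expressions in independent Gaussians -/

section moments

variable {ι : Type*}

/-- The law of a family of independent standard Gaussians. -/
abbrev stdGauss (ι : Type*) : Measure (ι → ℝ) := Measure.infinitePi fun _ => gaussianReal 0 1

/-- The fourth moment of the standard Gaussian. -/
def fourthMoment : ℝ := ∫ x, x ^ 4 ∂gaussianReal 0 1

lemma integral_comp_eval {f : ℝ → ℝ} (hf : Measurable f) (i : ι) :
    ∫ ω, f (ω i) ∂stdGauss ι = ∫ x, f x ∂gaussianReal 0 1 := by
  have h := Measure.infinitePi_map_eval (fun _ : ι => gaussianReal 0 1) i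
  rw [← h, integral_map (measurable_pi_apply i).aemeasurable hf.aestronglyMeasurable]

lemma integrable_comp_eval {f : ℝ → ℝ} (hf : Integrable f (gaussianReal 0 1)) (i : ι) :
    Integrable (fun ω => f (ω i)) (stdGauss ι) := by
  have h := Measure.infinitePi_map_eval (fun _ : ι => gaussianReal 0 1) i
  rw [← h] at hf
  exact hf.comp_measurable (measurable_pi_apply i)

lemma integrable_pow_gaussianReal (k : ℕ) : Integrable (fun x => x ^ k) (gaussianReal 0 1) := by
  have h := (memLp_id_gaussianReal' (μ := 0) (v := 1) k (by simp)).integrable_norm_pow'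
  refine (integrable_norm_iff (by fun_prop)).1 ?_
  simpa using h

lemma integrable_four (i j k l : ι) :
    Integrable (fun ω : ι → ℝ => ω i * ω j * ω k * ω l) (stdGauss ι) := by
  have h4 : ∀ i : ι, Integrable (fun ω => ω i ^ 4) (stdGauss ι) := fun i =>
    integrable_comp_eval (integrable_pow_gaussianReal 4) i
  refine (((h4 i).add (h4 j)).add ((h4 k).add (h4 l))).mono'
    (Measurable.aestronglyMeasurable (by fun_prop)) (ae_of_all _ fun ω => ?_)
  simp only [Pi.add_apply, Real.norm_eq_abs, abs_le]
  constructor <;>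
  nlinarith [sq_nonneg (ω i * ω j + ω k * ω l), sq_nonneg (ω i * ω j - ω k * ω l),
    sq_nonneg (ω i ^ 2 - ω j ^ 2), sq_nonneg (ω k ^ 2 - ω l ^ 2), sq_nonneg (ω i ^ 2),
    sq_nonneg (ω j ^ 2), sq_nonneg (ω k ^ 2), sq_nonneg (ω l ^ 2)]

lemma integrable_two (i j : ι) :
    Integrable (fun ω : ι → ℝ => ω i * ω j) (stdGauss ι) := by
  have h2 : ∀ i : ι, Integrable (fun ω => ω i ^ 2) (stdGauss ι) := fun i =>
    integrable_comp_eval (integrable_pow_gaussianReal 2) i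
  refine ((h2 i).add (h2 j)).mono' (Measurable.aestronglyMeasurable (by fun_prop))
    (ae_of_all _ fun ω => ?_)
  simp only [Pi.add_apply, Real.norm_eq_abs, abs_le]
  constructor <;> nlinarith [sq_nonneg (ω i + ω j), sq_nonneg (ω i - ω j)]

lemma integral_sq_gaussianReal : ∫ x, x ^ 2 ∂gaussianReal 0 1 = 1 := by
  have h := variance_id_gaussianReal (μ := 0) (v := 1)
  rw [variance_of_integral_eq_zero aemeasurable_id (by simp)] at h
  simpa using h

lemma indepFun_eval {i j k l : ι} (hj : i ≠ j) (hk : i ≠ k) (hl : i ≠ l) :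
    IndepFun (fun ω : ι → ℝ => ω i) (fun ω => (ω j, ω k, ω l)) (stdGauss ι) := by
  classical
  have h := (iIndepFun_infinitePi (P := fun _ : ι => gaussianReal 0 1) (X := fun _ x => x)
    (fun _ => measurable_id)).indepFun_finset {i} {j, k, l} (by simp [hj, hk, hl])
    (fun i => measurable_pi_apply i)
  exact h.comp (φ := fun x : ({i} : Finset ι) → ℝ => x ⟨i, by simp⟩)
    (ψ := fun x : ({j, k, l} : Finset ι) → ℝ =>
      (x ⟨j, by simp⟩, x ⟨k, by simp⟩, x ⟨l, by simp⟩)) (by fun_prop) (by fun_prop)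

lemma integral_indep {i j k l : ι} (hj : i ≠ j) (hk : i ≠ k) (hl : i ≠ l) {φ : ℝ → ℝ}
    {ψ : ℝ × ℝ × ℝ → ℝ} (hφ : Measurable φ) (hψ : Measurable ψ) :
    ∫ ω, φ (ω i) * ψ (ω j, ω k, ω l) ∂stdGauss ι =
      (∫ x, φ x ∂gaussianReal 0 1) * ∫ ω, ψ (ω j, ω k, ω l) ∂stdGauss ι := by
  have h := ((indepFun_eval hj hk hl).comp hφ hψ).integral_fun_mul_eq_mul_integral
    (Measurable.aestronglyMeasurable (by fun_prop)) (Measurable.aestronglyMeasurable (by fun_prop))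
  simp only [Function.comp_apply] at h
  rw [h, integral_comp_eval hφ]

lemma integral_four_eq_zero {i j k l : ι} (hj : i ≠ j) (hk : i ≠ k) (hl : i ≠ l) :
    ∫ ω, ω i * ω j * ω k * ω l ∂stdGauss ι = 0 := by
  have h := integral_indep hj hk hl (φ := fun x => x) (ψ := fun p => p.1 * p.2.1 * p.2.2)
    measurable_id (by fun_prop)
  rw [integral_id_gaussianReal, zero_mul] at h
  rw [← h]
  congr 1
  ext ω
  ring

lemma integral_two_eq [DecidableEq ι] (i j : ι) :
    ∫ ω, ω i * ω j ∂stdGauss ι = if i = j then 1 else 0 := by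
  split_ifs with h
  · subst h
    have := integral_comp_eval (f := fun x => x ^ 2) (by fun_prop) i
    rw [integral_sq_gaussianReal] at this
    simpa [sq] using this
  · have := integral_indep h h h (φ := fun x => x) (ψ := fun p => p.1) measurable_id (by fun_prop)
    rwa [integral_id_gaussianReal, zero_mul] at this

lemma integral_four_pair {i k : ι} (h : i ≠ k) :
    ∫ ω, ω i * ω i * ω k * ω k ∂stdGauss ι = 1 := by
  classical
  have h1 := integral_indep h h h (φ := fun x => x ^ 2) (ψ := fun p => p.1 * p.1)
    (by fun_prop) (by fun_prop)
  rw [integral_sq_gaussianReal, one_mul, integral_two_eq, if_pos rfl] at h1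
  rw [← h1]
  congr 1
  ext ω
  ring

/-- Isserlis' formula. The three pairings already account for 3 on the full diagonal, and the last
term corrects it, so the fourth moment need not be evaluated. -/
lemma integral_four_eq [DecidableEq ι] (i j k l : ι) :
    ∫ ω, ω i * ω j * ω k * ω l ∂stdGauss ι =
      (if i = j then 1 else 0) * (if k = l then 1 else 0) +
      (if i = k then 1 else 0) * (if j = l then 1 else 0) +
      (if i = l then 1 else 0) * (if j = k then 1 else 0) +
      if i = j ∧ i = k ∧ i = l then fourthMoment - 3 else 0 := by
  have perm : ∀ a b c d : ι, (∀ ω : ι → ℝ, ω i * ω j * ω k * ω l = ω a * ω b * ω c * ω d) →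
      ∫ ω, ω i * ω j * ω k * ω l ∂stdGauss ι = ∫ ω, ω a * ω b * ω c * ω d ∂stdGauss ι :=
    fun a b c d h => integral_congr_ae (ae_of_all _ h)
  by_cases hij : i = j
  · subst hij
    by_cases hkl : k = l
    · subst hkl
      by_cases hik : i = k
      · subst hik
        have := integral_comp_eval (f := fun x => x ^ 4) (by fun_prop) i
        rw [← fourthMoment] at this
        simp only [and_self, if_true, mul_one]
        rw [← this.symm.trans (integral_congr_ae (ae_of_all _ fun ω => ?_))]
        · ring
        · simp only; ring
      · rw [integral_four_pair hik]
        simp [hik]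
    · by_cases hki : k = i
      · subst hki
        rw [perm l k k k (fun ω => by ring), integral_four_eq_zero (Ne.symm hkl) (Ne.symm hkl)
          (Ne.symm hkl)]
        simp [hkl]
      · rw [perm k i i l (fun ω => by ring), integral_four_eq_zero hki hki hkl]
        simp [hkl, Ne.symm hki]
  · by_cases hik : i = k
    · subst hik
      by_cases hjl : j = l
      · subst hjl
        rw [perm i i j j (fun ω => by ring), integral_four_pair hij]
        simp [hij]
      · rw [perm j i i l (fun ω => by ring), integral_four_eq_zero (Ne.symm hij) (Ne.symm hij) hjl]
        simp [hij, hjl, Ne.symm hij]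
    · by_cases hil : i = l
      · subst hil
        by_cases hjk : j = k
        · subst hjk
          rw [perm i i j j (fun ω => by ring), integral_four_pair hij]
          simp [hij]
        · rw [perm j i i k (fun ω => by ring), integral_four_eq_zero (Ne.symm hij) (Ne.symm hij) hjk]
          simp [hij, hjk, hik]
      · rw [integral_four_eq_zero hij hik hil]
        simp [hij, hik, hil]

/-- The constant in the variance bound for quadratic forms. -/
def quadFormConst : ℝ := 2 + |fourthMoment - 3|

lemma quadFormConst_pos : 0 < quadFormConst := by unfold quadFormConst; positivity

/-- The centred quadratic form `∑ A_{ij} (ω_i ω_j - δ_{ij})`. -/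
def centredForm [DecidableEq ι] (I : Finset ι) (A : ι → ι → ℂ) (ω : ι → ℝ) : ℂ :=
  ∑ i ∈ I, ∑ j ∈ I, A i j * ((ω i * ω j - (if i = j then 1 else 0) : ℝ) : ℂ)

lemma integrable_centred_mul [DecidableEq ι] (i j k l : ι) :
    Integrable (fun ω : ι → ℝ => (ω i * ω j - (if i = j then 1 else 0)) *
      (ω k * ω l - (if k = l then 1 else 0))) (stdGauss ι) := by
  have h := (((integrable_four i j k l).sub ((integrable_two i j).mul_const
    (if k = l then 1 else 0))).sub ((integrable_two k l).const_mul (if i = j then 1 else 0))).add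
    (integrable_const ((if i = j then (1 : ℝ) else 0) * (if k = l then 1 else 0)))
  refine h.congr (ae_of_all _ fun ω => ?_)
  simp only [Pi.add_apply, Pi.sub_apply]
  ring

/-- Centring removes exactly the pairing of `i` with `j` and `k` with `l`. In the variance it would
contribute the squared trace, which the Hilbert–Schmidt norm does not control uniformly in
dimension. -/
lemma integral_centred_mul [DecidableEq ι] (i j k l : ι) :
    ∫ ω, (ω i * ω j - (if i = j then 1 else 0)) *
      (ω k * ω l - (if k = l then 1 else 0)) ∂stdGauss ι =
      (if i = k then 1 else 0) * (if j = l then 1 else 0) +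
      (if i = l then 1 else 0) * (if j = k then 1 else 0) +
      if i = j ∧ i = k ∧ i = l then fourthMoment - 3 else 0 := by
  have e : (fun ω : ι → ℝ => (ω i * ω j - (if i = j then 1 else 0)) *
      (ω k * ω l - (if k = l then 1 else 0))) = fun ω => ω i * ω j * ω k * ω l -
      (ω i * ω j) * (if k = l then 1 else 0) - (if i = j then 1 else 0) * (ω k * ω l) +
      (if i = j then (1 : ℝ) else 0) * (if k = l then 1 else 0) := by
    ext ω; ring
  have i1 := integrable_four (ι := ι) i j k l
  have i2 := (integrable_two i j).mul_const (if k = l then (1 : ℝ) else 0)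
  have i3 := (integrable_two k l).const_mul (if i = j then (1 : ℝ) else 0)
  have i12 : Integrable (fun ω : ι → ℝ => ω i * ω j * ω k * ω l -
      (ω i * ω j) * (if k = l then 1 else 0)) (stdGauss ι) := i1.sub i2
  have i123 : Integrable (fun ω : ι → ℝ => ω i * ω j * ω k * ω l -
      (ω i * ω j) * (if k = l then 1 else 0) - (if i = j then 1 else 0) * (ω k * ω l))
      (stdGauss ι) := i12.sub i3
  rw [e, integral_add i123 (integrable_const _), integral_sub i12 i3, integral_sub i1 i2, integral_mul_const, integral_const_mul, integral_four_eq, integral_two_eq,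
    integral_two_eq]
  simp
  ring

lemma normSq_centredForm [DecidableEq ι] (I : Finset ι) (A : ι → ι → ℂ) (ω : ι → ℝ) :
    ‖centredForm I A ω‖ ^ 2 = ∑ i ∈ I, ∑ j ∈ I, ∑ k ∈ I, ∑ l ∈ I,
      (A i j * (starRingEnd ℂ) (A k l)).re * ((ω i * ω j - (if i = j then 1 else 0)) *
      (ω k * ω l - (if k = l then 1 else 0))) := by
  have h : (‖centredForm I A ω‖ ^ 2 : ℝ) =
      (centredForm I A ω * (starRingEnd ℂ) (centredForm I A ω)).re := by
    rw [Complex.mul_conj, Complex.normSq_eq_norm_sq, Complex.ofReal_re]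
  rw [h]
  unfold centredForm
  simp only [map_sum, Finset.sum_mul, Complex.re_sum]
  refine Finset.sum_congr rfl fun i _ => Finset.sum_congr rfl fun j _ => ?_
  simp only [Finset.mul_sum, Complex.re_sum]
  refine Finset.sum_congr rfl fun k _ => Finset.sum_congr rfl fun l _ => ?_
  rw [map_mul, Complex.conj_ofReal,
    show ∀ x y z w : ℂ, x * y * (z * w) = x * z * (y * w) by intros; ring, ← Complex.ofReal_mul,
    Complex.re_mul_ofReal]

lemma integrable_normSq_centredForm [DecidableEq ι] (I : Finset ι) (A : ι → ι → ℂ) :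
    Integrable (fun ω => ‖centredForm I A ω‖ ^ 2) (stdGauss ι) := by
  simp only [normSq_centredForm]
  exact integrable_finsetSum _ fun i _ => integrable_finsetSum _ fun j _ =>
    integrable_finsetSum _ fun k _ => integrable_finsetSum _ fun l _ =>
      (integrable_centred_mul i j k l).const_mul _

/-- The surviving pairings contribute `‖A‖²` and the inner product of `A` with its transpose, at
most `‖A‖²`. The diagonal correction is at most `|fourthMoment - 3| ‖A‖²`. -/
lemma integral_normSq_centredForm_le [DecidableEq ι] (I : Finset ι) (A : ι → ι → ℂ) :
    ∫ ω, ‖centredForm I A ω‖ ^ 2 ∂stdGauss ι ≤ quadFormConst * ∑ i ∈ I, ∑ j ∈ I, ‖A i j‖ ^ 2 := by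
  have hint : ∫ ω, ‖centredForm I A ω‖ ^ 2 ∂stdGauss ι = ∑ i ∈ I, ∑ j ∈ I, ∑ k ∈ I, ∑ l ∈ I,
      (A i j * (starRingEnd ℂ) (A k l)).re * ((if i = k then 1 else 0) * (if j = l then 1 else 0) +
      (if i = l then 1 else 0) * (if j = k then 1 else 0) +
      if i = j ∧ i = k ∧ i = l then fourthMoment - 3 else 0) := by
    simp only [normSq_centredForm]
    rw [integral_finsetSum _ fun i _ => integrable_finsetSum _ fun j _ =>
      integrable_finsetSum _ fun k _ => integrable_finsetSum _ fun l _ =>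
      (integrable_centred_mul i j k l).const_mul _]
    refine Finset.sum_congr rfl fun i _ => ?_
    rw [integral_finsetSum _ fun j _ => integrable_finsetSum _ fun k _ =>
      integrable_finsetSum _ fun l _ => (integrable_centred_mul i j k l).const_mul _]
    refine Finset.sum_congr rfl fun j _ => ?_
    rw [integral_finsetSum _ fun k _ => integrable_finsetSum _ fun l _ =>
      (integrable_centred_mul i j k l).const_mul _]
    refine Finset.sum_congr rfl fun k _ => ?_
    rw [integral_finsetSum _ fun l _ => (integrable_centred_mul i j k l).const_mul _]
    refine Finset.sum_congr rfl fun l _ => ?_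
    rw [integral_const_mul, integral_centred_mul]
  rw [hint]
  have hcell : ∀ i ∈ I, ∀ j ∈ I, ∑ k ∈ I, ∑ l ∈ I,
      (A i j * (starRingEnd ℂ) (A k l)).re * ((if i = k then 1 else 0) * (if j = l then 1 else 0) +
      (if i = l then 1 else 0) * (if j = k then 1 else 0) +
      if i = j ∧ i = k ∧ i = l then fourthMoment - 3 else 0) =
      (A i j * (starRingEnd ℂ) (A i j)).re + (A i j * (starRingEnd ℂ) (A j i)).re +
      if i = j then (A i j * (starRingEnd ℂ) (A i j)).re * (fourthMoment - 3) else 0 := by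
    intro i hi j hj
    have h1 : ∑ k ∈ I, ∑ l ∈ I, (A i j * (starRingEnd ℂ) (A k l)).re *
        ((if i = k then 1 else 0) * (if j = l then 1 else 0)) =
        (A i j * (starRingEnd ℂ) (A i j)).re := by
      rw [Finset.sum_eq_single_of_mem i hi (fun k _ hk => by simp [Ne.symm hk]),
        Finset.sum_eq_single_of_mem j hj (fun l _ hl => by simp [Ne.symm hl])]
      simp
    have h2 : ∑ k ∈ I, ∑ l ∈ I, (A i j * (starRingEnd ℂ) (A k l)).re *
        ((if i = l then 1 else 0) * (if j = k then 1 else 0)) =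
        (A i j * (starRingEnd ℂ) (A j i)).re := by
      rw [Finset.sum_eq_single_of_mem j hj (fun k _ hk => by simp [Ne.symm hk]),
        Finset.sum_eq_single_of_mem i hi (fun l _ hl => by simp [Ne.symm hl])]
      simp
    have h3 : ∑ k ∈ I, ∑ l ∈ I, (A i j * (starRingEnd ℂ) (A k l)).re *
        (if i = j ∧ i = k ∧ i = l then fourthMoment - 3 else 0) =
        if i = j then (A i j * (starRingEnd ℂ) (A i j)).re * (fourthMoment - 3) else 0 := by
      by_cases hij : i = j
      · subst hij
        rw [Finset.sum_eq_single_of_mem i hi (fun k _ hk => by simp [Ne.symm hk]),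
          Finset.sum_eq_single_of_mem i hi (fun l _ hl => by simp [Ne.symm hl])]
        simp
      · simp [hij]
    simp only [mul_add, Finset.sum_add_distrib]
    rw [h1, h2, h3]
  have hnn : ∀ z : ℂ, (z * (starRingEnd ℂ) z).re = ‖z‖ ^ 2 := fun z => by
    rw [Complex.mul_conj, Complex.normSq_eq_norm_sq, Complex.ofReal_re]
  have hcross : ∀ z w : ℂ, (z * (starRingEnd ℂ) w).re ≤ (‖z‖ ^ 2 + ‖w‖ ^ 2) / 2 := fun z w => by
    have h1 := Complex.re_le_norm (z * (starRingEnd ℂ) w)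
    rw [norm_mul, RCLike.norm_conj] at h1
    nlinarith [sq_nonneg (‖z‖ - ‖w‖)]
  calc _ = ∑ i ∈ I, ∑ j ∈ I, ((A i j * (starRingEnd ℂ) (A i j)).re +
        (A i j * (starRingEnd ℂ) (A j i)).re +
        if i = j then (A i j * (starRingEnd ℂ) (A i j)).re * (fourthMoment - 3) else 0) :=
        Finset.sum_congr rfl fun i hi => Finset.sum_congr rfl fun j hj => hcell i hi j hj
    _ ≤ ∑ i ∈ I, ∑ j ∈ I, (‖A i j‖ ^ 2 + (‖A i j‖ ^ 2 + ‖A j i‖ ^ 2) / 2 +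
        ‖A i j‖ ^ 2 * |fourthMoment - 3|) := by
        refine Finset.sum_le_sum fun i _ => Finset.sum_le_sum fun j _ => ?_
        rw [hnn]
        gcongr
        · exact hcross _ _
        · split_ifs
          · gcongr
            exact le_abs_self _
          · positivity
    _ = quadFormConst * ∑ i ∈ I, ∑ j ∈ I, ‖A i j‖ ^ 2 := by
        have hs : ∑ i ∈ I, ∑ j ∈ I, ‖A j i‖ ^ 2 = ∑ i ∈ I, ∑ j ∈ I, ‖A i j‖ ^ 2 :=
          Finset.sum_comm
        simp only [Finset.sum_add_distrib, ← Finset.sum_div, ← Finset.sum_mul, hs]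
        unfold quadFormConst
        ring

end moments

end

section

/-! ### The Gaussian Fourier coefficients as linear forms of the sample -/

lemma isPos_or_isPos_neg {n : Freq} (h : n ≠ 0) : IsPos n ∨ IsPos (-n) := by
  have h' : n 0 ≠ 0 ∨ n 1 ≠ 0 := by
    by_contra hc
    push Not at hc
    exact h (funext fun i => by fin_cases i <;> simp [hc])
  unfold IsPos
  simp only [Pi.neg_apply]
  omega

lemma not_isPos_neg {n : Freq} (h : IsPos n) : ¬ IsPos (-n) := by
  unfold IsPos at *
  simp only [Pi.neg_apply]
  omega

open scoped Classical in
/-- The representative of `{n, -n}` in `Λ`. -/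
def rep (n : Freq) : Freq := if n = 0 ∨ IsPos n then n else -n

lemma rep_eq_or (n : Freq) : rep n = n ∨ rep n = -n := by
  unfold rep; split_ifs <;> simp

lemma rep_neg (n : Freq) : rep (-n) = rep n := by
  unfold rep
  by_cases h0 : n = 0
  · simp [h0]
  rcases isPos_or_isPos_neg h0 with h | h
  · simp [h0, h, not_isPos_neg h]
  · have := not_isPos_neg h
    rw [neg_neg] at this
    simp [h0, h, this]

lemma eq_or_eq_neg_of_rep_eq {n m : Freq} (h : rep n = rep m) : m = n ∨ m = -n := by
  rcases rep_eq_or n with hn | hn <;> rcases rep_eq_or m with hm | hm <;> rw [hn, hm] at h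
  · exact Or.inl h.symm
  · right; rw [h, neg_neg]
  · right; exact h.symm
  · left; exact (neg_injective h).symm

open scoped Classical in
/-- The coefficients of `gauss k n` with respect to the coordinates of the sample. -/
def unitCoeff (n : Freq) (j : Fin 2) : ℂ :=
  if n = 0 then (if j = 0 then 1 else 0)
  else if IsPos n then (if j = 0 then 1 else Complex.I) / (√2 : ℝ)
  else (if j = 0 then 1 else -Complex.I) / (√2 : ℝ)

lemma gauss_eq (k : Fin 2) (n : Freq) (ω : Sample) :
    gauss k n ω = ∑ j, unitCoeff n j * (ω (k, rep n, j) : ℂ) := by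
  rw [Fin.sum_univ_two]
  unfold gauss unitCoeff rep stdGaussian
  by_cases h0 : n = 0
  · simp [h0]
  by_cases hp : IsPos n
  · simp only [h0, hp, if_false, if_true, or_true]
    simp
    ring
  · simp only [h0, hp, if_false, or_self]
    simp
    ring

lemma norm_unitCoeff_le (n : Freq) (j : Fin 2) : ‖unitCoeff n j‖ ≤ 1 := by
  have h2 : (√2)⁻¹ ≤ 1 := inv_le_one_of_one_le₀ (Real.one_le_sqrt.2 (by norm_num))
  unfold unitCoeff
  split_ifs <;> simp [abs_of_nonneg (Real.sqrt_nonneg 2), h2]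

lemma sum_normSq_unitCoeff (n : Freq) : ∑ j, ‖unitCoeff n j‖ ^ 2 = 1 := by
  rw [Fin.sum_univ_two]
  unfold unitCoeff
  by_cases h0 : n = 0
  · simp [h0]
  by_cases hp : IsPos n <;> simp only [h0, hp, if_false, if_true] <;> simp <;> norm_num

lemma sqrt_two_sq_complex : ((√2 : ℝ) : ℂ) ^ 2 = 2 := by
  rw [← Complex.ofReal_pow, Real.sq_sqrt (by norm_num)]
  norm_num

/-- This encodes `E[g_n g_m]`, without conjugate. It vanishes for `m = n ≠ 0` because `1 + i² = 0`,
and equals 1 for `m = -n`. -/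
lemma sum_unitCoeff_mul (n m : Freq) (h : rep n = rep m) :
    ∑ j, unitCoeff n j * unitCoeff m j = if n + m = 0 then 1 else 0 := by
  have hs : ((√2 : ℝ) : ℂ) ≠ 0 := by simp
  have hs2 := sqrt_two_sq_complex
  have hI := Complex.I_sq
  have h2 : ∀ p : Freq, p ≠ 0 → p + p ≠ 0 := by
    intro p hp hpp
    apply hp
    funext i
    have := congrFun hpp i
    simp only [Pi.add_apply, Pi.zero_apply] at this ⊢
    omega
  rw [Fin.sum_univ_two]
  unfold unitCoeff
  rcases eq_or_eq_neg_of_rep_eq h with rfl | rfl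
  · by_cases h0 : m = 0
    · simp [h0]
    · rw [if_neg (h2 m h0)]
      by_cases hp : IsPos m <;> simp only [h0, hp, if_false, if_true] <;> simp <;> field_simp <;>
        linear_combination hI
  · by_cases h0 : n = 0
    · simp [h0]
    · rcases isPos_or_isPos_neg h0 with hp | hp
      · have hn := not_isPos_neg hp
        simp only [h0, hp, hn, neg_eq_zero, if_false, if_true]
        simp
        field_simp
        linear_combination -hs2 - hI
      · have hn := not_isPos_neg hp
        rw [neg_neg] at hn
        simp only [h0, hp, hn, neg_eq_zero, if_false, if_true]
        simp
        field_simp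
        linear_combination -hs2 - hI

lemma gauss_neg (k : Fin 2) (n : Freq) (ω : Sample) :
    gauss k (-n) ω = (starRingEnd ℂ) (gauss k n ω) := by
  unfold gauss
  by_cases h0 : n = 0
  · simp [h0]
  rcases isPos_or_isPos_neg h0 with hp | hp
  · simp [h0, hp, not_isPos_neg hp]
  · have hn := not_isPos_neg hp
    rw [neg_neg] at hn
    simp [h0, hp, hn]

lemma normSq_gauss (k : Fin 2) (n : Freq) (ω : Sample) :
    ‖gauss k n ω‖ ^ 2 = ∑ j, ‖unitCoeff n j‖ ^ 2 * ω (k, rep n, j) ^ 2 := by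
  have key : ∀ x y : ℝ, ‖((x : ℂ) + Complex.I * y) / (√2 : ℝ)‖ ^ 2 = (x ^ 2 + y ^ 2) / 2 := by
    intro x y
    rw [norm_div, div_pow, mul_comm, Complex.sq_norm, Complex.normSq_add_mul_I,
      Complex.norm_real, Real.norm_eq_abs, sq_abs, Real.sq_sqrt (by norm_num)]
  rw [Fin.sum_univ_two]
  unfold gauss unitCoeff rep stdGaussian
  by_cases h0 : n = 0
  · simp [h0]
  by_cases hp : IsPos n
  · simp only [h0, hp, if_false, if_true, or_true]
    rw [key]
    simp
    ring
  · simp only [h0, hp, if_false, or_self]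
    rw [RCLike.norm_conj, key]
    simp
    ring

lemma integrable_normSq_gauss (k : Fin 2) (n : Freq) :
    Integrable (fun ω => ‖gauss k n ω‖ ^ 2) sampleMeasure := by
  simp only [normSq_gauss]
  refine integrable_finsetSum _ fun j _ => Integrable.const_mul ?_ _
  exact integrable_comp_eval (integrable_pow_gaussianReal 2) _

lemma integral_normSq_gauss (k : Fin 2) (n : Freq) :
    ∫ ω, ‖gauss k n ω‖ ^ 2 ∂sampleMeasure = 1 := by
  have hi : ∀ j ∈ (Finset.univ : Finset (Fin 2)), Integrable
      (fun ω : Sample => ‖unitCoeff n j‖ ^ 2 * ω (k, rep n, j) ^ 2) sampleMeasure := fun j _ =>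
    Integrable.const_mul (integrable_comp_eval (integrable_pow_gaussianReal 2) _) _
  simp only [normSq_gauss]
  rw [integral_finsetSum _ hi]
  rw [← sum_normSq_unitCoeff n]
  refine Finset.sum_congr rfl fun j _ => ?_
  have h := integral_comp_eval (f := fun x => x ^ 2) (by fun_prop) (k, rep n, j)
  rw [integral_const_mul, sampleMeasure, h, integral_sq_gaussianReal, mul_one]

/-! ### The linear map from samples to coefficients and its Schur bounds. -/

/-- The coordinates of the sample involved in the coefficients with frequencies in `B`. -/
def sampleIndex (B : Finset Freq) : Finset (Fin 2 × Freq × Fin 2) :=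
  Finset.univ ×ˢ B ×ˢ Finset.univ

/-- The matrix of the linear map from samples to Fourier coefficients. -/
def gaussMatrix (k : Fin 2) (n : Freq) (i : Fin 2 × Freq × Fin 2) : ℂ :=
  if i.1 = k ∧ i.2.1 = rep n then unitCoeff n i.2.2 else 0

variable {B : Finset Freq}

lemma rep_mem (hB : ∀ n ∈ B, -n ∈ B) {n : Freq} (hn : n ∈ B) : rep n ∈ B := by
  rcases rep_eq_or n with h | h <;> rw [h]
  · exact hn
  · exact hB n hn

lemma sum_gaussMatrix_mul {R : Type*} [AddCommMonoid R] (hB : ∀ n ∈ B, -n ∈ B) {n : Freq}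
    (hn : n ∈ B) (k : Fin 2) (f : (Fin 2 × Freq × Fin 2) → ℂ → R) (hf : ∀ i, f i 0 = 0) :
    ∑ i ∈ sampleIndex B, f i (gaussMatrix k n i) = ∑ j, f (k, rep n, j) (unitCoeff n j) := by
  unfold sampleIndex gaussMatrix
  rw [Finset.sum_product, Finset.sum_eq_single_of_mem k (Finset.mem_univ k)
    (fun k' _ hk' => by simp [hk', hf]), Finset.sum_product,
    Finset.sum_eq_single_of_mem (rep n) (rep_mem hB hn) (fun m _ hm => by simp [hm, hf])]
  simp

lemma gauss_eq_sum (hB : ∀ n ∈ B, -n ∈ B) {n : Freq} (hn : n ∈ B) (k : Fin 2) (ω : Sample) :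
    gauss k n ω = ∑ i ∈ sampleIndex B, gaussMatrix k n i * (ω i : ℂ) := by
  rw [gauss_eq, sum_gaussMatrix_mul hB hn k (fun i z => z * (ω i : ℂ)) (by simp)]

lemma sum_gaussMatrix_mul_gaussMatrix (hB : ∀ n ∈ B, -n ∈ B) {n m : Freq}
    (hn : n ∈ B) (k l : Fin 2) :
    ∑ i ∈ sampleIndex B, gaussMatrix k n i * gaussMatrix l m i =
      if k = l ∧ n + m = 0 then 1 else 0 := by
  rw [sum_gaussMatrix_mul hB hn k (fun i z => z * gaussMatrix l m i) (by simp)]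
  unfold gaussMatrix
  by_cases hkl : k = l
  · by_cases hr : rep n = rep m
    · simp only [hkl, hr, and_self, if_true, true_and]
      exact sum_unitCoeff_mul n m hr
    · have : n + m ≠ 0 := by
        intro h0
        rw [add_eq_zero_iff_eq_neg] at h0
        rw [h0, rep_neg] at hr
        exact hr rfl
      simp [hkl, hr, this]
  · simp [hkl]

lemma sum_norm_gaussMatrix_index_le (hB : ∀ n ∈ B, -n ∈ B) {n : Freq} (hn : n ∈ B) (k : Fin 2) :
    ∑ i ∈ sampleIndex B, ‖gaussMatrix k n i‖ ≤ 2 := by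
  rw [sum_gaussMatrix_mul hB hn k (fun _ z => ‖z‖) (by simp), Fin.sum_univ_two]
  linarith [norm_unitCoeff_le n 0, norm_unitCoeff_le n 1]

/-- A coordinate enters only the coefficients of one frequency and its opposite, with factors of
modulus at most 1. -/
lemma sum_norm_gaussMatrix_freq_le (k : Fin 2) (i : Fin 2 × Freq × Fin 2) :
    ∑ n ∈ B, ‖gaussMatrix k n i‖ ≤ 2 := by
  have h : ∀ n ∈ B, ‖gaussMatrix k n i‖ ≤ if n ∈ ({i.2.1, -i.2.1} : Finset Freq) then 1 else 0 := by
    intro n _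
    unfold gaussMatrix
    by_cases hc : i.1 = k ∧ i.2.1 = rep n
    · have : n ∈ ({i.2.1, -i.2.1} : Finset Freq) := by
        rw [Finset.mem_insert, Finset.mem_singleton, hc.2]
        rcases rep_eq_or n with h | h <;> simp [h]
      rw [if_pos hc, if_pos this]
      exact norm_unitCoeff_le _ _
    · rw [if_neg hc]
      split_ifs <;> simp
  calc _ ≤ ∑ n ∈ B, if n ∈ ({i.2.1, -i.2.1} : Finset Freq) then (1 : ℝ) else 0 :=
        Finset.sum_le_sum h
    _ = ((B.filter fun n => n ∈ ({i.2.1, -i.2.1} : Finset Freq)).card : ℝ) := by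
        rw [Finset.sum_boole]
    _ ≤ (({i.2.1, -i.2.1} : Finset Freq).card : ℝ) := by
        gcongr
        intro n hn
        exact (Finset.mem_filter.1 hn).2
    _ ≤ 2 := by exact_mod_cast Finset.card_le_two

/-- Schur's test for finite matrices. -/
lemma sum_normSq_sum_mul_le {ι κ : Type*} (I : Finset ι) (K : Finset κ) (C : κ → ι → ℂ)
    (x : κ → ℂ) {α β : ℝ} (hα : 0 ≤ α) (h₁ : ∀ i ∈ I, ∑ n ∈ K, ‖C n i‖ ≤ α)
    (h₂ : ∀ n ∈ K, ∑ i ∈ I, ‖C n i‖ ≤ β) :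
    ∑ i ∈ I, ‖∑ n ∈ K, C n i * x n‖ ^ 2 ≤ α * β * ∑ n ∈ K, ‖x n‖ ^ 2 := by
  have h : ∀ i ∈ I, ‖∑ n ∈ K, C n i * x n‖ ^ 2 ≤ α * ∑ n ∈ K, ‖C n i‖ * ‖x n‖ ^ 2 := by
    intro i hi
    calc ‖∑ n ∈ K, C n i * x n‖ ^ 2 ≤ (∑ n ∈ K, √‖C n i‖ * (√‖C n i‖ * ‖x n‖)) ^ 2 := by
          gcongr
          refine norm_sum_le_of_le _ fun n _ => ?_
          rw [norm_mul, ← mul_assoc, Real.mul_self_sqrt (norm_nonneg _)]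
      _ ≤ (∑ n ∈ K, √‖C n i‖ ^ 2) * ∑ n ∈ K, (√‖C n i‖ * ‖x n‖) ^ 2 :=
          Finset.sum_mul_sq_le_sq_mul_sq _ _ _
      _ = (∑ n ∈ K, ‖C n i‖) * ∑ n ∈ K, ‖C n i‖ * ‖x n‖ ^ 2 := by
          simp only [mul_pow, Real.sq_sqrt (norm_nonneg _)]
      _ ≤ _ := by
          gcongr
          exact h₁ i hi
  calc _ ≤ ∑ i ∈ I, α * ∑ n ∈ K, ‖C n i‖ * ‖x n‖ ^ 2 := Finset.sum_le_sum h
    _ = α * ∑ n ∈ K, (∑ i ∈ I, ‖C n i‖) * ‖x n‖ ^ 2 := by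
        rw [← Finset.mul_sum, Finset.sum_comm]
        simp only [Finset.sum_mul]
    _ ≤ α * ∑ n ∈ K, β * ‖x n‖ ^ 2 := by
        gcongr with n hn
        exact h₂ n hn
    _ = _ := by rw [← Finset.mul_sum]; ring

/-- The Fourier coefficients depend in a Lipschitz way on the sample. -/
lemma sum_normSq_gauss_sub_le (hB : ∀ n ∈ B, -n ∈ B) (k : Fin 2) (x y : Sample) :
    ∑ n ∈ B, ‖gauss k n x - gauss k n y‖ ^ 2 ≤ 4 * ∑ i ∈ sampleIndex B, (x i - y i) ^ 2 := by
  have h := sum_normSq_sum_mul_le B (sampleIndex B) (fun i n => gaussMatrix k n i)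
    (fun i => ((x i - y i : ℝ) : ℂ)) (α := 2) (β := 2) (by norm_num)
    (fun n hn => sum_norm_gaussMatrix_index_le hB hn k)
    (fun i _ => sum_norm_gaussMatrix_freq_le k i)
  refine (le_of_eq ?_).trans (h.trans (le_of_eq ?_))
  · refine Finset.sum_congr rfl fun n hn => ?_
    rw [gauss_eq_sum hB hn, gauss_eq_sum hB hn, ← Finset.sum_sub_distrib]
    simp only [Complex.ofReal_sub, mul_sub]
  · simp only [Complex.norm_real, Real.norm_eq_abs, sq_abs]
    norm_num

/-! ### Wick-ordered sums and their variance. -/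

/-- The Wick-ordered quadratic expression with coefficients `κ`. -/
def wickSum (B : Finset Freq) (k l : Fin 2) (κ : Freq → Freq → ℂ) (ω : Sample) : ℂ :=
  ∑ n ∈ B, ∑ m ∈ B, κ n m * (gauss k n ω * gauss l m ω - if k = l ∧ n + m = 0 then 1 else 0)

/-- The constant subtracted for `(n, m)` is the covariance, that is, the sum over `i` of products of
matrix entries. Wick ordering in the coefficients is therefore centring in the coordinates. -/
lemma wickSum_eq (hB : ∀ n ∈ B, -n ∈ B) (k l : Fin 2) (κ : Freq → Freq → ℂ) (ω : Sample) :
    wickSum B k l κ ω = centredForm (sampleIndex B)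
      (fun i j => ∑ n ∈ B, gaussMatrix k n i * ∑ m ∈ B, gaussMatrix l m j * κ n m) ω := by
  have h : ∀ n ∈ B, ∀ m ∈ B, gauss k n ω * gauss l m ω - (if k = l ∧ n + m = 0 then 1 else 0) =
      ∑ i ∈ sampleIndex B, ∑ j ∈ sampleIndex B, gaussMatrix k n i * gaussMatrix l m j *
        ((ω i * ω j - (if i = j then 1 else 0) : ℝ) : ℂ) := by
    intro n hn m hm
    rw [← sum_gaussMatrix_mul_gaussMatrix hB hn, gauss_eq_sum hB hn, gauss_eq_sum hB hm,
      Finset.sum_mul_sum, ← Finset.sum_sub_distrib]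
    refine Finset.sum_congr rfl fun i hi => ?_
    have : gaussMatrix k n i * gaussMatrix l m i = ∑ j ∈ sampleIndex B,
        gaussMatrix k n i * gaussMatrix l m j * (if i = j then 1 else 0) := by
      rw [Finset.sum_eq_single_of_mem i hi (fun j _ hj => by simp [Ne.symm hj])]
      simp
    rw [this, ← Finset.sum_sub_distrib]
    refine Finset.sum_congr rfl fun j _ => ?_
    split_ifs <;> push_cast <;> ring
  unfold wickSum centredForm
  calc _ = ∑ n ∈ B, ∑ m ∈ B, ∑ i ∈ sampleIndex B, ∑ j ∈ sampleIndex B,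
        κ n m * (gaussMatrix k n i * gaussMatrix l m j *
          ((ω i * ω j - (if i = j then 1 else 0) : ℝ) : ℂ)) := by
        refine Finset.sum_congr rfl fun n hn => Finset.sum_congr rfl fun m hm => ?_
        rw [h n hn m hm]
        simp only [Finset.mul_sum]
    _ = ∑ i ∈ sampleIndex B, ∑ j ∈ sampleIndex B, ∑ n ∈ B, ∑ m ∈ B,
        κ n m * (gaussMatrix k n i * gaussMatrix l m j *
          ((ω i * ω j - (if i = j then 1 else 0) : ℝ) : ℂ)) := by
        have h3 : ∀ n, ∀ f : Freq → (Fin 2 × Freq × Fin 2) → (Fin 2 × Freq × Fin 2) → ℂ,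
            n ∈ B → ∑ m ∈ B, ∑ i ∈ sampleIndex B, ∑ j ∈ sampleIndex B, f m i j =
              ∑ i ∈ sampleIndex B, ∑ j ∈ sampleIndex B, ∑ m ∈ B, f m i j := fun n f _ => by
          rw [Finset.sum_comm]
          exact Finset.sum_congr rfl fun i _ => Finset.sum_comm
        rw [Finset.sum_congr rfl fun n hn => h3 n _ hn, Finset.sum_comm]
        exact Finset.sum_congr rfl fun i _ => Finset.sum_comm
    _ = _ := by
        refine Finset.sum_congr rfl fun i _ => Finset.sum_congr rfl fun j _ => ?_
        simp only [Finset.mul_sum, Finset.sum_mul]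
        refine Finset.sum_congr rfl fun n _ => Finset.sum_congr rfl fun m _ => ?_
        ring

lemma integrable_normSq_wickSum (hB : ∀ n ∈ B, -n ∈ B) (k l : Fin 2) (κ : Freq → Freq → ℂ) :
    Integrable (fun ω => ‖wickSum B k l κ ω‖ ^ 2) sampleMeasure := by
  simp only [wickSum_eq hB]
  exact integrable_normSq_centredForm _ _

/-- Schur's test with row and column sums at most 2 costs a factor 4 in each of the two indices,
whence 16. -/
lemma integral_normSq_wickSum_le (hB : ∀ n ∈ B, -n ∈ B) (k l : Fin 2) (κ : Freq → Freq → ℂ) :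
    ∫ ω, ‖wickSum B k l κ ω‖ ^ 2 ∂sampleMeasure ≤
      16 * quadFormConst * ∑ n ∈ B, ∑ m ∈ B, ‖κ n m‖ ^ 2 := by
  simp only [wickSum_eq hB]
  refine (integral_normSq_centredForm_le _ _).trans ?_
  have hq := quadFormConst_pos
  have h1 : ∀ j, ∑ i ∈ sampleIndex B,
      ‖∑ n ∈ B, gaussMatrix k n i * ∑ m ∈ B, gaussMatrix l m j * κ n m‖ ^ 2 ≤
      2 * 2 * ∑ n ∈ B, ‖∑ m ∈ B, gaussMatrix l m j * κ n m‖ ^ 2 := fun j =>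
    sum_normSq_sum_mul_le (sampleIndex B) B (gaussMatrix k) _ (by norm_num)
      (fun i _ => sum_norm_gaussMatrix_freq_le k i)
      (fun n hn => sum_norm_gaussMatrix_index_le hB hn k)
  have h2 : ∀ n, ∑ j ∈ sampleIndex B, ‖∑ m ∈ B, gaussMatrix l m j * κ n m‖ ^ 2 ≤
      2 * 2 * ∑ m ∈ B, ‖κ n m‖ ^ 2 := fun n =>
    sum_normSq_sum_mul_le (sampleIndex B) B (gaussMatrix l) (κ n) (by norm_num)
      (fun i _ => sum_norm_gaussMatrix_freq_le l i)
      (fun n hn => sum_norm_gaussMatrix_index_le hB hn l)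
  calc _ ≤ quadFormConst * ∑ j ∈ sampleIndex B,
        (2 * 2 * ∑ n ∈ B, ‖∑ m ∈ B, gaussMatrix l m j * κ n m‖ ^ 2) := by
        rw [Finset.sum_comm]
        gcongr with j _
        exact h1 j
    _ = quadFormConst * (4 * ∑ n ∈ B, ∑ j ∈ sampleIndex B,
        ‖∑ m ∈ B, gaussMatrix l m j * κ n m‖ ^ 2) := by
        rw [← Finset.mul_sum, Finset.sum_comm]
        norm_num
    _ ≤ quadFormConst * (4 * ∑ n ∈ B, (2 * 2 * ∑ m ∈ B, ‖κ n m‖ ^ 2)) := by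
        gcongr with n _
        exact h2 n
    _ = _ := by rw [← Finset.mul_sum]; ring

end

/-! ### Typical samples -/

instance : IsProbabilityMeasure sampleMeasure := by unfold sampleMeasure; infer_instance

/-- The Fourier coefficients of `π_B u`, under the Gaussian measure. -/
def sampleU (s : ℕ) (B : Finset Freq) (ω : Sample) (n : Freq) : ℂ :=
  if n ∈ B then gauss 0 n ω / (bracket n : ℂ) ^ (s + 1) else 0

/-- The Fourier coefficients of `π_B v`, under the Gaussian measure. -/
def sampleV (s : ℕ) (B : Finset Freq) (ω : Sample) (n : Freq) : ℂ :=
  if n ∈ B then gauss 1 n ω / (bracket n : ℂ) ^ s else 0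

/-- `∑_{n ∈ B} ⟨n⟩^{-2}`. -/
def wickMass (B : Finset Freq) : ℝ := ∑ n ∈ B, (bracket n ^ 2)⁻¹

lemma bracket_ne_zero (n : Freq) : (bracket n : ℂ) ≠ 0 := by
  exact_mod_cast (bracket_pos n).ne'

/-- After multiplication by `⟨a⟩^s`, the coefficients at `a` and `-a` have covariance `⟨a⟩^{-2}`.
The sum of these is `wickMass B`, so the counterterm performs exactly the Wick ordering. -/
lemma wickTensor_sampleU {B : Finset Freq} (hB : ∀ n ∈ B, -n ∈ B) (s : ℕ) (ω : Sample)
    (m l : Freq) :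
    wickTensor s (wickMass B) B (sampleU s B ω) m l = wickSum B 0 0 (fun a b =>
      if a + b + m + l = 0 then (((bracket a)⁻¹ * (bracket b)⁻¹ : ℝ) : ℂ) else 0) ω := by
  have h2 : (if m + l = 0 then (wickMass B : ℂ) else 0) = ∑ a ∈ B, ∑ b ∈ B,
      (if a + b + m + l = 0 then (((bracket a)⁻¹ * (bracket b)⁻¹ : ℝ) : ℂ) else 0) *
        (if (0 : Fin 2) = 0 ∧ a + b = 0 then 1 else 0) := by
    have : ∀ a ∈ B, ∑ b ∈ B,
      (if a + b + m + l = 0 then (((bracket a)⁻¹ * (bracket b)⁻¹ : ℝ) : ℂ) else 0) *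
        (if (0 : Fin 2) = 0 ∧ a + b = 0 then 1 else 0) =
        if m + l = 0 then (((bracket a ^ 2)⁻¹ : ℝ) : ℂ) else 0 := by
      intro a ha
      rw [Finset.sum_eq_single_of_mem (-a) (hB a ha)]
      · simp only [add_neg_cancel, zero_add, and_self, if_true, mul_one, bracket_neg]
        rw [← mul_inv, ← sq]
      · intro b _ hb
        have : a + b ≠ 0 := fun h => hb (eq_neg_of_add_eq_zero_right h)
        simp [this]
    rw [Finset.sum_congr rfl this]
    split_ifs
    · simp [wickMass]
    · simp
  unfold wickTensor wickSum
  rw [h2, ← Finset.sum_sub_distrib]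
  refine Finset.sum_congr rfl fun a ha => ?_
  rw [← Finset.sum_sub_distrib]
  refine Finset.sum_congr rfl fun b hb => ?_
  rw [mul_sub]
  congr 1
  have h0 := bracket_ne_zero a
  have h1 := bracket_ne_zero b
  simp only [sampleU, ha, hb, if_true]
  split_ifs
  · push_cast
    field_simp
    ring
  · simp

/-- The families `g` and `h` are independent, so this product needs no counterterm. -/
lemma commTensor_sample {B : Finset Freq} (s : ℕ) (ω : Sample) (m l : Freq) :
    commTensor s B (sampleU s B ω) (sampleV s B ω) m l = wickSum B 0 1 (fun a d =>
      if a + m + l + d = 0 then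
        ((commSymbol s a m l d / (bracket a ^ (s + 1) * bracket d ^ s) : ℝ) : ℂ) else 0) ω := by
  unfold commTensor wickSum
  refine Finset.sum_congr rfl fun a ha => Finset.sum_congr rfl fun d hd => ?_
  have h0 := bracket_ne_zero a
  have h1 := bracket_ne_zero d
  simp only [sampleU, sampleV, ha, hd, if_true, zero_ne_one, false_and, if_false, sub_zero]
  split_ifs
  · push_cast
    field_simp
  · simp

/-- The sum of the squares of the norms in `IsTypical`. -/
def typicalSq (s : ℕ) (B : Finset Freq) (ω : Sample) : ℝ :=
  ∑ n ∈ B, (lam n ^ (8 * s - 1) * ‖sampleU s B ω n‖) ^ 2 +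
  ∑ n ∈ B, (lam n ^ (8 * s - 9) * ‖sampleV s B ω n‖) ^ 2 +
  ∑ m ∈ B, ∑ l ∈ B, (‖wickTensor s (wickMass B) B (sampleU s B ω) m l‖ *
    ((lam m ^ 15)⁻¹ * (lam l ^ 7)⁻¹)) ^ 2 +
  ∑ m ∈ B, ∑ l ∈ B, (‖commTensor s B (sampleU s B ω) (sampleV s B ω) m l‖ *
    ((lam m ^ 15)⁻¹ * (lam l ^ 15)⁻¹)) ^ 2

lemma isTypical_of_typicalSq_le {s : ℕ} {B : Finset Freq} {ω : Sample} {M : ℝ} (hM : 0 ≤ M)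
    (h : typicalSq s B ω ≤ M ^ 2) :
    IsTypical s (wickMass B) B M (sampleU s B ω) (sampleV s B ω) := by
  unfold typicalSq at h
  have h1 : 0 ≤ ∑ n ∈ B, (lam n ^ (8 * s - 1) * ‖sampleU s B ω n‖) ^ 2 := by positivity
  have h2 : 0 ≤ ∑ n ∈ B, (lam n ^ (8 * s - 9) * ‖sampleV s B ω n‖) ^ 2 := by positivity
  have h3 : 0 ≤ ∑ m ∈ B, ∑ l ∈ B, (‖wickTensor s (wickMass B) B (sampleU s B ω) m l‖ *
    ((lam m ^ 15)⁻¹ * (lam l ^ 7)⁻¹)) ^ 2 := by positivity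
  have h4 : 0 ≤ ∑ m ∈ B, ∑ l ∈ B, (‖commTensor s B (sampleU s B ω) (sampleV s B ω) m l‖ *
    ((lam m ^ 15)⁻¹ * (lam l ^ 15)⁻¹)) ^ 2 := by positivity
  refine ⟨?_, ?_, by linarith, by linarith⟩
  · exact (Real.sqrt_le_iff).2 ⟨hM, by linarith⟩
  · exact (Real.sqrt_le_iff).2 ⟨hM, by linarith⟩

/-- A bound for the mean of `typicalSq`. -/
def typicalConst (s : ℕ) : ℝ :=
  2 * latticeSum + 16 * quadFormConst * (2 * latticeSum ^ 3) +
    16 * quadFormConst * (4 * commConst s ^ 2 * latticeSum ^ 3)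

lemma typicalConst_nonneg (s : ℕ) : 0 ≤ typicalConst s := by
  have := latticeSum_nonneg
  have := quadFormConst_pos
  unfold typicalConst
  positivity

lemma l2n_inv_lam_le (B : Finset Freq) {e : ℕ} (he : 9 ≤ e) :
    l2n B (fun n => (lam n)⁻¹ ^ e) ≤ √latticeSum := by
  refine Real.sqrt_le_sqrt (le_trans (le_of_eq ?_) (sum_lam_le B (e := e * 2) (by omega)))
  simp only [pow_mul]

/-- Exponent 16 just misses summability. The inequality `z¹⁶w¹⁶ ≤ z¹⁷w¹⁵ + w¹⁷z¹⁵` shifts one power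
between the two internal frequencies. Then the exponents 30 and 17 are summed in ℓ¹, while 14 and 15
are handled in ℓ² by convolution. -/
lemma quad_inv_lam_le (B : Finset Freq) :
    quad B (fun m l a b => (lam m)⁻¹ ^ 30 * (lam l)⁻¹ ^ 14 * ((lam a)⁻¹ ^ 16 * (lam b)⁻¹ ^ 16)) ≤
      2 * latticeSum ^ 3 := by
  have hl : ∀ n, 0 < (lam n)⁻¹ := fun n => inv_pos.2 (lam_pos n)
  have hL := latticeSum_nonneg
  have key : quad B (fun m l a b => (lam m)⁻¹ ^ 30 * (lam l)⁻¹ ^ 14 * (lam a)⁻¹ ^ 17 *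
      (lam b)⁻¹ ^ 15) ≤ latticeSum ^ 3 := by
    refine (quad_mul_le' B (f₁ := fun m => (lam m)⁻¹ ^ 30) (fun l => (lam l)⁻¹ ^ 14)
      (f₃ := fun a => (lam a)⁻¹ ^ 17) (fun b => (lam b)⁻¹ ^ 15)
      (fun n => by have := hl n; positivity) (fun n => by have := hl n; positivity)).trans ?_
    calc _ ≤ latticeSum * latticeSum * (√latticeSum * √latticeSum) := by
          have h0 : 0 ≤ ∑ n ∈ B, (lam n)⁻¹ ^ 17 :=
            Finset.sum_nonneg fun n _ => by have := hl n; positivity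
          exact mul_le_mul (mul_le_mul (sum_lam_le B (by norm_num)) (sum_lam_le B (by norm_num))
            h0 hL) (mul_le_mul (l2n_inv_lam_le B (by norm_num)) (l2n_inv_lam_le B (by norm_num))
            (l2n_nonneg _ _) (Real.sqrt_nonneg _)) (mul_nonneg (l2n_nonneg _ _) (l2n_nonneg _ _))
            (by positivity)
      _ = _ := by rw [Real.mul_self_sqrt hL]; ring
  have key2 := quad_swap34 (B := B) (fun m l a b => (lam m)⁻¹ ^ 30 * (lam l)⁻¹ ^ 14 *
      (lam a)⁻¹ ^ 17 * (lam b)⁻¹ ^ 15)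
  calc _ ≤ quad B (fun m l a b => (lam m)⁻¹ ^ 30 * (lam l)⁻¹ ^ 14 * (lam a)⁻¹ ^ 17 *
        (lam b)⁻¹ ^ 15 + (lam m)⁻¹ ^ 30 * (lam l)⁻¹ ^ 14 * (lam b)⁻¹ ^ 17 *
        (lam a)⁻¹ ^ 15) := by
        refine quad_le fun m _ l _ a _ b _ _ => ?_
        have hm := hl m; have hl' := hl l; have ha := hl a; have hb := hl b
        generalize (lam m)⁻¹ = x at *
        generalize (lam l)⁻¹ = y at *
        generalize (lam a)⁻¹ = z at *
        generalize (lam b)⁻¹ = w at *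
        have : z ^ 16 * w ^ 16 ≤ z ^ 17 * w ^ 15 + w ^ 17 * z ^ 15 := by
          have : 0 ≤ z ^ 15 * w ^ 15 * (z ^ 2 + w ^ 2 - z * w) := by
            have : 0 ≤ z ^ 2 + w ^ 2 - z * w := by nlinarith [sq_nonneg (z - w)]
            positivity
          nlinarith
        calc _ ≤ x ^ 30 * y ^ 14 * (z ^ 17 * w ^ 15 + w ^ 17 * z ^ 15) := by gcongr
          _ = _ := by ring
    _ ≤ _ := by
        rw [quad_add, key2]
        linarith

/-- After division by the standard deviations the commutator bound leaves `(lam m ^ 8 + lam l ^ 8) /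
lam a ^ 16`. As `a` dominates, this is at most `2 lam m lam l / lam a ^ 9`. With the weights 15 and
upon squaring, the exponents 28, 28, 18 are summable in three free frequencies. -/
lemma quad_commSymbol_sq_le {s : ℕ} (hs : 1 ≤ s) (B : Finset Freq) :
    quad B (fun m l a d => ((lam m)⁻¹ ^ 15 * (lam l)⁻¹ ^ 15 *
      (commSymbol s a m l d / (bracket a ^ (s + 1) * bracket d ^ s))) ^ 2) ≤
      4 * commConst s ^ 2 * latticeSum ^ 3 := by
  have hl : ∀ n, 0 < (lam n)⁻¹ := fun n => inv_pos.2 (lam_pos n)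
  have hL := latticeSum_nonneg
  have hC := commConst_pos s
  calc _ ≤ quad B (fun m l a d => (4 * commConst s ^ 2) *
        ((lam m)⁻¹ ^ 28 * (lam l)⁻¹ ^ 28 * (lam a)⁻¹ ^ 18)) := by
        refine quad_le fun m _ l _ a _ d _ h0 => ?_
        have h0' : a + m + l + d = 0 := by rw [← h0]; abel
        have hm := hl m; have hl' := hl l; have ha := hl a
        by_cases hh : lam m ≤ lam a ∧ lam l ≤ lam a
        swap
        · rw [commSymbol_eq_zero hh]
          simp only [zero_div, mul_zero]
          rw [zero_pow two_ne_zero]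
          positivity
        have hc := abs_commSymbol_le hs h0'
        have e : (4 * commConst s ^ 2) *
          ((lam m)⁻¹ ^ 28 * (lam l)⁻¹ ^ 28 * (lam a)⁻¹ ^ 18) =
          (2 * commConst s * ((lam m)⁻¹ ^ 14 * (lam l)⁻¹ ^ 14 * (lam a)⁻¹ ^ 9)) ^ 2 := by ring
        rw [e]
        refine sq_le_sq.2 ?_
        rw [abs_of_nonneg (a := 2 * commConst s * _) (by positivity), abs_mul, abs_div,
          abs_of_nonneg (a := (lam m)⁻¹ ^ 15 * (lam l)⁻¹ ^ 15) (by positivity)]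
        obtain ⟨k, rfl⟩ : ∃ k, s = k + 1 := ⟨s - 1, by omega⟩
        rw [show 8 * (k + 1) - 8 = 8 * k by omega] at hc
        rw [← lam_pow_eight a, ← lam_pow_eight d, ← pow_mul, ← pow_mul]
        have pa := lam_pos a; have pm := lam_pos m; have pl := lam_pos l; have pd := lam_pos d
        have om := one_le_lam m; have ol := one_le_lam l
        rw [abs_of_pos (a := lam a ^ _ * lam d ^ _) (by positivity)]
        have hsum : lam m ^ 8 + lam l ^ 8 ≤ 2 * (lam a ^ 7 * (lam m * lam l)) := by
          have h1 : lam m ^ 8 ≤ lam a ^ 7 * (lam m * lam l) := by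
            calc lam m ^ 8 = lam m ^ 7 * (lam m * 1) := by ring
              _ ≤ _ := by gcongr; exact hh.1
          have h2 : lam l ^ 8 ≤ lam a ^ 7 * (lam m * lam l) := by
            calc lam l ^ 8 = lam l ^ 7 * (1 * lam l) := by ring
              _ ≤ _ := by gcongr; exact hh.2
          linarith
        have hc' : |commSymbol (k + 1) a m l d| ≤ commConst (k + 1) * (lam d ^ (8 * (k + 1)) *
            lam a ^ (8 * k) * (2 * (lam a ^ 7 * (lam m * lam l)))) :=
          hc.trans (by unfold commConst; gcongr)
        calc _ ≤ (lam m)⁻¹ ^ 15 * (lam l)⁻¹ ^ 15 * (commConst (k + 1) * (lam d ^ (8 * (k + 1)) *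
            lam a ^ (8 * k) * (2 * (lam a ^ 7 * (lam m * lam l)))) /
            (lam a ^ (8 * (k + 1 + 1)) * lam d ^ (8 * (k + 1)))) := by gcongr
          _ = _ := by
            rw [show 8 * (k + 1 + 1) = 8 * k + 16 by ring, pow_add (lam a)]
            field_simp
    _ ≤ 4 * commConst s ^ 2 * (latticeSum * latticeSum * latticeSum) := by
        rw [quad_const_mul]
        gcongr
        refine (quad_mul_le_l1 B (f₁ := fun m => (lam m)⁻¹ ^ 28) (f₂ := fun m => (lam m)⁻¹ ^ 28)
          (f₃ := fun m => (lam m)⁻¹ ^ 18) (fun n => by have := hl n; positivity)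
          (fun n => by have := hl n; positivity) (fun n => by have := hl n; positivity)).trans ?_
        have hp : ∀ e : ℕ, 0 ≤ ∑ n ∈ B, (lam n)⁻¹ ^ e := fun e =>
          Finset.sum_nonneg fun n _ => by have := hl n; positivity
        exact mul_le_mul (mul_le_mul (sum_lam_le B (by norm_num)) (sum_lam_le B (by norm_num))
          (hp _) hL) (sum_lam_le B (by norm_num)) (hp _) (by positivity)
    _ = _ := by ring

lemma normSq_sampleU {s : ℕ} (hs : 1 ≤ s) {B : Finset Freq} (ω : Sample) {n : Freq} (hn : n ∈ B) :
    (lam n ^ (8 * s - 1) * ‖sampleU s B ω n‖) ^ 2 = (lam n)⁻¹ ^ 18 * ‖gauss 0 n ω‖ ^ 2 := by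
  have h := lam_pos n
  obtain ⟨k, rfl⟩ : ∃ k, s = k + 1 := ⟨s - 1, by omega⟩
  simp only [sampleU, hn, if_true]
  rw [norm_div, norm_pow, Complex.norm_real, Real.norm_eq_abs, abs_of_pos (bracket_pos n),
    ← lam_pow_eight, ← pow_mul, show 8 * (k + 1) - 1 = 8 * k + 7 by omega,
    show 8 * (k + 1 + 1) = 8 * k + 7 + 9 by ring, pow_add _ (8 * k + 7) 9]
  field_simp

lemma normSq_sampleV {s : ℕ} (hs : 2 ≤ s) {B : Finset Freq} (ω : Sample) {n : Freq} (hn : n ∈ B) :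
    (lam n ^ (8 * s - 9) * ‖sampleV s B ω n‖) ^ 2 = (lam n)⁻¹ ^ 18 * ‖gauss 1 n ω‖ ^ 2 := by
  have h := lam_pos n
  obtain ⟨k, rfl⟩ : ∃ k, s = k + 2 := ⟨s - 2, by omega⟩
  simp only [sampleV, hn, if_true]
  rw [norm_div, norm_pow, Complex.norm_real, Real.norm_eq_abs, abs_of_pos (bracket_pos n),
    ← lam_pow_eight, ← pow_mul, show 8 * (k + 2) - 9 = 8 * k + 7 by omega,
    show 8 * (k + 2) = 8 * k + 7 + 9 by ring, pow_add _ (8 * k + 7) 9]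
  field_simp

lemma sum_sum_quad (B : Finset Freq) (f : Freq → Freq → Freq → Freq → ℝ) :
    ∑ m ∈ B, ∑ l ∈ B, ∑ a ∈ B, ∑ d ∈ B, (if a + m + l + d = 0 then f m l a d else 0) =
      quad B f := by
  unfold quad
  refine Finset.sum_congr rfl fun m _ => Finset.sum_congr rfl fun l _ =>
    Finset.sum_congr rfl fun a _ => Finset.sum_congr rfl fun d _ => ?_
  rw [show m + l + a + d = a + m + l + d by abel]

lemma integrable_integral_wick {B : Finset Freq} (hB : ∀ n ∈ B, -n ∈ B) (k l : Fin 2)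
    (κ : Freq → Freq → Freq → Freq → ℂ) (w : Freq → Freq → ℝ) :
    Integrable (fun ω => ∑ m ∈ B, ∑ l' ∈ B, (‖wickSum B k l (κ m l') ω‖ * w m l') ^ 2)
      sampleMeasure ∧
    ∫ ω, (∑ m ∈ B, ∑ l' ∈ B, (‖wickSum B k l (κ m l') ω‖ * w m l') ^ 2) ∂sampleMeasure ≤
      16 * quadFormConst * ∑ m ∈ B, ∑ l' ∈ B, ∑ a ∈ B, ∑ d ∈ B, (w m l' * ‖κ m l' a d‖) ^ 2 := by
  simp only [mul_pow]
  have hi : ∀ m l', Integrable (fun ω => ‖wickSum B k l (κ m l') ω‖ ^ 2 * w m l' ^ 2)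
      sampleMeasure := fun m l' => (integrable_normSq_wickSum hB k l _).mul_const _
  refine ⟨integrable_finsetSum _ fun m _ => integrable_finsetSum _ fun l' _ => hi m l', ?_⟩
  rw [integral_finsetSum _ fun m _ => integrable_finsetSum _ fun l' _ => hi m l', Finset.mul_sum]
  refine Finset.sum_le_sum fun m _ => ?_
  rw [integral_finsetSum _ fun l' _ => hi m l', Finset.mul_sum]
  refine Finset.sum_le_sum fun l' _ => ?_
  rw [integral_mul_const]
  have := integral_normSq_wickSum_le hB k l (κ m l')
  calc _ ≤ 16 * quadFormConst * (∑ n ∈ B, ∑ m_1 ∈ B, ‖κ m l' n m_1‖ ^ 2) * w m l' ^ 2 := by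
        gcongr
    _ = _ := by
        simp only [← Finset.mul_sum]
        ring

lemma integrable_integral_typicalSq {s : ℕ} (hs : 2 ≤ s) {B : Finset Freq}
    (hB : ∀ n ∈ B, -n ∈ B) :
    Integrable (typicalSq s B) sampleMeasure ∧
      ∫ ω, typicalSq s B ω ∂sampleMeasure ≤ typicalConst s := by
  have hq := quadFormConst_pos
  have hlin : ∀ k : Fin 2, Integrable (fun ω => ∑ n ∈ B, (lam n)⁻¹ ^ 18 * ‖gauss k n ω‖ ^ 2)
      sampleMeasure ∧ ∫ ω, (∑ n ∈ B, (lam n)⁻¹ ^ 18 * ‖gauss k n ω‖ ^ 2) ∂sampleMeasure ≤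
        latticeSum := by
    intro k
    have hi : ∀ n ∈ B, Integrable (fun ω => (lam n)⁻¹ ^ 18 * ‖gauss k n ω‖ ^ 2) sampleMeasure :=
      fun n _ => (integrable_normSq_gauss k n).const_mul _
    refine ⟨integrable_finsetSum _ hi, ?_⟩
    rw [integral_finsetSum _ hi]
    simp only [integral_const_mul, integral_normSq_gauss, mul_one]
    exact sum_lam_le B (by norm_num)
  have e1 : ∀ ω, ∑ n ∈ B, (lam n ^ (8 * s - 1) * ‖sampleU s B ω n‖) ^ 2 =
      ∑ n ∈ B, (lam n)⁻¹ ^ 18 * ‖gauss 0 n ω‖ ^ 2 := fun ω =>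
    Finset.sum_congr rfl fun n hn => normSq_sampleU (by omega) ω hn
  have e2 : ∀ ω, ∑ n ∈ B, (lam n ^ (8 * s - 9) * ‖sampleV s B ω n‖) ^ 2 =
      ∑ n ∈ B, (lam n)⁻¹ ^ 18 * ‖gauss 1 n ω‖ ^ 2 := fun ω =>
    Finset.sum_congr rfl fun n hn => normSq_sampleV hs ω hn
  have hw := integrable_integral_wick hB 0 0 (fun m l a b =>
      if a + b + m + l = 0 then (((bracket a)⁻¹ * (bracket b)⁻¹ : ℝ) : ℂ) else 0)
      (fun m l => (lam m ^ 15)⁻¹ * (lam l ^ 7)⁻¹)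
  have hc := integrable_integral_wick hB 0 1 (fun m l a d => if a + m + l + d = 0 then
        ((commSymbol s a m l d / (bracket a ^ (s + 1) * bracket d ^ s) : ℝ) : ℂ) else 0)
      (fun m l => (lam m ^ 15)⁻¹ * (lam l ^ 15)⁻¹)
  have bw : ∑ m ∈ B, ∑ l ∈ B, ∑ a ∈ B, ∑ b ∈ B, (((lam m ^ 15)⁻¹ * (lam l ^ 7)⁻¹) *
      ‖if a + b + m + l = 0 then (((bracket a)⁻¹ * (bracket b)⁻¹ : ℝ) : ℂ) else 0‖) ^ 2 ≤
      2 * latticeSum ^ 3 := by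
    refine (le_of_eq ?_).trans (quad_inv_lam_le B)
    rw [← sum_sum_quad]
    refine Finset.sum_congr rfl fun m _ => Finset.sum_congr rfl fun l _ =>
      Finset.sum_congr rfl fun a _ => Finset.sum_congr rfl fun b _ => ?_
    rw [show a + b + m + l = a + m + l + b by abel]
    have pa := lam_pos a; have pb := lam_pos b
    split_ifs
    · rw [Complex.norm_real, Real.norm_eq_abs, ← lam_pow_eight, ← lam_pow_eight,
        abs_of_pos (by positivity)]
      simp only [← inv_pow]
      ring
    · simp
  have bc : ∑ m ∈ B, ∑ l ∈ B, ∑ a ∈ B, ∑ d ∈ B, (((lam m ^ 15)⁻¹ * (lam l ^ 15)⁻¹) *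
      ‖if a + m + l + d = 0 then
        ((commSymbol s a m l d / (bracket a ^ (s + 1) * bracket d ^ s) : ℝ) : ℂ) else 0‖) ^ 2 ≤
      4 * commConst s ^ 2 * latticeSum ^ 3 := by
    refine (le_of_eq ?_).trans (quad_commSymbol_sq_le (s := s) (by omega) B)
    rw [← sum_sum_quad]
    refine Finset.sum_congr rfl fun m _ => Finset.sum_congr rfl fun l _ =>
      Finset.sum_congr rfl fun a _ => Finset.sum_congr rfl fun d _ => ?_
    split_ifs
    · rw [Complex.norm_real, Real.norm_eq_abs, mul_pow, sq_abs, ← mul_pow]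
      simp only [inv_pow]
    · simp
  change Integrable (fun ω => typicalSq s B ω) sampleMeasure ∧ _
  simp only [typicalSq, e1, e2, wickTensor_sampleU hB, commTensor_sample]
  have i12 := (hlin 0).1.add (hlin 1).1
  have i3 := i12.add hw.1
  refine ⟨i3.add hc.1, ?_⟩
  have hsum := integral_add' i3 hc.1
  rw [integral_add' i12 hw.1, integral_add' (hlin 0).1 (hlin 1).1] at hsum
  refine (le_of_eq hsum).trans ?_
  have hw' := hw.2.trans (mul_le_mul_of_nonneg_left bw (by positivity))
  have hc' := hc.2.trans (mul_le_mul_of_nonneg_left bc (by positivity))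
  unfold typicalConst
  linarith [(hlin 0).2, (hlin 1).2]

/-! ### The moments of the rate of change of the renormalized energy -/

/-! ### Measurability and dependence on finitely many coordinates. -/

lemma measurable_sampleU (s : ℕ) (B : Finset Freq) (n : Freq) :
    Measurable fun ω => sampleU s B ω n := by
  unfold sampleU
  split_ifs
  · exact (measurable_gauss 0 n).div_const _
  · exact measurable_const

lemma measurable_sampleV (s : ℕ) (B : Finset Freq) (n : Freq) :
    Measurable fun ω => sampleV s B ω n := by
  unfold sampleV
  split_ifs
  · exact (measurable_gauss 1 n).div_const _
  · exact measurable_const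

lemma measurable_ite_const {α β : Type*} [MeasurableSpace α] [MeasurableSpace β] (P : Prop)
    [Decidable P] {f : α → β} (hf : Measurable f) (c : β) :
    Measurable fun x => if P then f x else c := by
  split_ifs
  · exact hf
  · exact measurable_const

lemma measurable_quad (B : Finset Freq) {α : Type*} [MeasurableSpace α]
    {f : α → Freq → Freq → Freq → Freq → ℂ} (hf : ∀ a b c d, Measurable fun x => f x a b c d) :
    Measurable fun x => quad B (f x) := by
  unfold quad
  exact Finset.measurable_sum _ fun a _ => Finset.measurable_sum _ fun b _ =>
    Finset.measurable_sum _ fun c _ => Finset.measurable_sum _ fun d _ =>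
      measurable_ite_const _ (hf a b c d) _

lemma measurable_energyRate (s : ℕ) (σ : ℝ) (B : Finset Freq) {α : Type*} [MeasurableSpace α]
    {a b : α → Freq → ℂ} (ha : ∀ n, Measurable fun x => a x n) (hb : ∀ n, Measurable fun x => b x n) :
    Measurable fun x => energyRate s σ B (a x) (b x) := by
  unfold energyRate
  refine Measurable.sub (Measurable.const_mul (Measurable.sub (measurable_quad B fun i j k l => ?_)
    (Measurable.const_mul ?_ _)) _) (measurable_quad B fun i j k l => ?_)
  · exact Measurable.const_mul ((((ha _).mul (ha _)).mul (ha _)).mul (hb _)) _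
  · exact Finset.measurable_sum _ fun a _ => Finset.measurable_sum _ fun b _ =>
      measurable_ite_const _ ((ha _).mul (hb _)) _
  · exact Measurable.const_mul ((((ha _).mul (ha _)).mul (ha _)).mul (hb _)) _

lemma measurable_typicalSq (s : ℕ) (B : Finset Freq) : Measurable (typicalSq s B) := by
  have hU := measurable_sampleU s B
  have hV := measurable_sampleV s B
  unfold typicalSq wickTensor commTensor
  refine Measurable.add (Measurable.add (Measurable.add ?_ ?_) ?_) ?_
  · exact Finset.measurable_sum _ fun n _ => ((hU n).norm.const_mul _).pow_const 2
  · exact Finset.measurable_sum _ fun n _ => ((hV n).norm.const_mul _).pow_const 2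
  · refine Finset.measurable_sum _ fun m _ => Finset.measurable_sum _ fun l _ =>
      (Measurable.mul_const (Measurable.norm ((Finset.measurable_sum _ fun a _ =>
        Finset.measurable_sum _ fun b _ => measurable_ite_const _ ?_ _).sub_const _)) _).pow_const 2
    exact Measurable.const_mul ((hU _).mul (hU _)) _
  · refine Finset.measurable_sum _ fun m _ => Finset.measurable_sum _ fun l _ =>
      (Measurable.mul_const (Measurable.norm (Finset.measurable_sum _ fun a _ =>
        Finset.measurable_sum _ fun b _ => measurable_ite_const _ ?_ _)) _).pow_const 2
    exact Measurable.const_mul ((hU _).mul (hV _)) _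

lemma gauss_eq_of_eqOn {B : Finset Freq} (hB : ∀ n ∈ B, -n ∈ B) {x y : Sample}
    (h : ∀ i ∈ sampleIndex B, x i = y i) (k : Fin 2) {n : Freq} (hn : n ∈ B) :
    gauss k n x = gauss k n y := by
  rw [gauss_eq_sum hB hn, gauss_eq_sum hB hn]
  exact Finset.sum_congr rfl fun i hi => by rw [h i hi]

lemma dependsOn_sampleU (s : ℕ) {B : Finset Freq} (hB : ∀ n ∈ B, -n ∈ B) :
    DependsOn (sampleU s B) (sampleIndex B : Set (Fin 2 × Freq × Fin 2)) := by
  intro x y h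
  funext n
  unfold sampleU
  split_ifs with hn
  · rw [gauss_eq_of_eqOn hB (fun i hi => h i hi) 0 hn]
  · rfl

lemma dependsOn_sampleV (s : ℕ) {B : Finset Freq} (hB : ∀ n ∈ B, -n ∈ B) :
    DependsOn (sampleV s B) (sampleIndex B : Set (Fin 2 × Freq × Fin 2)) := by
  intro x y h
  funext n
  unfold sampleV
  split_ifs with hn
  · rw [gauss_eq_of_eqOn hB (fun i hi => h i hi) 1 hn]
  · rfl

/-- The weight `⟨n⟩^{s+1}` cancels the standard deviation exactly, so this is a Lipschitz bound in
the Cameron–Martin norm. The 1 under the root provides the `τ ≥ 1` required by `norm_energyRate_le`.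
-/
lemma l2n_sampleU_sub_le (s : ℕ) {B : Finset Freq} (hB : ∀ n ∈ B, -n ∈ B) (x y : Sample) :
    l2n B (fun n => lam n ^ (8 * s + 8) * ‖sampleU s B x n - sampleU s B y n‖) ≤
      √(1 + 4 * ∑ i ∈ sampleIndex B, (x i - y i) ^ 2) := by
  refine Real.sqrt_le_sqrt ?_
  refine le_trans (le_of_eq ?_) ((sum_normSq_gauss_sub_le hB 0 x y).trans (by linarith))
  refine Finset.sum_congr rfl fun n hn => ?_
  have h := lam_pos n
  simp only [sampleU, hn, if_true]
  rw [← sub_div, norm_div, norm_pow, Complex.norm_real, Real.norm_eq_abs,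
    abs_of_pos (bracket_pos n), ← lam_pow_eight, ← pow_mul, show 8 * (s + 1) = 8 * s + 8 by ring]
  field_simp

lemma l2n_sampleV_sub_le (s : ℕ) {B : Finset Freq} (hB : ∀ n ∈ B, -n ∈ B) (x y : Sample) :
    l2n B (fun n => lam n ^ (8 * s) * ‖sampleV s B x n - sampleV s B y n‖) ≤
      √(1 + 4 * ∑ i ∈ sampleIndex B, (x i - y i) ^ 2) := by
  refine Real.sqrt_le_sqrt ?_
  refine le_trans (le_of_eq ?_) ((sum_normSq_gauss_sub_le hB 1 x y).trans (by linarith))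
  refine Finset.sum_congr rfl fun n hn => ?_
  have h := lam_pos n
  simp only [sampleV, hn, if_true]
  rw [← sub_div, norm_div, norm_pow, Complex.norm_real, Real.norm_eq_abs,
    abs_of_pos (bracket_pos n), ← lam_pow_eight, ← pow_mul]
  field_simp

/-! ### Exponential integrability and moments. -/

/-- The energy of the Fourier coefficients in `B`. -/
def quadEnergy (B : Finset Freq) (a b : Freq → ℂ) : ℝ :=
  ∑ n ∈ B, (bracket n ^ 2 * ‖a n‖ ^ 2 + ‖b n‖ ^ 2)

lemma measurable_quadEnergy (B : Finset Freq) {α : Type*} [MeasurableSpace α]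
    {a b : α → Freq → ℂ} (ha : ∀ n, Measurable fun x => a x n) (hb : ∀ n, Measurable fun x => b x n) :
    Measurable fun x => quadEnergy B (a x) (b x) :=
  Finset.measurable_sum _ fun n _ => (((ha n).norm.pow_const 2).const_mul _).add
    ((hb n).norm.pow_const 2)

lemma l2n_le_of_quadEnergy_le {B : Finset Freq} {a b : Freq → ℂ} {M : ℝ} (hM : 0 ≤ M)
    (h : quadEnergy B a b ≤ M ^ 2) :
    l2n B (fun n => lam n ^ 8 * ‖a n‖) ≤ M ∧ l2n B (fun n => lam n ^ 0 * ‖b n‖) ≤ M := by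
  unfold quadEnergy at h
  rw [Finset.sum_add_distrib] at h
  have h1 : 0 ≤ ∑ n ∈ B, bracket n ^ 2 * ‖a n‖ ^ 2 := by positivity
  have h2 : 0 ≤ ∑ n ∈ B, ‖b n‖ ^ 2 := by positivity
  constructor
  · refine Real.sqrt_le_iff.2 ⟨hM, ?_⟩
    simp only [lam_pow_eight, mul_pow]
    linarith
  · refine Real.sqrt_le_iff.2 ⟨hM, ?_⟩
    simp only [pow_zero, one_mul]
    linarith

/-- The norm bound of typical samples. -/
def typicalBound (s : ℕ) (r : ℝ) : ℝ := √(1 + 2 * typicalConst s + |r|)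

/-- The exponential rate of `energyRate`. -/
def rateConst (s : ℕ) (r : ℝ) : ℝ :=
  10 ^ 9 * (typicalBound s r ^ 4 * (1 + commConst s) * (1 + latticeSum))

lemma one_le_typicalBound (s : ℕ) (r : ℝ) : 1 ≤ typicalBound s r := by
  have := typicalConst_nonneg s
  have := abs_nonneg r
  exact Real.one_le_sqrt.2 (by linarith)

lemma typicalBound_sq (s : ℕ) (r : ℝ) : typicalBound s r ^ 2 = 1 + 2 * typicalConst s + |r| := by
  have := typicalConst_nonneg s
  have := abs_nonneg r
  exact Real.sq_sqrt (by linarith)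

lemma rateConst_pos (s : ℕ) (r : ℝ) : 0 < rateConst s r := by
  have := one_le_typicalBound s r
  have := commConst_pos s
  have := latticeSum_nonneg
  unfold rateConst
  positivity

/-- Markov's inequality: the threshold exceeds twice the mean of `typicalSq`. Its summand `|r|` lets
the same constant bound the energy norms. -/
lemma half_le_measure_typical {s : ℕ} (hs : 2 ≤ s) (r : ℝ) {B : Finset Freq}
    (hB : ∀ n ∈ B, -n ∈ B) :
    1 / 2 ≤ sampleMeasure {ω | typicalSq s B ω ≤ typicalBound s r ^ 2} := by
  obtain ⟨hi, hle⟩ := integrable_integral_typicalSq hs hB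
  have hC := typicalConst_nonneg s
  have hr := abs_nonneg r
  have h0 : ∀ ω, 0 ≤ typicalSq s B ω := fun ω => by unfold typicalSq; positivity
  have hm : MeasurableSet {ω | typicalSq s B ω ≤ typicalBound s r ^ 2} :=
    measurableSet_le (measurable_typicalSq s B) measurable_const
  have h := mul_meas_ge_le_integral_of_nonneg (ae_of_all _ h0) hi (typicalBound s r ^ 2)
  have hc : sampleMeasure.real {ω | typicalSq s B ω ≤ typicalBound s r ^ 2}ᶜ ≤
      sampleMeasure.real {ω | typicalBound s r ^ 2 ≤ typicalSq s B ω} := by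
    refine measureReal_mono fun ω hω => ?_
    simp only [Set.mem_compl_iff, Set.mem_ofPred_eq, not_le] at hω ⊢
    exact hω.le
  rw [probReal_compl_eq_one_sub hm] at hc
  have key : (1 / 2 : ℝ) ≤ sampleMeasure.real {ω | typicalSq s B ω ≤ typicalBound s r ^ 2} := by
    rw [typicalBound_sq] at *
    by_contra hcon
    push Not at hcon
    nlinarith
  rw [← ofReal_measureReal]
  calc (1 / 2 : ℝ≥0∞) = ENNReal.ofReal (1 / 2) := by
        rw [ENNReal.ofReal_div_of_pos (by norm_num)]; simp
    _ ≤ _ := ENNReal.ofReal_le_ofReal key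

/-- The exponential integrability of the rate of change, on sets of bounded energy. -/
lemma lintegral_exp_energyRate_le {s : ℕ} (hs : 2 ≤ s) (r : ℝ) {B : Finset Freq}
    (hB : ∀ n ∈ B, -n ∈ B) :
    ∫⁻ ω in {ω | quadEnergy B (sampleU s B ω) (sampleV s B ω) ≤ r},
      ENNReal.ofReal (Real.exp (‖energyRate s (wickMass B) B (sampleU s B ω) (sampleV s B ω)‖ /
        (16 * rateConst s r) - 1 / 16)) ∂sampleMeasure ≤ 2 := by
  have hK := rateConst_pos s r
  have hM := one_le_typicalBound s r
  set E : Set Sample := {ω | quadEnergy B (sampleU s B ω) (sampleV s B ω) ≤ r} with hE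
  set A : Set Sample := {ω | typicalSq s B ω ≤ typicalBound s r ^ 2} with hA
  set f : Sample → ℝ≥0∞ := fun ω => ENNReal.ofReal (Real.exp
    (‖energyRate s (wickMass B) B (sampleU s B ω) (sampleV s B ω)‖ /
        (16 * rateConst s r) - 1 / 16)) with hf
  have hEm : MeasurableSet E := measurableSet_le
    (measurable_quadEnergy B (measurable_sampleU s B) (measurable_sampleV s B)) measurable_const
  have hAm : MeasurableSet A := measurableSet_le (measurable_typicalSq s B) measurable_const
  have hfm : Measurable f := (Real.measurable_exp.comp (((measurable_energyRate s _ B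
    (measurable_sampleU s B) (measurable_sampleV s B)).norm.div_const _).sub_const _)).ennreal_ofReal
  -- The exponential on the energy sublevel set is tested against the indicator of the typical
  -- samples, whose mass at least 1/2 produces the bound 2.
  have key := lintegral_mul_lintegral_infinitePi_le_one (sampleIndex B)
    (F := E.indicator f) (G := A.indicator 1) (hfm.indicator hEm)
    (measurable_one.indicator hAm) ?_ ?_ ?_
  · rw [lintegral_indicator hEm, lintegral_indicator_one hAm] at key
    have hhalf := half_le_measure_typical hs r hB
    calc _ = (∫⁻ ω in E, f ω ∂sampleMeasure) * (1 / 2) * 2 := by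
          rw [mul_assoc, one_div, ENNReal.inv_mul_cancel (by norm_num) (by norm_num), mul_one]
      _ ≤ 1 * 2 := by
          gcongr
          exact (mul_le_mul_right hhalf _).trans key
      _ = 2 := one_mul _
  · intro x y h
    have hU := dependsOn_sampleU s hB h
    have hV := dependsOn_sampleV s hB h
    simp only [Set.indicator, hE, hf, Set.mem_ofPred_eq, hU, hV]
  · intro x y h
    have hU := dependsOn_sampleU s hB h
    have hV := dependsOn_sampleV s hB h
    simp only [Set.indicator, hA, typicalSq, Set.mem_ofPred_eq, hU, hV, Pi.one_apply]
  · intro x y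
    by_cases hx : x ∈ E
    swap
    · simp [hx]
    by_cases hy : y ∈ A
    swap
    · simp [hy]
    rw [Set.indicator_of_mem hx, Set.indicator_of_mem hy, Pi.one_apply, mul_one]
    refine ENNReal.ofReal_le_ofReal (Real.exp_le_exp.2 ?_)
    set D := ∑ i ∈ sampleIndex B, (x i - y i) ^ 2 with hD
    have hD0 : 0 ≤ D := by positivity
    have hen := l2n_le_of_quadEnergy_le (M := typicalBound s r) (by linarith)
      (le_trans (show _ ≤ r from hx) (by
        rw [typicalBound_sq]
        linarith [typicalConst_nonneg s, le_abs_self r]))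
    have hr := norm_energyRate_le hs (wickMass B) B hM
      (Real.one_le_sqrt.2 (show 1 ≤ 1 + 4 * D by linarith))
      (isTypical_of_typicalSq_le (by linarith) hy) hen.1 hen.2
      (l2n_sampleU_sub_le s hB x y) (l2n_sampleV_sub_le s hB x y)
    rw [Real.sq_sqrt (by linarith)] at hr
    change _ ≤ rateConst s r * _ at hr
    -- The factor 16 is 4 · 4: dividing `K(1 + 4D)` by `16K` gives `D/4 + 1/16`, the transport cost
    -- plus the constant subtracted in `f`.
    have : ‖energyRate s (wickMass B) B (sampleU s B x) (sampleV s B x)‖ /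
        (16 * rateConst s r) ≤ (1 + 4 * D) / 16 := by
      rw [div_le_div_iff₀ (by positivity) (by norm_num)]
      linarith
    linarith

/-- The inequality `x ≤ exp x` at `x = y / p`, raised to the power `p`. The factor `p ^ p` accounts
for the linear growth of the moments. -/
lemma rpow_le_rpow_mul_exp {y p : ℝ} (hy : 0 ≤ y) (hp : 0 < p) : y ^ p ≤ p ^ p * Real.exp y := by
  have h1 : y ≤ p * Real.exp (y / p) := by
    have := Real.add_one_le_exp (y / p)
    have h2 : y / p ≤ Real.exp (y / p) := by linarith
    rwa [div_le_iff₀' hp] at h2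
  calc y ^ p ≤ (p * Real.exp (y / p)) ^ p := Real.rpow_le_rpow hy h1 hp.le
    _ = _ := by
      rw [Real.mul_rpow hp.le (Real.exp_pos _).le, ← Real.exp_mul, div_mul_cancel₀ _ hp.ne']

/-- The moments of the rate of change grow linearly. -/
lemma lintegral_rpow_energyRate_le {s : ℕ} (hs : 2 ≤ s) (r : ℝ) {B : Finset Freq}
    (hB : ∀ n ∈ B, -n ∈ B) {p : ℝ} (hp : 1 ≤ p) :
    ∫⁻ ω in {ω | quadEnergy B (sampleU s B ω) (sampleV s B ω) ≤ r},
      ENNReal.ofReal (‖energyRate s (wickMass B) B (sampleU s B ω) (sampleV s B ω)‖ ^ p)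
        ∂sampleMeasure ≤ ENNReal.ofReal ((64 * rateConst s r * p) ^ p) := by
  have hK := rateConst_pos s r
  have hp0 : 0 < p := by linarith
  set R : Sample → ℝ := fun ω =>
    ‖energyRate s (wickMass B) B (sampleU s B ω) (sampleV s B ω)‖ with hR
  have h1 : ∀ ω, ENNReal.ofReal (R ω ^ p) ≤
      ENNReal.ofReal ((16 * rateConst s r * p) ^ p * Real.exp (1 / 16)) *
        ENNReal.ofReal (Real.exp (R ω / (16 * rateConst s r) - 1 / 16)) := by
    intro ω
    rw [← ENNReal.ofReal_mul (by positivity)]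
    refine ENNReal.ofReal_le_ofReal ?_
    have h0 : 0 ≤ R ω := norm_nonneg _
    have := rpow_le_rpow_mul_exp (y := R ω / (16 * rateConst s r)) (by positivity) hp0
    rw [Real.div_rpow h0 (by positivity), div_le_iff₀ (by positivity)] at this
    refine this.trans (le_of_eq ?_)
    rw [Real.mul_rpow (by positivity) hp0.le, Real.exp_sub]
    field_simp
  calc _ ≤ ∫⁻ ω in {ω | quadEnergy B (sampleU s B ω) (sampleV s B ω) ≤ r},
        ENNReal.ofReal ((16 * rateConst s r * p) ^ p * Real.exp (1 / 16)) *
        ENNReal.ofReal (Real.exp (R ω / (16 * rateConst s r) - 1 / 16)) ∂sampleMeasure :=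
        lintegral_mono h1
    _ ≤ ENNReal.ofReal ((16 * rateConst s r * p) ^ p * Real.exp (1 / 16)) * 2 := by
        rw [lintegral_const_mul' _ _ ENNReal.ofReal_ne_top]
        gcongr
        exact lintegral_exp_energyRate_le hs r hB
    _ = ENNReal.ofReal ((16 * rateConst s r * p) ^ p * Real.exp (1 / 16) * 2) := by
        rw [ENNReal.ofReal_mul (q := 2) (by positivity)]
        simp
    _ ≤ _ := by
        refine ENNReal.ofReal_le_ofReal ?_
        -- The numerical factor is at most `4 ≤ 4 ^ p`, which turns 16 into 64 inside the power.
        have he : Real.exp (1 / 16) ≤ 2 := by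
          have := Real.exp_bound_div_one_sub_of_interval (x := 1 / 16) (by norm_num) (by norm_num)
          linarith [show (1 / (1 - 1 / 16) : ℝ) ≤ 2 by norm_num]
        have h4 : (4 : ℝ) ≤ 4 ^ p := by
          simpa using Real.rpow_le_rpow_of_exponent_le (x := 4) (by norm_num) hp
        calc _ ≤ (16 * rateConst s r * p) ^ p * 2 * 2 := by gcongr
          _ = 4 * (16 * rateConst s r * p) ^ p := by ring
          _ ≤ 4 ^ p * (16 * rateConst s r * p) ^ p := by gcongr
          _ = _ := by
            rw [← Real.mul_rpow (by norm_num) (by positivity)]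
            ring_nf

/-! ### Fourier series of real square integrable functions -/

/-- A real function as a complex one. -/
def toComplex : L2 →L[ℝ] Lp ℂ 2 haar := Complex.ofRealCLM.compLpL 2 haar

/-- The Fourier coefficients of complex square integrable functions. -/
def coeffC (n : Freq) : Lp ℂ 2 haar →L[ℂ] ℂ :=
  innerSL ℂ (UnitAddTorus.mFourierLp 2 n : Lp ℂ 2 haar)

lemma coeffC_apply (n : Freq) (F : Lp ℂ 2 haar) : coeffC n F = UnitAddTorus.mFourierCoeff F n := by
  rw [← UnitAddTorus.mFourierBasis_repr, HilbertBasis.repr_apply_apply]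
  simp only [UnitAddTorus.coe_mFourierBasis]
  rfl

lemma coeFn_toComplex (f : L2) : toComplex f =ᵐ[haar] fun x => (f x : ℂ) :=
  Complex.ofRealCLM.coeFn_compLpL f

lemma coeff_eq (f : L2) (n : Freq) : coeff f n = coeffC n (toComplex f) := by
  rw [coeffC_apply]
  unfold coeff UnitAddTorus.mFourierCoeff
  refine integral_congr_ae ?_
  filter_upwards [coeFn_toComplex f] with x hx
  rw [hx]

lemma coeff_sub (f g : L2) (n : Freq) : coeff (f - g : L2) n = coeff f n - coeff g n := by
  simp only [coeff_eq, map_sub]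

lemma continuous_coeff (n : Freq) : Continuous fun f : L2 => coeff f n := by
  simp only [coeff_eq]
  exact (coeffC n).continuous.comp toComplex.continuous

lemma coeff_neg (f : T2 → ℝ) (n : Freq) : coeff f (-n) = (starRingEnd ℂ) (coeff f n) := by
  unfold coeff UnitAddTorus.mFourierCoeff
  rw [← integral_conj]
  refine integral_congr_ae (ae_of_all _ fun x => ?_)
  simp only [smul_eq_mul, map_mul, Complex.conj_ofReal, ← UnitAddTorus.mFourier_neg]

lemma integral_sq_eq_norm_sq (f : L2) : ∫ x, f x ^ 2 ∂haar = ‖f‖ ^ 2 := by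
  rw [← real_inner_self_eq_norm_sq, L2.inner_def]
  simp only [real_inner_self_eq_norm_sq, Real.norm_eq_abs, sq_abs]

lemma hasSum_normSq_coeff (f : L2) : HasSum (fun n => ‖coeff f n‖ ^ 2) (‖f‖ ^ 2) := by
  have h := UnitAddTorus.hasSum_sq_mFourierCoeff (toComplex f)
  simp only [← coeffC_apply, ← coeff_eq] at h
  rw [← integral_sq_eq_norm_sq]
  convert! h using 1
  refine integral_congr_ae ?_
  filter_upwards [coeFn_toComplex f] with x hx
  rw [hx, Complex.norm_real, Real.norm_eq_abs, sq_abs]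

lemma eq_of_coeff_eq {f g : L2} (h : ∀ n, coeff f n = coeff g n) : f = g := by
  have h1 := hasSum_normSq_coeff (f - g)
  simp only [coeff_sub, h, sub_self, norm_zero, ne_eq, OfNat.ofNat_ne_zero, not_false_eq_true,
    zero_pow] at h1
  have h2 := h1.unique hasSum_zero
  rw [sq_eq_zero_iff, norm_eq_zero] at h2
  exact sub_eq_zero.1 h2

/-- The real part of the Fourier series with coefficients `c`. -/
def series (c : Freq → ℂ) : L2 :=
  Complex.reCLM.compLp (∑' n : Freq, c n • UnitAddTorus.mFourierLp 2 n : Lp ℂ 2 haar)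

/-- The real part is half the sum with the conjugate, and conjugating a function reflects its
frequencies. -/
lemma coeff_compLp_re (F : Lp ℂ 2 haar) (n : Freq) :
    coeff (Complex.reCLM.compLp F : L2) n =
      (coeffC n F + (starRingEnd ℂ) (coeffC (-n) F)) / 2 := by
  rw [coeffC_apply, coeffC_apply]
  unfold coeff UnitAddTorus.mFourierCoeff
  have hF : Integrable F haar := (Lp.memLp F).integrable (by norm_num)
  have hi : ∀ m : Freq, Integrable (fun x => UnitAddTorus.mFourier m x • F x) haar := fun m =>
    hF.bdd_mul (c := 1) (UnitAddTorus.mFourier m).continuous.aestronglyMeasurable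
      (ae_of_all _ fun x => ((UnitAddTorus.mFourier m).norm_coe_le_norm x).trans_eq
        UnitAddTorus.mFourier_norm)
  have hc : Integrable (fun x => (starRingEnd ℂ) (UnitAddTorus.mFourier n x • F x)) haar :=
    (Complex.conjLIE.integrable_comp_iff).2 (hi n)
  rw [neg_neg]
  have e1 : (starRingEnd ℂ) (∫ x, UnitAddTorus.mFourier n x • F x ∂haar) =
      ∫ x, (starRingEnd ℂ) (UnitAddTorus.mFourier n x • F x) ∂haar := integral_conj.symm
  refine Eq.trans ?_ (congrArg (fun z => (_ + z) / 2) e1.symm)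
  refine Eq.trans ?_ (congrArg (fun z => z / 2) (integral_add (hi (-n)) hc))
  rw [← integral_div]
  refine integral_congr_ae ?_
  filter_upwards [Complex.reCLM.coeFn_compLp F] with x hx
  rw [hx, UnitAddTorus.mFourier_neg]
  simp only [smul_eq_mul, map_mul, Complex.reCLM_apply]
  rw [← mul_add, Complex.add_conj]
  push_cast
  ring

/-- Hermitian symmetry makes the series real, so nothing is lost by taking its real part. -/
lemma coeff_series {c : Freq → ℂ} (hc : ∀ n, c (-n) = (starRingEnd ℂ) (c n))
    (hs : Summable fun n => ‖c n‖ ^ 2) (n : Freq) : coeff (series c) n = c n := by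
  have h1 : ∀ m, coeffC m (∑' n : Freq, c n • UnitAddTorus.mFourierLp 2 n : Lp ℂ 2 haar) = c m := by
    intro m
    rw [(coeffC m).map_tsum ((summable_series_iff c).2 hs)]
    have : ∀ k, coeffC m (c k • UnitAddTorus.mFourierLp 2 k : Lp ℂ 2 haar) =
        if k = m then c m else 0 := by
      intro k
      have h := orthonormal_iff_ite.1 (UnitAddTorus.orthonormal_mFourier (d := Fin 2)) m k
      rw [map_smul, coeffC]
      rw [show innerSL ℂ (UnitAddTorus.mFourierLp 2 m : Lp ℂ 2 haar) (UnitAddTorus.mFourierLp 2 k)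
        = _ from h, smul_eq_mul]
      by_cases hk : k = m
      · simp [hk]
      · simp [hk, Ne.symm hk]
    simp only [this, tsum_ite_eq]
  unfold series
  rw [coeff_compLp_re, h1, h1, hc]
  simp

/-! ### Trigonometric polynomials -/

/-- The trigonometric polynomial with coefficients `c` at the frequencies in `B`. -/
def trig (B : Finset Freq) (c : Freq → ℂ) : C(T2, ℂ) := ∑ n ∈ B, c n • UnitAddTorus.mFourier n

lemma trig_apply (B : Finset Freq) (c : Freq → ℂ) (x : T2) :
    trig B c x = ∑ n ∈ B, c n * UnitAddTorus.mFourier n x := by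
  simp [trig, ContinuousMap.sum_apply]

lemma trig_congr {B : Finset Freq} {c d : Freq → ℂ} (h : ∀ n ∈ B, c n = d n) :
    trig B c = trig B d :=
  Finset.sum_congr rfl fun n hn => by rw [h n hn]

lemma mem_ball {N : ℕ} {n : Freq} : n ∈ ball N ↔ absSq n ≤ (N : ℝ) ^ 2 := by
  unfold ball
  simp only [Finset.mem_filter, Fintype.mem_piFinset, Finset.mem_Icc, and_iff_right_iff_imp]
  intro h i
  have h0 : (n i : ℝ) ^ 2 ≤ (N : ℝ) ^ 2 := by
    unfold absSq at h
    fin_cases i <;> simp <;> nlinarith [sq_nonneg (n 0 : ℝ), sq_nonneg (n 1 : ℝ)]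
  have := abs_le_of_sq_le_sq' h0 (by positivity)
  exact_mod_cast this

lemma neg_mem_ball {N : ℕ} : ∀ n ∈ ball N, -n ∈ ball N := fun n hn => by
  rw [mem_ball, absSq_neg]
  exact mem_ball.1 hn

lemma sum_neg_eq {B : Finset Freq} (hB : ∀ n ∈ B, -n ∈ B) {R : Type*} [AddCommMonoid R]
    (f : Freq → R) : ∑ n ∈ B, f (-n) = ∑ n ∈ B, f n :=
  Finset.sum_nbij' (fun n => -n) (fun n => -n) hB hB (by simp) (by simp) (by simp)

lemma ofReal_re_trig {B : Finset Freq} (hB : ∀ n ∈ B, -n ∈ B) {c : Freq → ℂ}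
    (hc : ∀ n, c (-n) = (starRingEnd ℂ) (c n)) (x : T2) : ((trig B c x).re : ℂ) = trig B c x := by
  rw [← Complex.conj_eq_iff_re, trig_apply, map_sum, ← sum_neg_eq hB]
  refine Finset.sum_congr rfl fun n _ => ?_
  rw [map_mul, hc, Complex.conj_conj, UnitAddTorus.mFourier_neg, Complex.conj_conj]

lemma ofReal_proj (N : ℕ) (f : T2 → ℝ) (x : T2) :
    (proj N f x : ℂ) = trig (ball N) (coeff f) x := by
  rw [← ofReal_re_trig neg_mem_ball (coeff_neg f), trig_apply]
  rfl

lemma integral_mFourier (n : Freq) :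
    ∫ x, UnitAddTorus.mFourier n x ∂haar = if n = 0 then 1 else 0 := by
  have h := orthonormal_iff_ite.1 (UnitAddTorus.orthonormal_mFourier (d := Fin 2)) 0 n
  rw [ContinuousMap.inner_toLp] at h
  simp only [UnitAddTorus.mFourier_zero, ContinuousMap.one_apply, map_one, mul_one] at h
  simp only [eq_comm (a := n)]
  exact h

lemma integrable_continuousMap (f : C(T2, ℂ)) : Integrable f haar :=
  f.continuous.integrable_of_hasCompactSupport (HasCompactSupport.of_compactSpace f)

lemma mFourier_mul (m n : Freq) (x : T2) : UnitAddTorus.mFourier m x * UnitAddTorus.mFourier n x =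
    UnitAddTorus.mFourier (m + n) x := UnitAddTorus.mFourier_add.symm

lemma integral_mFourier_mul_trig (B : Finset Freq) (c : Freq → ℂ) (q : Freq) :
    ∫ x, UnitAddTorus.mFourier q x * trig B c x ∂haar =
      ∑ n ∈ B, if q + n = 0 then c n else 0 := by
  have : ∀ x, UnitAddTorus.mFourier q x * trig B c x =
      ∑ n ∈ B, c n * UnitAddTorus.mFourier (q + n) x := by
    intro x
    rw [trig_apply, Finset.mul_sum]
    refine Finset.sum_congr rfl fun n _ => ?_
    rw [← mFourier_mul]
    ring
  simp only [this]
  rw [integral_finsetSum _ fun n _ => (integrable_continuousMap _).const_mul _]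
  refine Finset.sum_congr rfl fun n _ => ?_
  rw [integral_const_mul, integral_mFourier]
  split_ifs <;> simp

/-! ### Integrals of products and the energy as a polynomial. -/

/-- The bilinear sum over pairs of opposite frequencies. -/
def pairing (B : Finset Freq) (c d : Freq → ℂ) : ℂ :=
  ∑ m ∈ B, ∑ n ∈ B, if m + n = 0 then c m * d n else 0

/-- The Fourier coefficients of the cube of a trigonometric polynomial. -/
def cubeCoeff (B : Finset Freq) (a : Freq → ℂ) (n : Freq) : ℂ :=
  ∑ i ∈ B, ∑ j ∈ B, ∑ k ∈ B, if i + j + k = n then a i * a j * a k else 0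

lemma integral_mFourier_mul_prod (B : Finset Freq) (q : Freq) (c₁ c₂ c₃ : Freq → ℂ) :
    ∫ x, UnitAddTorus.mFourier q x * (trig B c₁ x * trig B c₂ x * trig B c₃ x) ∂haar =
      ∑ i ∈ B, ∑ j ∈ B, ∑ k ∈ B, if q + i + j + k = 0 then c₁ i * c₂ j * c₃ k else 0 := by
  have : ∀ x, UnitAddTorus.mFourier q x * (trig B c₁ x * trig B c₂ x * trig B c₃ x) =
      ∑ i ∈ B, ∑ j ∈ B, c₁ i * c₂ j * (UnitAddTorus.mFourier (q + i + j) x * trig B c₃ x) := by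
    intro x
    rw [trig_apply B c₁, trig_apply B c₂, Finset.sum_mul_sum, Finset.sum_mul, Finset.mul_sum]
    refine Finset.sum_congr rfl fun i _ => ?_
    rw [Finset.sum_mul, Finset.mul_sum]
    refine Finset.sum_congr rfl fun j _ => ?_
    rw [← mFourier_mul, ← mFourier_mul]
    ring
  simp only [this]
  have hi : ∀ i j, Integrable (fun x => c₁ i * c₂ j *
      (UnitAddTorus.mFourier (q + i + j) x * trig B c₃ x)) haar := fun i j =>
    (integrable_continuousMap (UnitAddTorus.mFourier (q + i + j) * trig B c₃)).const_mul _
  rw [integral_finsetSum _ fun i _ => integrable_finsetSum _ fun j _ => hi i j]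
  refine Finset.sum_congr rfl fun i _ => ?_
  rw [integral_finsetSum _ fun j _ => hi i j]
  refine Finset.sum_congr rfl fun j _ => ?_
  rw [integral_const_mul, integral_mFourier_mul_trig, Finset.mul_sum]
  refine Finset.sum_congr rfl fun k _ => ?_
  split_ifs <;> simp

lemma integral_trig_mul_trig (B : Finset Freq) (c d : Freq → ℂ) :
    ∫ x, trig B c x * trig B d x ∂haar = pairing B c d := by
  have : ∀ x, trig B c x * trig B d x =
      ∑ i ∈ B, c i * (UnitAddTorus.mFourier i x * trig B d x) := by
    intro x
    rw [trig_apply B c, Finset.sum_mul]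
    refine Finset.sum_congr rfl fun i _ => by ring
  simp only [this]
  have hi : ∀ i ∈ B, Integrable (fun x => c i * (UnitAddTorus.mFourier i x * trig B d x)) haar :=
    fun i _ => (integrable_continuousMap (UnitAddTorus.mFourier i * trig B d)).const_mul _
  rw [integral_finsetSum _ hi]
  refine Finset.sum_congr rfl fun i _ => ?_
  rw [integral_const_mul, integral_mFourier_mul_trig, Finset.mul_sum]
  refine Finset.sum_congr rfl fun k _ => ?_
  split_ifs <;> simp

lemma integral_trig_prod (B : Finset Freq) (c₁ c₂ c₃ c₄ : Freq → ℂ) :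
    ∫ x, trig B c₁ x * (trig B c₂ x * trig B c₃ x * trig B c₄ x) ∂haar =
      quad B (fun i j k l => c₁ i * (c₂ j * c₃ k * c₄ l)) := by
  have : ∀ x, trig B c₁ x * (trig B c₂ x * trig B c₃ x * trig B c₄ x) =
      ∑ i ∈ B, c₁ i * (UnitAddTorus.mFourier i x * (trig B c₂ x * trig B c₃ x * trig B c₄ x)) := by
    intro x
    rw [trig_apply B c₁, Finset.sum_mul]
    refine Finset.sum_congr rfl fun i _ => by ring
  simp only [this]
  have hi : ∀ i ∈ B, Integrable (fun x => c₁ i * (UnitAddTorus.mFourier i x *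
      (trig B c₂ x * trig B c₃ x * trig B c₄ x))) haar := fun i _ => (integrable_continuousMap
    (UnitAddTorus.mFourier i * (trig B c₂ * trig B c₃ * trig B c₄))).const_mul _
  rw [integral_finsetSum _ hi]
  refine Finset.sum_congr rfl fun i _ => ?_
  rw [integral_const_mul, integral_mFourier_mul_prod, Finset.mul_sum]
  refine Finset.sum_congr rfl fun j _ => ?_
  rw [Finset.mul_sum]
  refine Finset.sum_congr rfl fun k _ => ?_
  rw [Finset.mul_sum]
  refine Finset.sum_congr rfl fun l _ => ?_
  split_ifs <;> simp

lemma coeff_of_trig {B : Finset Freq} {c : Freq → ℂ} {g : T2 → ℝ}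
    (hg : ∀ x, (g x : ℂ) = trig B c x) (n : Freq) : coeff g n = if n ∈ B then c n else 0 := by
  unfold coeff UnitAddTorus.mFourierCoeff
  simp only [hg, smul_eq_mul]
  refine (integral_mFourier_mul_trig B c (-n)).trans ?_
  have : ∀ k, (-n + k = 0) = (k = n) := fun k => by
    rw [neg_add_eq_zero, eq_comm (a := n)]
  simp only [this, Finset.sum_ite_eq']

lemma coeff_proj (N : ℕ) (f : T2 → ℝ) (n : Freq) :
    coeff (proj N f) n = if n ∈ ball N then coeff f n else 0 :=
  coeff_of_trig (ofReal_proj N f) n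

lemma proj_proj (N : ℕ) (f : T2 → ℝ) : proj N (proj N f) = proj N f := by
  funext x
  have h := ofReal_proj N (proj N f) x
  rw [trig_congr fun n hn => (coeff_proj N f n).trans (if_pos hn), ← ofReal_proj] at h
  exact_mod_cast h

lemma coeff_proj_pow (N : ℕ) (f : T2 → ℝ) (n : Freq) :
    coeff (fun x => proj N f x ^ 3) n = cubeCoeff (ball N) (coeff f) n := by
  have h : ∀ x, UnitAddTorus.mFourier (-n) x • ((proj N f x ^ 3 : ℝ) : ℂ) =
      UnitAddTorus.mFourier (-n) x * (trig (ball N) (coeff f) x * trig (ball N) (coeff f) x *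
        trig (ball N) (coeff f) x) := fun x => by
    rw [Complex.ofReal_pow, ofReal_proj, smul_eq_mul, pow_three']
  refine (integral_congr_ae (ae_of_all haar h)).trans
    ((integral_mFourier_mul_prod (ball N) (-n) _ _ _).trans ?_)
  unfold cubeCoeff
  refine Finset.sum_congr rfl fun i _ => Finset.sum_congr rfl fun j _ =>
    Finset.sum_congr rfl fun k _ => ?_
  have : (-n + i + j + k = 0) = (i + j + k = n) := by
    rw [add_assoc, add_assoc, neg_add_eq_zero, eq_comm (a := n), add_assoc]
  simp only [this]

/-- For a trigonometric polynomial the series defining `J` is a finite sum. The identity holds only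
almost everywhere because `J` evaluates a representative of an `L²` class. -/
lemma ofReal_J_ae {B : Finset Freq} (hB : ∀ n ∈ B, -n ∈ B) {c : Freq → ℂ}
    (hc : ∀ n, c (-n) = (starRingEnd ℂ) (c n)) {g : T2 → ℝ}
    (hg : ∀ x, (g x : ℂ) = trig B c x) (k : ℕ) :
    ∀ᵐ x ∂haar, (J k g x : ℂ) = trig B (fun n => (bracket n : ℂ) ^ k * c n) x := by
  have h : (∑' n : Freq, ((bracket n : ℂ) ^ k * coeff g n) • UnitAddTorus.mFourierLp 2 n :
      Lp ℂ 2 haar) = ContinuousMap.toLp (E := ℂ) 2 haar ℂ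
        (trig B (fun n => (bracket n : ℂ) ^ k * c n)) := by
    rw [tsum_eq_sum (s := B) fun n hn => by rw [coeff_of_trig hg, if_neg hn, mul_zero, zero_smul]]
    unfold trig
    rw [map_sum]
    refine Finset.sum_congr rfl fun n hn => ?_
    rw [map_smul, coeff_of_trig hg, if_pos hn]
    rfl
  unfold J
  rw [h]
  filter_upwards [ContinuousMap.coeFn_toLp (p := 2) (𝕜 := ℂ) haar
    (trig B (fun n => (bracket n : ℂ) ^ k * c n))] with x hx
  rw [hx]
  refine ofReal_re_trig hB (fun n => ?_) x
  rw [hc, bracket_neg, map_mul, map_pow, Complex.conj_ofReal]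

/-- The renormalized energy as a function of the Fourier coefficients. -/
def energyPoly (s : ℕ) (σ : ℝ) (B : Finset Freq) (a b : Freq → ℂ) : ℂ :=
  1 / 2 * pairing B (fun n => (bracket n : ℂ) ^ s * b n) (fun n => (bracket n : ℂ) ^ s * b n) +
    1 / 2 * pairing B (fun n => (bracket n : ℂ) ^ (s + 1) * a n)
      (fun n => (bracket n : ℂ) ^ (s + 1) * a n) +
    3 / 2 * quad B (fun i j k l => (bracket i : ℂ) ^ s * a i * ((bracket j : ℂ) ^ s * a j * a k * a l))
    - 3 / 2 * σ * pairing B a a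

lemma ofReal_integral_of_ae {f : T2 → ℝ} {F : C(T2, ℂ)} (h : ∀ᵐ x ∂haar, (f x : ℂ) = F x) :
    ((∫ x, f x ∂haar : ℝ) : ℂ) = ∫ x, F x ∂haar := by
  rw [← integral_complex_ofReal]
  exact integral_congr_ae h

lemma ofReal_integral_J_sq {B : Finset Freq} (hB : ∀ n ∈ B, -n ∈ B) {c : Freq → ℂ}
    (hc : ∀ n, c (-n) = (starRingEnd ℂ) (c n)) {g : T2 → ℝ}
    (hg : ∀ x, (g x : ℂ) = trig B c x) (k : ℕ) :
    ((∫ x, J k g x ^ 2 ∂haar : ℝ) : ℂ) =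
      pairing B (fun n => (bracket n : ℂ) ^ k * c n) (fun n => (bracket n : ℂ) ^ k * c n) := by
  rw [← integral_trig_mul_trig]
  refine ofReal_integral_of_ae (F := trig B _ * trig B _) ?_
  filter_upwards [ofReal_J_ae hB hc hg k] with x hx
  rw [Complex.ofReal_pow, hx, sq]
  rfl

lemma ofReal_renormEnergy (s N : ℕ) (u v : T2 → ℝ) :
    (renormEnergy s N (proj N u) (proj N v) : ℂ) =
      energyPoly s (sigma s N) (ball N) (coeff u) (coeff v) := by
  have hu := ofReal_proj N u
  have hv := ofReal_proj N v
  have hJ := ofReal_J_ae neg_mem_ball (coeff_neg u) hu s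
  unfold renormEnergy energyPoly
  rw [proj_proj]
  push_cast
  rw [ofReal_integral_J_sq neg_mem_ball (coeff_neg v) hv,
    ofReal_integral_J_sq neg_mem_ball (coeff_neg u) hu]
  congr 2
  · congr 1
    rw [← integral_trig_prod (c₁ := fun n => (bracket n : ℂ) ^ s * coeff u n)
      (c₂ := fun n => (bracket n : ℂ) ^ s * coeff u n)]
    refine ofReal_integral_of_ae (F := trig _ _ * (trig _ _ * trig _ _ * trig _ _)) ?_
    filter_upwards [hJ] with x hx
    push_cast
    rw [hx, hu]
    simp only [Pi.mul_apply]
    ring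
  · rw [← integral_trig_mul_trig]
    refine ofReal_integral_of_ae (F := trig _ _ * trig _ _) (ae_of_all _ fun x => ?_)
    push_cast
    rw [hu, sq]
    rfl

lemma pairing_eq {B : Finset Freq} (hB : ∀ n ∈ B, -n ∈ B) (c d : Freq → ℂ) :
    pairing B c d = ∑ n ∈ B, c n * d (-n) := by
  refine Finset.sum_congr rfl fun n hn => ?_
  have : ∀ m, (n + m = 0) = (m = -n) := fun m => by rw [add_comm, add_eq_zero_iff_eq_neg]
  simp only [this, Finset.sum_ite_eq', hB n hn, if_true]

lemma pairing_self {B : Finset Freq} (hB : ∀ n ∈ B, -n ∈ B) {c : Freq → ℂ}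
    (hc : ∀ n, c (-n) = (starRingEnd ℂ) (c n)) :
    pairing B c c = ((∑ n ∈ B, ‖c n‖ ^ 2 : ℝ) : ℂ) := by
  rw [pairing_eq hB]
  push_cast
  refine Finset.sum_congr rfl fun n _ => ?_
  rw [hc, Complex.mul_conj, Complex.normSq_eq_norm_sq]
  push_cast
  rfl

/-! ### The time derivative of the renormalized energy -/

lemma hasDerivAt_ite_zero (P : Prop) [Decidable P] {f : ℝ → ℂ} {f' : ℂ} {t : ℝ}
    (hf : HasDerivAt f f' t) :
    HasDerivAt (fun τ => if P then f τ else 0) (if P then f' else 0) t := by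
  split_ifs
  · exact hf
  · exact hasDerivAt_const t 0

lemma hasDerivAt_quad {B : Finset Freq} {f : ℝ → Freq → Freq → Freq → Freq → ℂ}
    {f' : Freq → Freq → Freq → Freq → ℂ} {t : ℝ}
    (hf : ∀ i j k l, HasDerivAt (fun τ => f τ i j k l) (f' i j k l) t) :
    HasDerivAt (fun τ => quad B (f τ)) (quad B f') t := by
  unfold quad
  exact HasDerivAt.fun_sum fun i _ => HasDerivAt.fun_sum fun j _ => HasDerivAt.fun_sum fun k _ =>
    HasDerivAt.fun_sum fun l _ => hasDerivAt_ite_zero _ (hf i j k l)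

lemma hasDerivAt_pairing {B : Finset Freq} {c d : ℝ → Freq → ℂ} {c' d' : Freq → ℂ} {t : ℝ}
    (hc : ∀ n, HasDerivAt (fun τ => c τ n) (c' n) t)
    (hd : ∀ n, HasDerivAt (fun τ => d τ n) (d' n) t) :
    HasDerivAt (fun τ => pairing B (c τ) (d τ)) (pairing B c' (d t) + pairing B (c t) d') t := by
  unfold pairing
  rw [← Finset.sum_add_distrib]
  refine HasDerivAt.fun_sum fun i _ => ?_
  rw [← Finset.sum_add_distrib]
  refine HasDerivAt.fun_sum fun j _ => ?_
  convert! hasDerivAt_ite_zero (i + j = 0) ((hc i).mul (hd j)) using 1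
  split_ifs <;> simp

lemma pairing_comm (B : Finset Freq) (c d : Freq → ℂ) : pairing B c d = pairing B d c := by
  unfold pairing
  rw [Finset.sum_comm]
  refine Finset.sum_congr rfl fun i _ => Finset.sum_congr rfl fun j _ => ?_
  rw [add_comm i j, mul_comm]

lemma pairing_cubeCoeff {B : Finset Freq} (hB : ∀ n ∈ B, -n ∈ B) (a c : Freq → ℂ) :
    pairing B (cubeCoeff B a) c = quad B fun i j k l => a i * a j * a k * c l := by
  rw [pairing_comm, pairing_eq hB, ← sum_neg_eq hB]
  unfold quad cubeCoeff
  simp only [neg_neg, Finset.mul_sum]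
  rw [Finset.sum_comm]
  refine Finset.sum_congr rfl fun i _ => ?_
  rw [Finset.sum_comm]
  refine Finset.sum_congr rfl fun j _ => ?_
  rw [Finset.sum_comm]
  refine Finset.sum_congr rfl fun k _ => ?_
  rw [← sum_neg_eq hB]
  refine Finset.sum_congr rfl fun l _ => ?_
  have : (i + j + k = -l) = (i + j + k + l = 0) := by
    rw [eq_neg_iff_add_eq_zero]
  simp only [this, neg_neg]
  split_ifs <;> ring

lemma pairing_mul_even {B : Finset Freq} (hB : ∀ n ∈ B, -n ∈ B) (κ : Freq → ℂ)
    (hκ : ∀ n, κ (-n) = κ n) (c d : Freq → ℂ) :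
    pairing B (fun n => κ n * c n) (fun n => κ n * d n) =
      pairing B c (fun n => κ n ^ 2 * d n) := by
  rw [pairing_eq hB, pairing_eq hB]
  refine Finset.sum_congr rfl fun n _ => ?_
  rw [hκ]
  ring

/-- The time derivative of the renormalized energy along the truncated equation. -/
lemma hasDerivAt_energyPoly (s : ℕ) (σ : ℝ) {B : Finset Freq} (hB : ∀ n ∈ B, -n ∈ B)
    {a b : ℝ → Freq → ℂ} {t : ℝ} (ha : ∀ n, HasDerivAt (fun τ => a τ n) (b t n) t)
    (hb : ∀ n, HasDerivAt (fun τ => b τ n)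
      (-(absSq n : ℂ) * a t n - a t n - if n ∈ B then cubeCoeff B (a t) n else 0) t) :
    HasDerivAt (fun τ => energyPoly s σ B (a τ) (b τ)) (energyRate s σ B (a t) (b t)) t := by
  set b' : Freq → ℂ := fun n =>
    -(absSq n : ℂ) * a t n - a t n - if n ∈ B then cubeCoeff B (a t) n else 0 with hb'
  have hκ : ∀ k : ℕ, ∀ n : Freq, (bracket (-n) : ℂ) ^ k = (bracket n : ℂ) ^ k := fun k n => by
    rw [bracket_neg]
  have hP : ∀ (k : ℕ) {c : ℝ → Freq → ℂ} {c' : Freq → ℂ},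
      (∀ n, HasDerivAt (fun τ => c τ n) (c' n) t) →
      HasDerivAt (fun τ => pairing B (fun n => (bracket n : ℂ) ^ k * c τ n)
        (fun n => (bracket n : ℂ) ^ k * c τ n))
        (2 * pairing B c' (fun n => (bracket n : ℂ) ^ (2 * k) * c t n)) t := by
    intro k c c' hc
    have h : ∀ n, HasDerivAt (fun τ => (bracket n : ℂ) ^ k * c τ n) ((bracket n : ℂ) ^ k * c' n) t :=
      fun n => (hc n).const_mul _
    convert! hasDerivAt_pairing h h using 1
    rw [pairing_comm B (fun n => (bracket n : ℂ) ^ k * c t n), pairing_mul_even hB _ (hκ k)]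
    simp only [← pow_mul, mul_comm k 2]
    ring
  have h1 := (hP s hb).const_mul (1 / 2 : ℂ)
  have h2 := (hP (s + 1) ha).const_mul (1 / 2 : ℂ)
  have h4 := (hasDerivAt_pairing (B := B) ha ha).const_mul (3 / 2 * σ : ℂ)
  -- Of the four terms of the product rule, two differentiate a plain factor and two a factor
  -- carrying `⟨·⟩^s`. Within each kind the terms agree after a permutation of the slots.
  have h3 : HasDerivAt (fun τ => quad B (fun i j k l =>
      (bracket i : ℂ) ^ s * a τ i * ((bracket j : ℂ) ^ s * a τ j * a τ k * a τ l)))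
      (2 * quad B (fun i j k l => ((bracket i ^ s * bracket j ^ s : ℝ) : ℂ) *
        (a t i * a t j * a t k * b t l)) + 2 * quad B (fun i j k l =>
          ((bracket l ^ s * bracket i ^ s : ℝ) : ℂ) * (a t i * a t j * a t k * b t l))) t := by
    have h := hasDerivAt_quad (B := B) fun i j k l =>
      ((ha i).const_mul ((bracket i : ℂ) ^ s)).mul
        ((((ha j).const_mul ((bracket j : ℂ) ^ s)).mul (ha k)).mul (ha l))
    convert! h using 1
    set f : Freq → Freq → Freq → Freq → ℂ := fun i j k l =>
      ((bracket i ^ s * bracket j ^ s : ℝ) : ℂ) * (a t i * a t j * a t k * b t l) with hf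
    set g : Freq → Freq → Freq → Freq → ℂ := fun i j k l =>
      ((bracket l ^ s * bracket i ^ s : ℝ) : ℂ) * (a t i * a t j * a t k * b t l) with hg
    have f2 := quad_swap34 (B := B) f
    have g2 := quad_swap24 (B := B) g
    have g1 := (quad_swap12 (B := B) fun i j k l => g i l k j).trans g2
    rw [two_mul, two_mul]
    nth_rw 1 [← f2]
    nth_rw 1 [← g1]
    nth_rw 1 [← g2]
    rw [← quad_add, ← quad_add, ← quad_add]
    refine quad_congr fun i _ j _ k _ l _ _ => ?_
    simp only [hf, hg, Pi.mul_apply]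
    push_cast
    ring
  have e := (((h1.add h2).add (h3.const_mul (3 / 2 : ℂ))).sub h4)
  convert! e using 1
  -- Since `⟨n⟩^{2(s+1)} = ⟨n⟩^{2s}(1 + |n|²)`, the linear part of the equation produces exactly the
  -- term cancelled by the derivative of the `H^{s+1}` norm. Only the cubic part survives.
  have e1 : pairing B b' (fun n => (bracket n : ℂ) ^ (2 * s) * b t n) =
      -pairing B (b t) (fun n => (bracket n : ℂ) ^ (2 * (s + 1)) * a t n) -
      quad B (fun i j k l => a t i * a t j * a t k * ((bracket l : ℂ) ^ (2 * s) * b t l)) := by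
    rw [← pairing_cubeCoeff hB, pairing_comm B (b t), pairing_eq hB, pairing_eq hB, pairing_eq hB,
      ← Finset.sum_neg_distrib, ← Finset.sum_sub_distrib]
    refine Finset.sum_congr rfl fun n hn => ?_
    have hbr : (bracket n : ℂ) ^ (2 * (s + 1)) = (bracket n : ℂ) ^ (2 * s) * (1 + absSq n) := by
      rw [mul_add, pow_add, mul_one, ← Complex.ofReal_pow _ 2, bracket_sq]
      push_cast
      ring
    simp only [hb', hn, if_true, bracket_neg, hbr]
    ring
  -- The coefficient 3 is 3/2 times the 2 from differentiating the factors with weight `⟨·⟩^s`.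
  -- Combined with the cubic part it forms the commutator symbol.
  have e2 : quad B (fun n₁ n₂ n₃ n₄ =>
      ((bracket n₄ ^ s * (bracket n₄ ^ s - 3 * bracket n₁ ^ s) : ℝ) : ℂ) *
      (a t n₁ * a t n₂ * a t n₃ * b t n₄)) =
      quad B (fun i j k l => a t i * a t j * a t k * ((bracket l : ℂ) ^ (2 * s) * b t l)) +
      (-3) * quad B (fun i j k l =>
          ((bracket l ^ s * bracket i ^ s : ℝ) : ℂ) * (a t i * a t j * a t k * b t l)) := by
    rw [← quad_const_mul, ← quad_add]
    refine quad_congr fun i _ j _ k _ l _ _ => ?_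
    push_cast
    ring
  unfold energyRate
  rw [e1, e2, pairing_comm B (b t) (a t)]
  change _ - (_ + _) = _
  unfold pairing
  ring

/-! ### Fourier coefficients under the Gaussian measure -/

lemma summable_inv_lam_pow {e : ℕ} (he : 17 ≤ e) : Summable fun n : Freq => (lam n)⁻¹ ^ e := by
  refine Summable.of_nonneg_of_le (fun n => by have := lam_pos n; positivity) (fun n => ?_)
    summable_lam_pow
  rw [← inv_pow]
  exact pow_le_pow_of_le_one (by have := lam_pos n; positivity)
    (inv_le_one_of_one_le₀ (one_le_lam n)) he

/-- By Tonelli the expectation of the sum is the sum of the weights, because `E|g_n|² = 1`. -/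
lemma ae_summable_normSq_gauss (k : Fin 2) {w : Freq → ℝ} (hw : ∀ n, 0 ≤ w n) (hs : Summable w) :
    ∀ᵐ ω ∂sampleMeasure, Summable fun n => w n * ‖gauss k n ω‖ ^ 2 := by
  have hm : ∀ n, Measurable fun ω => ENNReal.ofReal (w n * ‖gauss k n ω‖ ^ 2) := fun n =>
    (((measurable_gauss k n).norm.pow_const 2).const_mul _).ennreal_ofReal
  have h : ∫⁻ ω, ∑' n, ENNReal.ofReal (w n * ‖gauss k n ω‖ ^ 2) ∂sampleMeasure ≠ ⊤ := by
    rw [lintegral_tsum fun n => (hm n).aemeasurable]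
    have : ∀ n, ∫⁻ ω, ENNReal.ofReal (w n * ‖gauss k n ω‖ ^ 2) ∂sampleMeasure =
        ENNReal.ofReal (w n) := by
      intro n
      rw [← ofReal_integral_eq_lintegral_ofReal ((integrable_normSq_gauss k n).const_mul _)
        (ae_of_all _ fun ω => mul_nonneg (hw n) (by positivity)), integral_const_mul,
        integral_normSq_gauss, mul_one]
    simp only [this]
    exact hs.tsum_ofReal_ne_top
  filter_upwards [ae_lt_top (Measurable.tsum hm) h] with ω hω
  refine (ENNReal.summable_toReal hω.ne).congr fun n => ?_
  exact ENNReal.toReal_ofReal (mul_nonneg (hw n) (by positivity))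

lemma normSq_gauss_div (k : Fin 2) (a : ℕ) (n : Freq) (ω : Sample) :
    ‖gauss k n ω / (bracket n : ℂ) ^ a‖ ^ 2 = (lam n)⁻¹ ^ (16 * a) * ‖gauss k n ω‖ ^ 2 := by
  rw [norm_div, norm_pow, Complex.norm_real, Real.norm_eq_abs, abs_of_pos (bracket_pos n),
    ← lam_pow_eight, div_pow, ← pow_mul, ← pow_mul, inv_pow, show 8 * (a * 2) = 16 * a by ring]
  ring

/-- Where the series diverges `tsum` is zero by default. This happens on a null set, since the
variances decay like `lam n` to the power `-16a`, with `16a ≥ 32`. -/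
lemma ae_coeff_randomSeries (k : Fin 2) {a : ℕ} (ha : 2 ≤ a) :
    ∀ᵐ ω ∂sampleMeasure, ∀ n, coeff (randomSeries k a ω) n = gauss k n ω / (bracket n : ℂ) ^ a := by
  filter_upwards [ae_summable_normSq_gauss k (w := fun n => (lam n)⁻¹ ^ (16 * a))
    (fun n => by have := lam_pos n; positivity) (summable_inv_lam_pow (by omega))] with ω hω
  refine coeff_series (c := fun n => gauss k n ω / (bracket n : ℂ) ^ a) (fun n => ?_) ?_
  · rw [gauss_neg, bracket_neg, map_div₀, map_pow, Complex.conj_ofReal]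
  · simpa only [normSq_gauss_div] using hω

lemma measurable_coeff (n : Freq) : Measurable fun f : L2 => coeff f n :=
  (continuous_coeff n).measurable

lemma measurable_pair (s : ℕ) :
    Measurable fun ω => (randomSeries 0 (s + 1) ω, randomSeries 1 s ω) :=
  (measurable_randomSeries 0 (s + 1)).prodMk (measurable_randomSeries 1 s)

lemma ae_memH1 {s : ℕ} (hs : 2 ≤ s) : ∀ᵐ w ∂mu s, MemH1 w.1 := by
  have hms : MeasurableSet {w : L2 × L2 | MemH1 w.1} := by
    have : {w : L2 × L2 | MemH1 w.1} =
        {w | ∑' n, ENNReal.ofReal (bracket n ^ 2 * ‖coeff w.1 n‖ ^ 2) ≠ ⊤} := by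
      ext w
      constructor
      · exact fun h => Summable.tsum_ofReal_ne_top h
      · intro h
        refine (ENNReal.summable_toReal h).congr fun n => ?_
        exact ENNReal.toReal_ofReal (by positivity)
    rw [this]
    refine (measurableSet_singleton _).compl.preimage (f := fun w : L2 × L2 =>
      ∑' n, ENNReal.ofReal (bracket n ^ 2 * ‖coeff w.1 n‖ ^ 2)) ?_
    exact Measurable.tsum fun n =>
      ((((measurable_coeff n).comp measurable_fst).norm.pow_const 2).const_mul _).ennreal_ofReal
  unfold mu
  rw [ae_map_iff (measurable_pair s).aemeasurable hms]
  filter_upwards [ae_coeff_randomSeries 0 (a := s + 1) (by omega),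
    ae_summable_normSq_gauss 0 (w := fun n => (lam n)⁻¹ ^ (16 * s))
    (fun n => by have := lam_pos n; positivity) (summable_inv_lam_pow (by omega))] with ω h1 h2
  refine h2.congr fun n => ?_
  have := lam_pos n
  rw [h1, normSq_gauss_div, ← lam_pow_eight, mul_add, pow_add, inv_pow, inv_pow]
  field_simp

/-- Each frequency contributes `⟨n⟩^{2s}⟨n⟩^{-2(s+1)}E|g_n|²`. The constant in the renormalized
energy is thus the one that Wick orders `wickTensor`. -/
lemma sigma_eq {s : ℕ} (hs : 2 ≤ s) (N : ℕ) : sigma s N = wickMass (ball N) := by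
  have h1 : ∀ f : L2, ∫ x, J s (proj N f) x ^ 2 ∂haar =
      ∑ n ∈ ball N, ‖(bracket n : ℂ) ^ s * coeff f n‖ ^ 2 := by
    intro f
    have h := ofReal_integral_J_sq neg_mem_ball (coeff_neg f) (ofReal_proj N f) s
    rw [pairing_self neg_mem_ball fun n => by
      rw [coeff_neg, bracket_neg, map_mul, map_pow, Complex.conj_ofReal]] at h
    exact_mod_cast h
  unfold sigma mu
  simp only [h1]
  rw [integral_map (measurable_pair s).aemeasurable]
  swap
  · refine (Finset.measurable_sum _ fun n _ => ?_).aestronglyMeasurable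
    exact (((measurable_coeff n).comp measurable_fst).const_mul _).norm.pow_const 2
  have h2 : ∀ᵐ ω ∂sampleMeasure, ∑ n ∈ ball N, ‖(bracket n : ℂ) ^ s *
      coeff (randomSeries 0 (s + 1) ω) n‖ ^ 2 =
      ∑ n ∈ ball N, (bracket n ^ 2)⁻¹ * ‖gauss 0 n ω‖ ^ 2 := by
    filter_upwards [ae_coeff_randomSeries 0 (a := s + 1) (by omega)] with ω h
    refine Finset.sum_congr rfl fun n _ => ?_
    have := bracket_pos n
    rw [h, norm_mul, norm_div, norm_pow, norm_pow, Complex.norm_real, Real.norm_eq_abs,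
      abs_of_pos (bracket_pos n)]
    field_simp
    ring
  rw [integral_congr_ae h2, integral_finsetSum _ fun n _ =>
    (integrable_normSq_gauss 0 n).const_mul _]
  simp only [integral_const_mul, integral_normSq_gauss, mul_one]
  rfl

lemma energyRate_congr {s : ℕ} {σ : ℝ} {B : Finset Freq} {a b a' b' : Freq → ℂ}
    (ha : ∀ n ∈ B, a n = a' n) (hb : ∀ n ∈ B, b n = b' n) :
    energyRate s σ B a b = energyRate s σ B a' b' := by
  have h : ∀ κ : Freq → Freq → Freq → Freq → ℂ,
      quad B (fun i j k l => κ i j k l * (a i * a j * a k * b l)) =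
      quad B (fun i j k l => κ i j k l * (a' i * a' j * a' k * b' l)) := fun κ =>
    quad_congr fun i hi j hj k hk l hl _ => by rw [ha i hi, ha j hj, ha k hk, hb l hl]
  have h2 : (∑ m ∈ B, ∑ l ∈ B, if m + l = 0 then a m * b l else 0) =
      ∑ m ∈ B, ∑ l ∈ B, if m + l = 0 then a' m * b' l else 0 :=
    Finset.sum_congr rfl fun m hm => Finset.sum_congr rfl fun l hl => by rw [ha m hm, hb l hl]
  unfold energyRate
  rw [h2, h fun i j _ _ => ((bracket i ^ s * bracket j ^ s : ℝ) : ℂ),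
    h fun i _ _ l => ((bracket l ^ s * (bracket l ^ s - 3 * bracket i ^ s) : ℝ) : ℂ)]

lemma quadEnergy_congr {B : Finset Freq} {a b a' b' : Freq → ℂ}
    (ha : ∀ n ∈ B, a n = a' n) (hb : ∀ n ∈ B, b n = b' n) :
    quadEnergy B a b = quadEnergy B a' b' :=
  Finset.sum_congr rfl fun n hn => by rw [ha n hn, hb n hn]

/-- The moments of the rate of change under the Gaussian measure. -/
lemma lintegral_mu_rpow_le {s : ℕ} (hs : 2 ≤ s) (r : ℝ) (N : ℕ) {p : ℝ} (hp : 1 ≤ p) :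
    ∫⁻ w in {w : L2 × L2 | quadEnergy (ball N) (coeff w.1) (coeff w.2) ≤ r},
      ENNReal.ofReal (‖energyRate s (sigma s N) (ball N) (coeff w.1) (coeff w.2)‖ ^ p) ∂mu s ≤
      ENNReal.ofReal ((64 * rateConst s r * p) ^ p) := by
  refine le_trans (le_of_eq ?_) (lintegral_rpow_energyRate_le hs r (B := ball N) neg_mem_ball hp)
  have hc1 : ∀ n, Measurable fun w : L2 × L2 => coeff w.1 n := fun n =>
    (measurable_coeff n).comp measurable_fst
  have hc2 : ∀ n, Measurable fun w : L2 × L2 => coeff w.2 n := fun n =>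
    (measurable_coeff n).comp measurable_snd
  have hE : MeasurableSet {w : L2 × L2 | quadEnergy (ball N) (coeff w.1) (coeff w.2) ≤ r} :=
    measurableSet_le (measurable_quadEnergy _ hc1 hc2) measurable_const
  have hf : Measurable fun w : L2 × L2 => ENNReal.ofReal
      (‖energyRate s (sigma s N) (ball N) (coeff w.1) (coeff w.2)‖ ^ p) :=
    ((measurable_energyRate s _ _ hc1 hc2).norm.pow_const p).ennreal_ofReal
  have hE' : MeasurableSet {ω | quadEnergy (ball N) (sampleU s (ball N) ω)
      (sampleV s (ball N) ω) ≤ r} := measurableSet_le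
    (measurable_quadEnergy _ (measurable_sampleU s _) (measurable_sampleV s _)) measurable_const
  rw [← lintegral_indicator hE, ← lintegral_indicator hE', mu,
    lintegral_map (hf.indicator hE) (measurable_pair s)]
  refine lintegral_congr_ae ?_
  filter_upwards [ae_coeff_randomSeries 0 (a := s + 1) (by omega),
    ae_coeff_randomSeries 1 hs] with ω h0 h1
  have e0 : ∀ n ∈ ball N, coeff (randomSeries 0 (s + 1) ω) n = sampleU s (ball N) ω n :=
    fun n hn => by rw [h0, sampleU, if_pos hn]
  have e1 : ∀ n ∈ ball N, coeff (randomSeries 1 s ω) n = sampleV s (ball N) ω n :=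
    fun n hn => by rw [h1, sampleV, if_pos hn]
  simp only [Set.indicator, Set.mem_ofPred_eq, quadEnergy_congr e0 e1, energyRate_congr e0 e1,
    sigma_eq hs]

/-! ### Global solutions of ordinary differential equations with bounded Lipschitz fields -/

section ode

variable {E : Type*} [NormedAddCommGroup E] [NormedSpace ℝ E]

lemma eq_of_hasDerivAt {G : E → E} {K : NNReal} (hG : LipschitzWith K G) {x y : ℝ → E}
    (hx : ∀ t, HasDerivAt x (G (x t)) t) (hy : ∀ t, HasDerivAt y (G (y t)) t) (h0 : x 0 = y 0) :
    x = y :=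
  ODE_solution_unique_univ (v := fun _ => G) (s := fun _ => Set.univ) (K := K)
    (fun _ => hG.lipschitzOnWith) (fun t => ⟨hx t, trivial⟩) (fun t => ⟨hy t, trivial⟩) h0

/-- For a bounded field, Picard–Lindelöf applies on `[-T, T]` for every `T`, with a ball of radius
`L * T`. Local solutions agree by uniqueness and are glued. -/
lemma exists_global_solution [CompleteSpace E] {G : E → E} {K L : NNReal} (hG : LipschitzWith K G)
    (hL : ∀ x, ‖G x‖ ≤ L) (x₀ : E) : ∃ x : ℝ → E, x 0 = x₀ ∧ ∀ t, HasDerivAt x (G (x t)) t := by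
  have hloc : ∀ T : NNReal, ∃ x : ℝ → E, x 0 = x₀ ∧
      ∀ t ∈ Set.Ioo (-(T : ℝ)) T, HasDerivAt x (G (x t)) t := by
    intro T
    have hP : IsPicardLindelof (fun _ : ℝ => G) (tmin := -T) (tmax := T)
        ⟨0, by simp⟩ x₀ (L * T) 0 L K :=
      { lipschitzOnWith := fun _ _ => hG.lipschitzOnWith
        continuousOn := fun _ _ => continuousOn_const
        norm_le := fun _ _ x _ => hL x
        mul_max_le := by simp }
    obtain ⟨x, h0, hx⟩ := hP.exists_eq_forall_mem_Icc_hasDerivWithinAt₀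
    exact ⟨x, h0, fun t ht => (hx t (Set.Ioo_subset_Icc_self ht)).hasDerivAt
      (Icc_mem_nhds ht.1 ht.2)⟩
  choose x h0 hx using hloc
  have huniq : ∀ S T : NNReal, S ≤ T → ∀ t ∈ Set.Ioo (-(S : ℝ)) S, x S t = x T t := by
    intro S T hST t ht
    have hS : (0 : ℝ) ∈ Set.Ioo (-(S : ℝ)) S := by
      have : 0 < (S : ℝ) := by linarith [ht.1, ht.2]
      simp [this]
    have hST' : (S : ℝ) ≤ T := by exact_mod_cast hST
    exact ODE_solution_unique_of_mem_Ioo (v := fun _ => G) (s := fun _ => Set.univ) (K := K)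
      (fun _ _ => hG.lipschitzOnWith) hS (fun t ht => ⟨hx S t ht, trivial⟩)
      (fun t ht => ⟨hx T t ⟨by linarith [ht.1], by linarith [ht.2]⟩, trivial⟩)
      ((h0 S).trans (h0 T).symm) ht
  -- At time `t` the solution on the interval of radius `|t| + 1` is used. Near a fixed `t` all of
  -- these coincide with the one of radius `|t| + 2`.
  refine ⟨fun t => x (‖t‖₊ + 1) t, h0 _, fun t => ?_⟩
  have hmem : ∀ τ : ℝ, ∀ c : ℝ, 0 < c → τ ∈ Set.Ioo (-(|τ| + c)) (|τ| + c) := fun τ c hc =>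
    ⟨by linarith [neg_abs_le τ], by linarith [le_abs_self τ]⟩
  have hx2 : HasDerivAt (x (‖t‖₊ + 2)) (G (x (‖t‖₊ + 2) t)) t := by
    refine hx (‖t‖₊ + 2) t ?_
    push_cast
    exact hmem t 2 two_pos
  have e : ∀ τ : ℝ, |τ| < |t| + 1 → x (‖τ‖₊ + 1) τ = x (‖t‖₊ + 2) τ := by
    intro τ hτ
    refine huniq _ _ ?_ τ ?_
    · rw [← NNReal.coe_le_coe]
      push_cast
      rw [Real.norm_eq_abs, Real.norm_eq_abs]
      linarith
    · push_cast
      exact hmem τ 1 one_pos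
  beta_reduce
  rw [e t (by linarith)]
  refine hx2.congr_of_eventuallyEq ?_
  filter_upwards [(isOpen_lt continuous_abs continuous_const).mem_nhds
    (show |t| < |t| + 1 by linarith)] with τ hτ
  exact e τ hτ

end ode

/-! ### Low frequencies -/

/-- The extension by zero of coefficients at the frequencies in `B`. -/
def extend (B : Finset Freq) (a : B → ℂ) (n : Freq) : ℂ := if h : n ∈ B then a ⟨n, h⟩ else 0

lemma contDiff_extend (B : Finset Freq) (n : Freq) : ContDiff ℝ 1 fun a : B → ℂ => extend B a n := by
  unfold extend
  split_ifs <;> fun_prop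

/-- The coefficients of the states of the truncated equation. -/
abbrev LowState (B : Finset Freq) : Type := (B → ℂ) × (B → ℂ)

/-- The right-hand side of the truncated equation. -/
def lowField (B : Finset Freq) (x : LowState B) : LowState B :=
  (x.2, fun n => -(bracket n : ℂ) ^ 2 * x.1 n - cubeCoeff B (extend B x.1) n)

/-- The quadratic part of the energy of a state. -/
def lowEnergy (B : Finset Freq) (x : LowState B) : ℝ :=
  quadEnergy B (extend B x.1) (extend B x.2)

/-- The right-hand side of the truncated equation, multiplied by a cutoff function of the energy. -/
def cutField (B : Finset Freq) (R : ℝ) (x : LowState B) : LowState B :=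
  Real.smoothTransition (2 - lowEnergy B x / R) • lowField B x

lemma contDiff_lowEnergy (B : Finset Freq) : ContDiff ℝ 1 (lowEnergy B) := by
  unfold lowEnergy quadEnergy
  have h1 : ∀ n, ContDiff ℝ 1 fun x : LowState B => extend B x.1 n := fun n =>
    (contDiff_extend B n).comp contDiff_fst
  have h2 : ∀ n, ContDiff ℝ 1 fun x : LowState B => extend B x.2 n := fun n =>
    (contDiff_extend B n).comp contDiff_snd
  exact ContDiff.sum fun n _ => (contDiff_const.mul ((h1 n).norm_sq ℝ)).add ((h2 n).norm_sq ℝ)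

lemma contDiff_lowField (B : Finset Freq) : ContDiff ℝ 1 (lowField B) := by
  have h1 : ∀ n, ContDiff ℝ 1 fun x : LowState B => extend B x.1 n := fun n =>
    (contDiff_extend B n).comp contDiff_fst
  unfold lowField cubeCoeff
  refine ContDiff.prodMk contDiff_snd (contDiff_pi.2 fun n => ContDiff.sub (by fun_prop) ?_)
  refine ContDiff.sum fun i _ => ContDiff.sum fun j _ => ContDiff.sum fun k _ => ?_
  split_ifs
  · exact ((h1 i).mul (h1 j)).mul (h1 k)
  · exact contDiff_const

lemma contDiff_cutField (B : Finset Freq) (R : ℝ) : ContDiff ℝ 1 (cutField B R) :=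
  ContDiff.smul (Real.smoothTransition.contDiff.comp
    (contDiff_const.sub ((contDiff_lowEnergy B).div_const R))) (contDiff_lowField B)

lemma norm_sq_le_lowEnergy (B : Finset Freq) (x : LowState B) : ‖x‖ ^ 2 ≤ lowEnergy B x := by
  have hE : 0 ≤ lowEnergy B x := by unfold lowEnergy quadEnergy; positivity
  have key : ∀ n : B, ‖x.1 n‖ ^ 2 ≤ lowEnergy B x ∧ ‖x.2 n‖ ^ 2 ≤ lowEnergy B x := by
    intro n
    have h := Finset.single_le_sum (f := fun n => bracket n ^ 2 * ‖extend B x.1 n‖ ^ 2 +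
      ‖extend B x.2 n‖ ^ 2) (fun m _ => by positivity) n.2
    have e1 : extend B x.1 n = x.1 n := by simp [extend]
    have e2 : extend B x.2 n = x.2 n := by simp [extend]
    simp only [e1, e2] at h
    have hb : 1 ≤ bracket n ^ 2 := one_le_pow₀ (one_le_bracket n)
    unfold lowEnergy quadEnergy
    have := sq_nonneg ‖x.1 n‖
    have := sq_nonneg ‖x.2 n‖
    constructor <;> nlinarith
  have h : ‖x‖ ≤ √(lowEnergy B x) := by
    refine max_le ?_ ?_
    · exact (pi_norm_le_iff_of_nonneg (Real.sqrt_nonneg _)).2 fun n =>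
        Real.le_sqrt_of_sq_le (key n).1
    · exact (pi_norm_le_iff_of_nonneg (Real.sqrt_nonneg _)).2 fun n =>
        Real.le_sqrt_of_sq_le (key n).2
  calc ‖x‖ ^ 2 ≤ √(lowEnergy B x) ^ 2 := by gcongr
    _ = _ := Real.sq_sqrt hE

lemma hasCompactSupport_cutField (B : Finset Freq) {R : ℝ} (hR : 0 < R) :
    HasCompactSupport (cutField B R) := by
  refine HasCompactSupport.of_support_subset_isCompact
    (isCompact_closedBall (0 : LowState B) (√(2 * R))) fun x hx => ?_
  rw [mem_closedBall_zero_iff]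
  refine Real.le_sqrt_of_sq_le ((norm_sq_le_lowEnergy B x).trans ?_)
  by_contra hcon
  push Not at hcon
  refine hx ?_
  unfold cutField
  rw [Real.smoothTransition.zero_of_nonpos, zero_smul]
  rw [sub_nonpos, le_div_iff₀ hR]
  exact hcon.le

lemma cutField_eq {B : Finset Freq} {R : ℝ} (hR : 0 < R) {x : LowState B} (hx : lowEnergy B x ≤ R) :
    cutField B R x = lowField B x := by
  unfold cutField
  rw [Real.smoothTransition.one_of_one_le, one_smul]
  have : lowEnergy B x / R ≤ 1 := (div_le_one hR).2 hx
  linarith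

lemma exists_lipschitz_cutField (B : Finset Freq) {R : ℝ} (hR : 0 < R) :
    (∃ K, LipschitzWith K (cutField B R)) ∧ ∃ L : NNReal, ∀ x, ‖cutField B R x‖ ≤ L := by
  refine ⟨ContDiff.lipschitzWith_of_hasCompactSupport (hasCompactSupport_cutField B hR)
    (contDiff_cutField B R) one_ne_zero, ?_⟩
  obtain ⟨C, hC⟩ := (hasCompactSupport_cutField B hR).exists_bound_of_continuous
    (contDiff_cutField B R).continuous
  exact ⟨C.toNNReal, fun x => (hC x).trans (Real.le_coe_toNNReal C)⟩

/-! ### Symmetry under conjugation. -/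

/-- The complex conjugation of the functions with given coefficients. -/
def reflect {B : Finset Freq} (hB : ∀ n ∈ B, -n ∈ B) : (B → ℂ) →L[ℝ] (B → ℂ) :=
  ContinuousLinearMap.pi fun n =>
    (Complex.conjCLE : ℂ →L[ℝ] ℂ) ∘L ContinuousLinearMap.proj (⟨-n, hB n n.2⟩ : B)

lemma reflect_apply {B : Finset Freq} (hB : ∀ n ∈ B, -n ∈ B) (a : B → ℂ) (n : B) :
    reflect hB a n = (starRingEnd ℂ) (a ⟨-n, hB n n.2⟩) := rfl

lemma extend_reflect {B : Finset Freq} (hB : ∀ n ∈ B, -n ∈ B) (a : B → ℂ) (n : Freq) :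
    extend B (reflect hB a) n = (starRingEnd ℂ) (extend B a (-n)) := by
  unfold extend
  by_cases h : n ∈ B
  · rw [dif_pos h, dif_pos (hB n h), reflect_apply]
  · have : -n ∉ B := fun h' => h (by simpa using hB _ h')
    rw [dif_neg h, dif_neg this, map_zero]

lemma lowEnergy_reflect {B : Finset Freq} (hB : ∀ n ∈ B, -n ∈ B) (x : LowState B) :
    lowEnergy B (reflect hB x.1, reflect hB x.2) = lowEnergy B x := by
  unfold lowEnergy quadEnergy
  simp only [extend_reflect, RCLike.norm_conj]
  rw [← sum_neg_eq hB]
  simp only [neg_neg, bracket_neg]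

lemma cubeCoeff_conj {B : Finset Freq} (hB : ∀ n ∈ B, -n ∈ B) (a : Freq → ℂ) (n : Freq) :
    cubeCoeff B (fun m => (starRingEnd ℂ) (a (-m))) n = (starRingEnd ℂ) (cubeCoeff B a (-n)) := by
  unfold cubeCoeff
  simp only [map_sum]
  rw [← sum_neg_eq hB]
  refine Finset.sum_congr rfl fun i _ => ?_
  rw [← sum_neg_eq hB]
  refine Finset.sum_congr rfl fun j _ => ?_
  rw [← sum_neg_eq hB]
  refine Finset.sum_congr rfl fun k _ => ?_
  have : (-i + -j + -k = n) = (i + j + k = -n) := by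
    rw [← neg_add, ← neg_add, neg_eq_iff_eq_neg]
  simp only [this, neg_neg]
  split_ifs <;> simp

lemma lowField_reflect {B : Finset Freq} (hB : ∀ n ∈ B, -n ∈ B) (x : LowState B) :
    lowField B (reflect hB x.1, reflect hB x.2) =
      (reflect hB (lowField B x).1, reflect hB (lowField B x).2) := by
  unfold lowField
  refine Prod.ext rfl (funext fun n => ?_)
  simp only [reflect_apply]
  rw [show extend B (reflect hB x.1) = fun m => (starRingEnd ℂ) (extend B x.1 (-m)) from
    funext fun m => extend_reflect hB x.1 m, cubeCoeff_conj hB]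
  simp [bracket_neg]

/-- The field commutes with conjugation, so by uniqueness a solution with real initial datum stays
real. -/
lemma cutField_reflect {B : Finset Freq} (hB : ∀ n ∈ B, -n ∈ B) (R : ℝ) (x : LowState B) :
    cutField B R (reflect hB x.1, reflect hB x.2) =
      (reflect hB (cutField B R x).1, reflect hB (cutField B R x).2) := by
  unfold cutField
  rw [lowEnergy_reflect, lowField_reflect]
  simp only [Prod.smul_mk, Prod.smul_fst, Prod.smul_snd, map_smul]

/-! ### Conservation of energy -/

/-- The truncated energy as a function of the Fourier coefficients. -/
def hamiltonian (B : Finset Freq) (a b : Freq → ℂ) : ℂ :=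
  1 / 2 * (pairing B (fun n => (bracket n : ℂ) ^ 1 * a n) (fun n => (bracket n : ℂ) ^ 1 * a n) +
    pairing B b b) + 1 / 4 * quad B (fun i j k l => a i * (a j * a k * a l))

/-- The scalar `θ` covers the cut-off field: multiplying a Hamiltonian field by a scalar function
does not leave the level sets of the energy. -/
lemma hasDerivAt_hamiltonian {B : Finset Freq} (hB : ∀ n ∈ B, -n ∈ B) {a b : ℝ → Freq → ℂ}
    {a' b' : Freq → ℂ} {t : ℝ} (ha : ∀ n, HasDerivAt (fun τ => a τ n) (a' n) t)
    (hb : ∀ n, HasDerivAt (fun τ => b τ n) (b' n) t) (θ : ℂ) (ha' : ∀ n ∈ B, a' n = θ * b t n)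
    (hb' : ∀ n ∈ B, b' n = θ * (-(bracket n : ℂ) ^ 2 * a t n - cubeCoeff B (a t) n)) :
    HasDerivAt (fun τ => hamiltonian B (a τ) (b τ)) 0 t := by
  have h1 : ∀ n, HasDerivAt (fun τ => (bracket n : ℂ) ^ 1 * a τ n) ((bracket n : ℂ) ^ 1 * a' n) t :=
    fun n => (ha n).const_mul _
  have h2 := hasDerivAt_quad (B := B) fun i j k l =>
      (ha i).mul ((((ha j)).mul (ha k)).mul (ha l))
  have e := (((hasDerivAt_pairing (B := B) h1 h1).add (hasDerivAt_pairing (B := B) hb hb)).const_mul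
    (1 / 2 : ℂ)).add (h2.const_mul (1 / 4 : ℂ))
  convert! e using 1
  have p1 : pairing B (fun n => (bracket n : ℂ) ^ 1 * a' n) (fun n => (bracket n : ℂ) ^ 1 * a t n) =
      θ * ∑ n ∈ B, (bracket n : ℂ) ^ 2 * b t n * a t (-n) := by
    rw [pairing_eq hB, Finset.mul_sum]
    refine Finset.sum_congr rfl fun n hn => ?_
    rw [ha' n hn, bracket_neg]
    ring
  have p2 : pairing B b' (b t) = -(θ * ∑ n ∈ B, (bracket n : ℂ) ^ 2 * b t n * a t (-n)) -
      θ * quad B fun i j k l => a t i * a t j * a t k * b t l := by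
    rw [← pairing_cubeCoeff hB, ← sum_neg_eq hB, pairing_eq hB, pairing_eq hB, Finset.mul_sum,
      Finset.mul_sum, ← Finset.sum_neg_distrib, ← Finset.sum_sub_distrib]
    refine Finset.sum_congr rfl fun n hn => ?_
    rw [hb' n hn, bracket_neg, neg_neg]
    ring
  set f : Freq → Freq → Freq → Freq → ℂ := fun i j k l => a t i * a t j * a t k * a' l with hf
  have f2 := quad_swap34 (B := B) f
  have f3 := quad_swap24 (B := B) f
  have f4 := (quad_swap12 (B := B) fun i j k l => f i l k j).trans f3
  have hfb : quad B f = θ * quad B fun i j k l => a t i * a t j * a t k * b t l := by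
    rw [← quad_const_mul]
    refine quad_congr fun i _ j _ k _ l hl _ => ?_
    simp only [hf]
    rw [ha' l hl]
    ring
  have p3 : quad B (fun i j k l => a' i * (a t j * a t k * a t l) + a t i *
      ((a' j * a t k + a t j * a' k) * a t l + a t j * a t k * a' l)) = 4 * quad B f := by
    have : 4 * quad B f = quad B f + quad B f + quad B f + quad B f := by ring
    rw [this]
    nth_rw 1 [← f2]
    nth_rw 1 [← f3]
    nth_rw 1 [← f4]
    rw [← quad_add, ← quad_add, ← quad_add]
    refine quad_congr fun i _ j _ k _ l _ _ => ?_
    simp only [hf]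
    ring
  simp only [Pi.mul_apply]
  rw [p3, hfb, pairing_comm B (fun n => (bracket n : ℂ) ^ 1 * a t n),
    pairing_comm B (b t) b', p1, p2]
  ring

/-- Coercivity of the defocusing energy. For real data the quartic sum is the integral of a fourth
power, hence nonnegative. -/
lemma quadEnergy_le_hamiltonian {B : Finset Freq} (hB : ∀ n ∈ B, -n ∈ B) {a b : Freq → ℂ}
    (ha : ∀ n, a (-n) = (starRingEnd ℂ) (a n)) (hb : ∀ n, b (-n) = (starRingEnd ℂ) (b n)) :
    quadEnergy B a b ≤ 2 * (hamiltonian B a b).re := by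
  have h4 : quad B (fun i j k l => a i * (a j * a k * a l)) =
      ((∫ x, (trig B a x).re ^ 4 ∂haar : ℝ) : ℂ) := by
    rw [← integral_trig_prod]
    refine (ofReal_integral_of_ae (F := trig B a * (trig B a * trig B a * trig B a))
      (ae_of_all _ fun x => ?_)).symm
    push_cast
    rw [ofReal_re_trig hB ha]
    simp only [Pi.mul_apply]
    ring
  have h0 : 0 ≤ ∫ x, (trig B a x).re ^ 4 ∂haar := integral_nonneg fun x => by positivity
  unfold hamiltonian
  rw [h4, pairing_self hB hb, pairing_self hB fun n => by
    rw [ha, bracket_neg, map_mul, map_pow, Complex.conj_ofReal]]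
  have e : quadEnergy B a b = ∑ n ∈ B, ‖(bracket n : ℂ) ^ 1 * a n‖ ^ 2 + ∑ n ∈ B, ‖b n‖ ^ 2 := by
    unfold quadEnergy
    rw [Finset.sum_add_distrib]
    congr 1
    refine Finset.sum_congr rfl fun n _ => ?_
    rw [pow_one, norm_mul, Complex.norm_real, Real.norm_eq_abs, mul_pow, sq_abs]
  rw [e]
  generalize ∑ n ∈ B, ‖(bracket n : ℂ) ^ 1 * a n‖ ^ 2 = X
  generalize ∑ n ∈ B, ‖b n‖ ^ 2 = Y
  generalize ∫ x, (trig B a x).re ^ 4 ∂haar = Z at *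
  have : (1 / 2 * ((X : ℂ) + (Y : ℂ)) + 1 / 4 * (Z : ℂ)) =
      ((1 / 2 * (X + Y) + 1 / 4 * Z : ℝ) : ℂ) := by push_cast; ring
  rw [this, Complex.ofReal_re]
  linarith

lemma hasDerivAt_extend {B : Finset Freq} {a : ℝ → B → ℂ} {a' : B → ℂ} {t : ℝ}
    (h : HasDerivAt a a' t) (n : Freq) :
    HasDerivAt (fun τ => extend B (a τ) n) (extend B a' n) t := by
  unfold extend
  split_ifs
  · exact (hasDerivAt_pi.1 h) _
  · exact hasDerivAt_const t 0

/-- A state which consists of the coefficients of real functions. -/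
def IsReal {B : Finset Freq} (hB : ∀ n ∈ B, -n ∈ B) (x : LowState B) : Prop :=
  (reflect hB x.1, reflect hB x.2) = x

lemma IsReal.extend_neg {B : Finset Freq} {hB : ∀ n ∈ B, -n ∈ B} {x : LowState B}
    (h : IsReal hB x) (n : Freq) :
    extend B x.1 (-n) = (starRingEnd ℂ) (extend B x.1 n) ∧
      extend B x.2 (-n) = (starRingEnd ℂ) (extend B x.2 n) := by
  have h1 := congrArg Prod.fst h
  have h2 := congrArg Prod.snd h
  simp only at h1 h2
  constructor
  · conv_rhs => rw [← h1, extend_reflect, Complex.conj_conj]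
  · conv_rhs => rw [← h2, extend_reflect, Complex.conj_conj]

/-- The energy of a state. -/
def lowHamiltonian (B : Finset Freq) (x : LowState B) : ℂ :=
  hamiltonian B (extend B x.1) (extend B x.2)

lemma lowEnergy_le {B : Finset Freq} {hB : ∀ n ∈ B, -n ∈ B} {x : LowState B} (h : IsReal hB x) :
    lowEnergy B x ≤ 2 * (lowHamiltonian B x).re :=
  quadEnergy_le_hamiltonian hB (fun n => (h.extend_neg n).1) fun n => (h.extend_neg n).2

lemma lowHamiltonian_eq {B : Finset Freq} (hB : ∀ n ∈ B, -n ∈ B) {x : ℝ → LowState B} {θ : ℝ → ℝ}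
    (hx : ∀ t, HasDerivAt x (θ t • lowField B (x t)) t) (t : ℝ) :
    lowHamiltonian B (x t) = lowHamiltonian B (x 0) := by
  have hd : ∀ t, HasDerivAt (fun τ => lowHamiltonian B (x τ)) 0 t := by
    intro t
    have h1 : HasDerivAt (fun τ => (x τ).1) (θ t • lowField B (x t)).1 t :=
      (ContinuousLinearMap.fst ℝ (B → ℂ) (B → ℂ)).hasFDerivAt.comp_hasDerivAt t (hx t)
    have h2 : HasDerivAt (fun τ => (x τ).2) (θ t • lowField B (x t)).2 t :=
      (ContinuousLinearMap.snd ℝ (B → ℂ) (B → ℂ)).hasFDerivAt.comp_hasDerivAt t (hx t)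
    refine hasDerivAt_hamiltonian hB (hasDerivAt_extend h1) (hasDerivAt_extend h2) (θ t)
      (fun n hn => ?_) (fun n hn => ?_)
    · simp [extend, hn, lowField]
    · simp [extend, hn, lowField]
  exact is_const_of_deriv_eq_zero (fun t => (hd t).differentiableAt) (fun t => (hd t).deriv) t 0

/-- The low frequencies of solutions are determined by the initial datum. -/
lemma lowState_unique {B : Finset Freq} {hB : ∀ n ∈ B, -n ∈ B} {x y : ℝ → LowState B}
    (hx : ∀ t, HasDerivAt x (lowField B (x t)) t) (hy : ∀ t, HasDerivAt y (lowField B (y t)) t)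
    (hxr : ∀ t, IsReal hB (x t)) (hyr : ∀ t, IsReal hB (y t)) (h0 : x 0 = y 0) : x = y := by
  set R := |2 * (lowHamiltonian B (x 0)).re| + 1 with hR
  have hR0 : 0 < R := by positivity
  -- Conservation and coercivity keep the energy below `R`, so both solutions also solve the cut-off
  -- equation, whose field is globally Lipschitz.
  have key : ∀ z : ℝ → LowState B, (∀ t, HasDerivAt z (lowField B (z t)) t) →
      (∀ t, IsReal hB (z t)) → z 0 = x 0 → ∀ t, HasDerivAt z (cutField B R (z t)) t := by
    intro z hz hzr hz0 t
    rw [cutField_eq hR0]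
    · exact hz t
    · refine (lowEnergy_le (hzr t)).trans ?_
      rw [lowHamiltonian_eq hB (θ := fun _ => 1) (by simpa using hz), hz0, hR]
      linarith [le_abs_self (2 * (lowHamiltonian B (x 0)).re)]
  obtain ⟨K, hK⟩ := (exists_lipschitz_cutField B hR0).1
  exact eq_of_hasDerivAt hK (key x hx hxr rfl) (key y hy hyr h0.symm) h0

/-- The low frequencies of solutions exist globally. -/
lemma exists_lowState {B : Finset Freq} {hB : ∀ n ∈ B, -n ∈ B} {x₀ : LowState B}
    (h0 : IsReal hB x₀) : ∃ x : ℝ → LowState B, x 0 = x₀ ∧ (∀ t, IsReal hB (x t)) ∧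
      (∀ t, HasDerivAt x (lowField B (x t)) t) ∧ ∃ R, ∀ t, lowEnergy B (x t) ≤ R := by
  set R := |2 * (lowHamiltonian B x₀).re| + 1 with hR
  have hR0 : 0 < R := by positivity
  obtain ⟨⟨K, hK⟩, L, hL⟩ := exists_lipschitz_cutField B hR0
  obtain ⟨x, hx0, hx⟩ := exists_global_solution hK hL x₀
  have hreal : ∀ t, IsReal hB (x t) := by
    intro t
    have h1 : ∀ t, HasDerivAt (fun τ => (reflect hB (x τ).1, reflect hB (x τ).2))
        (cutField B R (reflect hB (x t).1, reflect hB (x t).2)) t := by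
      intro t
      rw [cutField_reflect]
      exact HasDerivAt.prodMk
        ((reflect hB).hasFDerivAt.comp_hasDerivAt t ((ContinuousLinearMap.fst ℝ (B → ℂ) (B → ℂ)).hasFDerivAt.comp_hasDerivAt t (hx t)))
        ((reflect hB).hasFDerivAt.comp_hasDerivAt t ((ContinuousLinearMap.snd ℝ (B → ℂ) (B → ℂ)).hasFDerivAt.comp_hasDerivAt t (hx t)))
    have h2 := eq_of_hasDerivAt hK h1 hx (by rw [hx0]; exact h0)
    exact congrFun h2 t
  -- The Hamiltonian is conserved by the cut-off equation as well, so the cutoff is never active.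
  have hE : ∀ t, lowEnergy B (x t) ≤ R := by
    intro t
    refine (lowEnergy_le (hreal t)).trans ?_
    rw [lowHamiltonian_eq hB (θ := fun t => Real.smoothTransition (2 - lowEnergy B (x t) / R)) hx,
      hx0, hR]
    linarith [le_abs_self (2 * (lowHamiltonian B x₀).re)]
  exact ⟨x, hx0, hreal, fun t => cutField_eq hR0 (hE t) ▸ hx t, R, hE⟩

/-! ### Global well-posedness -/

lemma cubeCoeff_congr {B : Finset Freq} {a a' : Freq → ℂ} (h : ∀ n ∈ B, a n = a' n) (n : Freq) :
    cubeCoeff B a n = cubeCoeff B a' n :=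
  Finset.sum_congr rfl fun i hi => Finset.sum_congr rfl fun j hj =>
    Finset.sum_congr rfl fun k hk => by rw [h i hi, h j hj, h k hk]

lemma ofReal_bracket_sq (n : Freq) : (bracket n : ℂ) ^ 2 = 1 + absSq n := by
  rw [← Complex.ofReal_pow, bracket_sq]
  push_cast
  rfl

lemma norm_sub_sq_le (x y : ℂ) : ‖x - y‖ ^ 2 ≤ 2 * (‖x‖ ^ 2 + ‖y‖ ^ 2) := by
  have := norm_sub_le x y
  have h0 := norm_nonneg (x - y)
  nlinarith [sq_nonneg (‖x‖ - ‖y‖)]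

/-- Dominated convergence: a summable bound independent of time upgrades continuity of each
coefficient to continuity in the weighted norm. -/
lemma tendsto_tsum_weight_normSq_sub {w M : Freq → ℝ} (hw : ∀ n, 0 ≤ w n) (hM : Summable M)
    {a : ℝ → Freq → ℂ} (ha : ∀ n, Continuous fun t => a t n)
    (hb : ∀ t n, w n * ‖a t n‖ ^ 2 ≤ M n) (t₀ : ℝ) :
    Tendsto (fun t => ∑' n, w n * ‖a t n - a t₀ n‖ ^ 2) (𝓝 t₀) (𝓝 0) := by
  have h := tendsto_tsum_of_dominated_convergence (𝓕 := 𝓝 t₀)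
    (f := fun t n => w n * ‖a t n - a t₀ n‖ ^ 2) (g := fun _ => 0) (bound := fun n => 4 * M n)
    (hM.mul_left 4) (fun n => ?_) (Eventually.of_forall fun t n => ?_)
  · simpa using h
  · have : Continuous fun t => w n * ‖a t n - a t₀ n‖ ^ 2 := by
      have := ha n
      fun_prop
    simpa using this.tendsto t₀
  · have h1 := mul_le_mul_of_nonneg_left (norm_sub_sq_le (a t n) (a t₀ n)) (hw n)
    have := hw n
    rw [Real.norm_eq_abs, abs_of_nonneg (by positivity)]
    linarith [hb t n, hb t₀ n]

/-- Families of Fourier coefficients which solve the equation yield solutions. -/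
lemma isSolution_series {N : ℕ} {a b : ℝ → Freq → ℂ} {M : Freq → ℝ} (hM : Summable M)
    (hbd : ∀ t n, bracket n ^ 2 * ‖a t n‖ ^ 2 + ‖b t n‖ ^ 2 ≤ M n)
    (har : ∀ t n, a t (-n) = (starRingEnd ℂ) (a t n))
    (hbr : ∀ t n, b t (-n) = (starRingEnd ℂ) (b t n))
    (ha : ∀ n t, HasDerivAt (fun τ => a τ n) (b t n) t)
    (hb : ∀ n t, HasDerivAt (fun τ => b τ n)
      (-(absSq n : ℂ) * a t n - a t n - if n ∈ ball N then cubeCoeff (ball N) (a t) n else 0) t) :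
    (∀ t n, coeff (series (a t)) n = a t n ∧ coeff (series (b t)) n = b t n) ∧
      IsSolution N fun t => (series (a t), series (b t)) := by
  have hbd1 : ∀ t n, bracket n ^ 2 * ‖a t n‖ ^ 2 ≤ M n := fun t n => by
    have := sq_nonneg ‖b t n‖
    linarith [hbd t n]
  have hbd2 : ∀ t n, ‖b t n‖ ^ 2 ≤ M n := fun t n => by
    have : 0 ≤ bracket n ^ 2 * ‖a t n‖ ^ 2 := by positivity
    linarith [hbd t n]
  have hsa1 : ∀ t, Summable fun n => bracket n ^ 2 * ‖a t n‖ ^ 2 := fun t =>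
    Summable.of_nonneg_of_le (fun n => by positivity) (hbd1 t) hM
  have hsa : ∀ t, Summable fun n => ‖a t n‖ ^ 2 := fun t =>
    Summable.of_nonneg_of_le (fun n => by positivity) (fun n => by
      have := one_le_pow₀ (one_le_bracket n) (n := 2)
      have := sq_nonneg ‖a t n‖
      nlinarith) (hsa1 t)
  have hsb : ∀ t, Summable fun n => ‖b t n‖ ^ 2 := fun t =>
    Summable.of_nonneg_of_le (fun n => by positivity) (hbd2 t) hM
  have ca : ∀ t n, coeff (series (a t)) n = a t n := fun t n => coeff_series (har t) (hsa t) n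
  have cb : ∀ t n, coeff (series (b t)) n = b t n := fun t n => coeff_series (hbr t) (hsb t) n
  refine ⟨fun t n => ⟨ca t n, cb t n⟩, ?_, ?_, ?_, ?_, ?_⟩
  · intro t
    unfold MemH1
    simpa only [ca] using hsa1 t
  · intro t₀
    unfold h1NormSq
    simp only [coeff_sub, ca]
    exact tendsto_tsum_weight_normSq_sub (fun n => by positivity) hM
      (fun n => continuous_iff_continuousAt.2 fun t => (ha n t).continuousAt) hbd1 t₀
  · rw [continuous_iff_continuousAt]
    intro t₀
    have h := tendsto_tsum_weight_normSq_sub (w := fun _ => 1) (fun _ => zero_le_one) hM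
      (fun n => continuous_iff_continuousAt.2 fun t => (hb n t).continuousAt)
      (fun t n => by simpa using hbd2 t n) t₀
    have e : ∀ t, ∑' n, 1 * ‖b t n - b t₀ n‖ ^ 2 = ‖series (b t) - series (b t₀)‖ ^ 2 := by
      intro t
      rw [← (hasSum_normSq_coeff (series (b t) - series (b t₀))).tsum_eq]
      simp only [coeff_sub, cb, one_mul]
    simp only [e] at h
    rw [ContinuousAt, tendsto_iff_norm_sub_tendsto_zero]
    have h2 := h.sqrt
    simpa [Real.sqrt_sq (norm_nonneg _)] using h2
  · intro n t
    simpa only [ca, cb] using ha n t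
  · intro n t
    simp only [ca, cb, coeff_proj_pow]
    rw [cubeCoeff_congr (a' := a t) fun m _ => ca t m]
    exact hb n t

/-! ### Uniqueness and existence of solutions. -/

/-- The restriction of the Fourier coefficients to `B`. -/
def lowPart (B : Finset Freq) (w : L2 × L2) : LowState B :=
  (fun n => coeff w.1 n, fun n => coeff w.2 n)

lemma extend_lowPart {B : Finset Freq} (w : L2 × L2) {n : Freq} (hn : n ∈ B) :
    extend B (lowPart B w).1 n = coeff w.1 n ∧ extend B (lowPart B w).2 n = coeff w.2 n := by
  simp [extend, lowPart, hn]

lemma isReal_lowPart {B : Finset Freq} (hB : ∀ n ∈ B, -n ∈ B) (w : L2 × L2) :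
    IsReal hB (lowPart B w) := by
  refine Prod.ext (funext fun n => ?_) (funext fun n => ?_)
  · simp only [reflect_apply, lowPart, coeff_neg, Complex.conj_conj]
  · simp only [reflect_apply, lowPart, coeff_neg, Complex.conj_conj]

lemma hasDerivAt_lowPart {N : ℕ} {W : ℝ → L2 × L2} (h : IsSolution N W) (t : ℝ) :
    HasDerivAt (fun τ => lowPart (ball N) (W τ)) (lowField (ball N) (lowPart (ball N) (W t))) t := by
  refine HasDerivAt.prodMk (hasDerivAt_pi.2 fun n => h.eq_fst n t)
    (hasDerivAt_pi.2 fun n => ?_)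
  have h2 := h.eq_snd n t
  rw [if_pos n.2, coeff_proj_pow] at h2
  convert! h2 using 1
  rw [cubeCoeff_congr (a' := coeff (W t).1) fun m hm => (extend_lowPart (W t) hm).1,
    ofReal_bracket_sq]
  simp only [lowPart]
  ring

/-- The oscillator energy `k²|d|² + |e|²` is conserved. With `k = ⟨n⟩` this gives uniqueness at
frequencies outside the ball, where the equation is linear. -/
lemma eq_zero_of_oscillator {k : ℝ} {d e : ℝ → ℂ} (hd : ∀ t, HasDerivAt d (e t) t)
    (he : ∀ t, HasDerivAt e (-(k : ℂ) ^ 2 * d t) t) (hd0 : d 0 = 0) (he0 : e 0 = 0) (hk : k ≠ 0)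
    (t : ℝ) : d t = 0 ∧ e t = 0 := by
  have h : ∀ t, HasDerivAt (fun τ => k ^ 2 * ‖d τ‖ ^ 2 + ‖e τ‖ ^ 2) 0 t := by
    intro t
    convert! ((hd t).norm_sq.const_mul (k ^ 2)).add (he t).norm_sq using 1
    have : -(k : ℂ) ^ 2 * d t = (-k ^ 2 : ℝ) • d t := by
      rw [Complex.real_smul]
      push_cast
      ring
    rw [this, inner_smul_right, real_inner_comm]
    ring
  have h2 := is_const_of_deriv_eq_zero (fun t => (h t).differentiableAt) (fun t => (h t).deriv) t 0
  simp only [hd0, he0, norm_zero] at h2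
  have h3 : 0 ≤ k ^ 2 * ‖d t‖ ^ 2 := by positivity
  have h4 : 0 ≤ ‖e t‖ ^ 2 := by positivity
  have h5 : k ^ 2 * ‖d t‖ ^ 2 = 0 := by linarith
  have h6 : ‖e t‖ ^ 2 = 0 := by linarith
  constructor
  · simpa [hk] using h5
  · simpa using h6

lemma isSolution_unique {N : ℕ} {W W' : ℝ → L2 × L2} (h : IsSolution N W) (h' : IsSolution N W')
    (h0 : W 0 = W' 0) : W = W' := by
  have hlow := lowState_unique (hB := neg_mem_ball (N := N)) (hasDerivAt_lowPart h)
    (hasDerivAt_lowPart h') (fun t => isReal_lowPart _ _) (fun t => isReal_lowPart _ _) (by rw [h0])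
  have key : ∀ t n, coeff (W t).1 n = coeff (W' t).1 n ∧ coeff (W t).2 n = coeff (W' t).2 n := by
    intro t n
    by_cases hn : n ∈ ball N
    · have e := congrFun hlow t
      rw [← (extend_lowPart (W t) hn).1, ← (extend_lowPart (W t) hn).2,
        ← (extend_lowPart (W' t) hn).1, ← (extend_lowPart (W' t) hn).2, e]
      exact ⟨rfl, rfl⟩
    · have := eq_zero_of_oscillator (k := bracket n)
        (d := fun t => coeff (W t).1 n - coeff (W' t).1 n)
        (e := fun t => coeff (W t).2 n - coeff (W' t).2 n)
        (fun t => (h.eq_fst n t).sub (h'.eq_fst n t)) (fun t => ?_) (by simp [h0]) (by simp [h0])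
        (bracket_pos n).ne' t
      · exact ⟨sub_eq_zero.1 this.1, sub_eq_zero.1 this.2⟩
      · convert! (h.eq_snd n t).sub (h'.eq_snd n t) using 1
        rw [if_neg hn, if_neg hn, ofReal_bracket_sq]
        ring
  funext t
  exact Prod.ext (eq_of_coeff_eq fun n => (key t n).1) (eq_of_coeff_eq fun n => (key t n).2)

lemma hasDerivAt_cos_mul (k t : ℝ) :
    HasDerivAt (fun τ : ℝ => ((Real.cos (k * τ) : ℝ) : ℂ)) (-(k : ℂ) * (Real.sin (k * t) : ℝ)) t := by
  have h := (((hasDerivAt_id t).const_mul k).cos).ofReal_comp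
  convert! h using 1
  simp
  ring

lemma hasDerivAt_sin_mul (k t : ℝ) :
    HasDerivAt (fun τ : ℝ => ((Real.sin (k * τ) : ℝ) : ℂ)) ((k : ℂ) * (Real.cos (k * t) : ℝ)) t := by
  have h := (((hasDerivAt_id t).const_mul k).sin).ofReal_comp
  convert! h using 1
  simp
  ring

lemma norm_sq_cos_sin_le (θ : ℝ) (x y : ℂ) :
    ‖((Real.cos θ : ℝ) : ℂ) * x + ((Real.sin θ : ℝ) : ℂ) * y‖ ^ 2 ≤ 2 * (‖x‖ ^ 2 + ‖y‖ ^ 2) := by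
  have h1 : ‖((Real.cos θ : ℝ) : ℂ) * x‖ ≤ ‖x‖ := by
    rw [norm_mul, Complex.norm_real]
    exact mul_le_of_le_one_left (norm_nonneg _) (Real.abs_cos_le_one θ)
  have h2 : ‖((Real.sin θ : ℝ) : ℂ) * y‖ ≤ ‖y‖ := by
    rw [norm_mul, Complex.norm_real]
    exact mul_le_of_le_one_left (norm_nonneg _) (Real.abs_sin_le_one θ)
  have h3 : ‖((Real.cos θ : ℝ) : ℂ) * x + ((Real.sin θ : ℝ) : ℂ) * y‖ ≤ ‖x‖ + ‖y‖ :=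
    (norm_add_le _ _).trans (by linarith)
  have h0 := norm_nonneg (((Real.cos θ : ℝ) : ℂ) * x + ((Real.sin θ : ℝ) : ℂ) * y)
  nlinarith [sq_nonneg (‖x‖ - ‖y‖)]

/-- Frequencies in the ball follow the finite-dimensional flow. The others decouple and are given
explicitly by cosine and sine of `⟨n⟩t`. -/
lemma exists_isSolution (N : ℕ) {w : L2 × L2} (hw : MemH1 w.1) :
    ∃ W, IsSolution N W ∧ W 0 = w := by
  obtain ⟨x, hx0, hxr, hx, R, hR⟩ := exists_lowState (hB := neg_mem_ball (N := N))
    (isReal_lowPart neg_mem_ball w)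
  set a : ℝ → Freq → ℂ := fun t n => if n ∈ ball N then extend (ball N) (x t).1 n else
    ((Real.cos (bracket n * t) : ℝ) : ℂ) * coeff w.1 n +
      ((Real.sin (bracket n * t) : ℝ) : ℂ) * (coeff w.2 n / bracket n) with ha
  set b : ℝ → Freq → ℂ := fun t n => if n ∈ ball N then extend (ball N) (x t).2 n else
    ((Real.cos (bracket n * t) : ℝ) : ℂ) * coeff w.2 n +
      ((Real.sin (bracket n * t) : ℝ) : ℂ) * (-(bracket n * coeff w.1 n)) with hb
  have hnB : ∀ {n : Freq}, n ∉ ball N → -n ∉ ball N := fun h h' => h (by simpa using neg_mem_ball _ h')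
  have haB : ∀ t, ∀ n ∈ ball N, a t n = extend (ball N) (x t).1 n := fun t n hn => by simp only [ha, hn, if_true]
  have hfst : ∀ t, HasDerivAt (fun τ => (x τ).1) (lowField (ball N) (x t)).1 t := fun t =>
    (ContinuousLinearMap.fst ℝ (ball N → ℂ) (ball N → ℂ)).hasFDerivAt.comp_hasDerivAt t (hx t)
  have hsnd : ∀ t, HasDerivAt (fun τ => (x τ).2) (lowField (ball N) (x t)).2 t := fun t =>
    (ContinuousLinearMap.snd ℝ (ball N → ℂ) (ball N → ℂ)).hasFDerivAt.comp_hasDerivAt t (hx t)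
  -- A majorant independent of time: the energy bound `R` at finitely many frequencies and,
  -- elsewhere, 2 + 2 times the initial energy, from the squared sums of cosine and sine terms for
  -- `u` and for `v`.
  set M : Freq → ℝ := fun n => (if n ∈ ball N then R else 0) +
    4 * (bracket n ^ 2 * ‖coeff w.1 n‖ ^ 2 + ‖coeff w.2 n‖ ^ 2) with hMdef
  have hM : Summable M := by
    refine Summable.add ?_ ((hw.add (hasSum_normSq_coeff w.2).summable).mul_left 4)
    exact summable_of_ne_finset_zero (s := ball N) fun n hn => by simp [hn]
  have hmain : (∀ t n, coeff (series (a t)) n = a t n ∧ coeff (series (b t)) n = b t n) ∧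
      IsSolution N fun t => (series (a t), series (b t)) := by
    refine isSolution_series hM (fun t n => ?_) (fun t n => ?_) (fun t n => ?_) (fun n t => ?_)
      (fun n t => ?_)
    · have h0 : 0 ≤ bracket n ^ 2 * ‖coeff w.1 n‖ ^ 2 + ‖coeff w.2 n‖ ^ 2 := by positivity
      by_cases hn : n ∈ ball N
      · simp only [ha, hb, hMdef, hn, if_true]
        have h1 := Finset.single_le_sum (f := fun n => bracket n ^ 2 * ‖extend (ball N) (x t).1 n‖ ^ 2 +
          ‖extend (ball N) (x t).2 n‖ ^ 2) (fun m _ => by positivity) hn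
        have h2 : _ ≤ R := h1.trans (hR t)
        linarith
      · simp only [ha, hb, hMdef, hn, if_false]
        have hp := bracket_pos n
        have h1 := mul_le_mul_of_nonneg_left (norm_sq_cos_sin_le (bracket n * t) (coeff w.1 n)
          (coeff w.2 n / bracket n)) (sq_nonneg (bracket n))
        have h2 := norm_sq_cos_sin_le (bracket n * t) (coeff w.2 n) (-(bracket n * coeff w.1 n))
        rw [norm_div, Complex.norm_real, Real.norm_eq_abs, abs_of_pos hp] at h1
        rw [norm_neg, norm_mul, Complex.norm_real, Real.norm_eq_abs, abs_of_pos hp] at h2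
        have e1 : bracket n ^ 2 * (2 * (‖coeff w.1 n‖ ^ 2 + (‖coeff w.2 n‖ / bracket n) ^ 2)) =
            2 * (bracket n ^ 2 * ‖coeff w.1 n‖ ^ 2 + ‖coeff w.2 n‖ ^ 2) := by field_simp
        rw [e1] at h1
        linarith [mul_pow (bracket n) ‖coeff w.1 n‖ 2]
    · by_cases hn : n ∈ ball N
      · simp only [ha, hn, neg_mem_ball n hn, if_true, ((hxr t).extend_neg n).1]
      · simp only [ha, hn, hnB hn, if_false, coeff_neg, bracket_neg, map_add, map_mul, map_div₀,
          Complex.conj_ofReal]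
    · by_cases hn : n ∈ ball N
      · simp only [hb, hn, neg_mem_ball n hn, if_true, ((hxr t).extend_neg n).2]
      · simp only [hb, hn, hnB hn, if_false, coeff_neg, bracket_neg, map_add, map_mul, map_neg,
          Complex.conj_ofReal]
    · by_cases hn : n ∈ ball N
      · simp only [ha, hb, hn, if_true]
        exact hasDerivAt_extend (hfst t) n
      · simp only [ha, hb, hn, if_false]
        have hp := bracket_ne_zero n
        convert! ((hasDerivAt_cos_mul (bracket n) t).mul_const _).add
          ((hasDerivAt_sin_mul (bracket n) t).mul_const _) using 1
        field_simp
        ring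
    · by_cases hn : n ∈ ball N
      · rw [if_pos hn, cubeCoeff_congr (haB t)]
        simp only [ha, hb, hn, if_true]
        convert! hasDerivAt_extend (hsnd t) n using 1
        simp only [extend, hn, dif_pos, lowField]
        rw [ofReal_bracket_sq]
        ring
      · simp only [ha, hb, hn, if_false]
        have hp := bracket_ne_zero n
        convert! ((hasDerivAt_cos_mul (bracket n) t).mul_const _).add
          ((hasDerivAt_sin_mul (bracket n) t).mul_const _) using 1
        have := ofReal_bracket_sq n
        have e : (absSq n : ℂ) = (bracket n : ℂ) ^ 2 - 1 := by rw [this]; ring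
        rw [e]
        field_simp
        ring
  obtain ⟨hc, hsol⟩ := hmain
  refine ⟨_, hsol, Prod.ext (eq_of_coeff_eq fun n => ?_) (eq_of_coeff_eq fun n => ?_)⟩
  · refine (hc 0 n).1.trans ?_
    by_cases hn : n ∈ ball N
    · simp only [ha, hn, if_true, hx0, (extend_lowPart w hn).1]
    · simp [ha, hn]
  · refine (hc 0 n).2.trans ?_
    by_cases hn : n ∈ ball N
    · simp only [hb, hn, if_true, hx0, (extend_lowPart w hn).2]
    · simp [hb, hn]

theorem existsUnique_isSolution (N : ℕ) (w : L2 × L2) (hw : MemH1 w.1) :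
    ∃! W : ℝ → L2 × L2, IsSolution N W ∧ W 0 = w := by
  obtain ⟨W, hW, h0⟩ := exists_isSolution N hw
  exact ⟨W, ⟨hW, h0⟩, fun W' h => isSolution_unique h.1 hW (h.2.trans h0.symm)⟩

/-! ### The renormalized energy along the flow -/

lemma isSolution_flow (N : ℕ) {w : L2 × L2} (hw : MemH1 w.1) :
    IsSolution N (fun t => flow N t w) ∧ flow N 0 w = w := by
  have h := exists_isSolution N hw
  have e : ∀ t, flow N t w = h.choose t := fun t => by rw [flow, dif_pos h]
  simp only [e]
  exact h.choose_spec

lemma hasDerivAt_energyAlongFlow (s N : ℕ) {w : L2 × L2} (hw : MemH1 w.1) :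
    HasDerivAt (energyAlongFlow s N w)
      (energyRate s (sigma s N) (ball N) (coeff w.1) (coeff w.2)).re 0 := by
  obtain ⟨hsol, h0⟩ := isSolution_flow N hw
  have h := hasDerivAt_energyPoly s (sigma s N) (B := ball N) neg_mem_ball
    (a := fun t => coeff (flow N t w).1) (b := fun t => coeff (flow N t w).2) (t := 0)
    (fun n => hsol.eq_fst n 0) (fun n => by simpa only [coeff_proj_pow] using hsol.eq_snd n 0)
  rw [h0] at h
  have h2 := Complex.reCLM.hasFDerivAt.comp_hasDerivAt (0 : ℝ) h
  refine h2.congr_of_eventuallyEq (Eventually.of_forall fun t => ?_)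
  change renormEnergy s N _ _ = Complex.re _
  rw [← ofReal_renormEnergy, Complex.ofReal_re]

/-- The factor 2 undoes the 1/2 in the energy; the quartic term and the high frequencies are
nonnegative and are dropped. -/
lemma quadEnergy_le_of_mem_energySublevel {N : ℕ} {r : ℝ} {w : L2 × L2}
    (hw : w ∈ energySublevel N r) : quadEnergy (ball N) (coeff w.1) (coeff w.2) ≤ 2 * r := by
  obtain ⟨h1, h2⟩ := hw
  unfold truncEnergy h1NormSq at h2
  rw [integral_sq_eq_norm_sq] at h2
  have h4 : 0 ≤ ∫ x, proj N w.1 x ^ 4 ∂haar := integral_nonneg fun x => by positivity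
  have h5 := h1.sum_le_tsum (ball N) fun n _ => by positivity
  have h6 := sum_le_hasSum (ball N) (fun n _ => by positivity) (hasSum_normSq_coeff w.2)
  unfold quadEnergy
  rw [Finset.sum_add_distrib]
  linarith

lemma moment_bound {s : ℕ} (hs : 2 ≤ s) (r : ℝ) (N : ℕ) {p : ℝ} (hp : 2 ≤ p) :
    IntegrableOn (fun w => |deriv (energyAlongFlow s N w) 0| ^ p) (energySublevel N r) (mu s) ∧
      (∫ w in energySublevel N r, |deriv (energyAlongFlow s N w) 0| ^ p ∂mu s) ^ (1 / p) ≤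
        64 * rateConst s (2 * r) * p := by
  have hp0 : 0 < p := by linarith
  have hK := rateConst_pos s (2 * r)
  set g : L2 × L2 → ℝ := fun w =>
    |(energyRate s (sigma s N) (ball N) (coeff w.1) (coeff w.2)).re| ^ p with hg
  set S : Set (L2 × L2) := {w | quadEnergy (ball N) (coeff w.1) (coeff w.2) ≤ 2 * r} with hS
  have hgm : Measurable g := by
    have hm := measurable_energyRate s (sigma s N) (ball N) (a := fun w : L2 × L2 => coeff w.1)
      (b := fun w : L2 × L2 => coeff w.2) (fun n => (measurable_coeff n).comp measurable_fst)
      (fun n => (measurable_coeff n).comp measurable_snd)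
    exact ((Complex.measurable_re.comp hm).norm).pow_const p
  have hg0 : ∀ w, 0 ≤ g w := fun w => by positivity
  have hle : ∫⁻ w in S, ENNReal.ofReal (g w) ∂mu s ≤
      ENNReal.ofReal ((64 * rateConst s (2 * r) * p) ^ p) := by
    refine le_trans (lintegral_mono fun w => ENNReal.ofReal_le_ofReal ?_)
      (lintegral_mu_rpow_le hs (2 * r) N (by linarith))
    exact Real.rpow_le_rpow (abs_nonneg _) (Complex.abs_re_le_norm _) hp0.le
  have hint : IntegrableOn g S (mu s) := by
    refine ⟨hgm.aestronglyMeasurable, ?_⟩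
    rw [hasFiniteIntegral_iff_ofReal (ae_of_all _ hg0)]
    exact hle.trans_lt ENNReal.ofReal_lt_top
  -- The sublevel set is enlarged to `S`, which involves only the frequencies in the ball, where the
  -- moment bound is available.
  have hsub : energySublevel N r ⊆ S := fun w hw => quadEnergy_le_of_mem_energySublevel hw
  have hae : ∀ᵐ w ∂(mu s).restrict (energySublevel N r),
      g w = |deriv (energyAlongFlow s N w) 0| ^ p := by
    filter_upwards [ae_restrict_of_ae (ae_memH1 hs)] with w hw
    rw [(hasDerivAt_energyAlongFlow s N hw).deriv]
  refine ⟨(hint.mono_set hsub).congr hae, ?_⟩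
  have hI : ∫ w in energySublevel N r, |deriv (energyAlongFlow s N w) 0| ^ p ∂mu s ≤
      (64 * rateConst s (2 * r) * p) ^ p := by
    rw [← integral_congr_ae hae]
    refine (setIntegral_mono_set hint (ae_of_all _ hg0) hsub.eventuallyLE).trans ?_
    rw [integral_eq_lintegral_of_nonneg_ae (ae_of_all _ hg0) hgm.aestronglyMeasurable]
    exact ENNReal.toReal_le_of_le_ofReal (by positivity) hle
  have h0 : 0 ≤ ∫ w in energySublevel N r, |deriv (energyAlongFlow s N w) 0| ^ p ∂mu s :=
    integral_nonneg fun w => by positivity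
  calc _ ≤ ((64 * rateConst s (2 * r) * p) ^ p) ^ (1 / p) :=
        Real.rpow_le_rpow h0 hI (by positivity)
    _ = _ := by
      rw [← Real.rpow_mul (by positivity), mul_one_div_cancel hp0.ne', Real.rpow_one]

end NLKG

end

theorem theorem1p3 (s : ℕ) (hs : 2 ≤ s) (hs_even : Even s) :
    -- the truncated equation is globally well-posed, so that its flow is defined on `H¹ × L²`
    (∀ (N : ℕ) (w : NLKG.L2 × NLKG.L2), NLKG.MemH1 w.1 →
      ∃! W : ℝ → NLKG.L2 × NLKG.L2, NLKG.IsSolution N W ∧ W 0 = w) ∧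
    -- the renormalized energy is differentiable in time at `t = 0` along the flow
    (∀ (N : ℕ) (w : NLKG.L2 × NLKG.L2), NLKG.MemH1 w.1 →
      DifferentiableAt ℝ (NLKG.energyAlongFlow s N w) 0) ∧
    -- the renormalized energy estimate
    (∀ r : ℝ, 0 < r → ∃ C : ℝ, ∀ (N : ℕ) (p : ℝ), 2 ≤ p →
      MeasureTheory.IntegrableOn
        (fun w => |deriv (NLKG.energyAlongFlow s N w) 0| ^ p)
        (NLKG.energySublevel N r) (NLKG.mu s) ∧
      (∫ w in NLKG.energySublevel N r,
        |deriv (NLKG.energyAlongFlow s N w) 0| ^ p ∂(NLKG.mu s)) ^ (1 / p) ≤ C * p) := by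
  refine ⟨fun N w hw => NLKG.existsUnique_isSolution N w hw,
    fun N w hw => (NLKG.hasDerivAt_energyAlongFlow s N hw).differentiableAt,
    fun r _ => ⟨64 * NLKG.rateConst s (2 * r), fun N p hp => NLKG.moment_bound hs r N hp⟩⟩
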